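/- **Setting.** A based Gauss diagram $G$ of a (long virtual) knot is an oriented circle with a base point and $n$ signed arrows joining $2n$ distinct points of the circle (arrows point from the overpass to the underpass; the sign is the writhe of the crossing). An arrow diagram $A$ is the same without signs. Let $\Sigma(A)$ be the oriented surface obtained from the disk bounded by the circle by gluing an untwisted ribbon along each arrow. If $\Sigma(A)$ has exactly one boundary component, $A$ is called *ascending* (*descending*) if, following $\partial\Sigma(A)$ from the base point, one passes each ribbon for the first time against (along) the direction of its arrow. Let $\langle A,G\rangle=\sum_{\phi:A\to G}\prod_{\alpha}\operatorname{sign}(\phi(\alpha))$, where $\phi$ runs over the embeddings of based diagrams and $\alpha$ over the arrows of $A$, and put $$\nabla_A(G)=\sum_{k\ge 0}z^k\sum_{A\ \text{ascending},\ k\ \text{arrows}}\langle A,G\rangle,\qquad \nabla_D(G)=\sum_{k\ge 0}z^k\sum_{A\ \text{descending},\ k\ \text{arrows}}\langle A,G\rangle,$$ and $\nabla_{A-D}(G)=\nabla_A(G)-\nabla_D(G)$. A long virtual knot is a class of based Gauss diagrams modulo Reidemeister moves away from the base point; a virtual knot is a class modulo Reidemeister moves and moves of the base point; a virtual knot is classical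 if it is represented by the Gauss diagram of a planar knot diagram. Let $K_T$ be the Kishino knot, with cyclic Gauss code $U_1O_2O_1U_2\,O_3U_4U_3O_4$ ($O$ = over, $U$ = under) and signs $\varepsilon,-\varepsilon,\delta,-\delta$ of the crossings $1,2,3,4$; all choices $\varepsilon,\delta\in\{1,-1\}$ are allowed. Let $G$ be its Gauss diagram with base point between $U_4$ and $U_3$, and $\widehat G$ the one with base point between $O_2$ and $O_1$. **Proposition.** The polynomials $\nabla_A$, $\nabla_D$ and $\nabla_{A-D}$ detect that the Kishino knot is non-classical, in the following sense. 1. $\nabla_A$, $\nabla_D$ and $\nabla_{A-D}$ are invariants of long virtual knots. 2. If $H$ is the Gauss diagram of a planar diagram of a classical knot, then $\nabla_A(H)$, $\nabla_D(H)$ and $\nabla_{A-D}(H)$ do not depend on the position of the base point, and $\nabla_{A-D}(H)=0$. 3. For the Kishino knot, in contrast, $$\nabla_A(G)=1-2z^2+z^4,\quad \nabla_D(G)=1,\quad \nabla_{A-D}(G)=-2z^2+z^4,$$ $$\nabla_A(\widehat G)=1,\quad \nabla_D(\widehat G)=1-2z^2+z^4,\quad \nabla_{A-D}(\widehat G)=2z^2-z^4.$$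 4. $K_T$ is not a classical knot: no Gauss diagram of a planar knot diagram represents the same virtual knot as $K_T$. -/

import Mathlib

open Polynomial

/-- A based arrow diagram with one circle and `n` arrows, up to orientation-preserving
diffeomorphism.  The `2 * n` end points of the arrows are numbered `0, 1, …, 2 * n - 1` in the order
in which they are met when one follows the circle from the base point.  The two end points of an
arrow are exchanged by `partner`, and exactly one of them is the head. -/
structure ArrowDiagram (n : ℕ) where
  partner : Fin (2 * n) → Fin (2 * n)
  partner_partner : ∀ i, partner (partner i) = i
  isHead : Fin (2 * n) → Bool
  isHead_partner : ∀ i, isHead (partner i) = !isHead i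

/-- A based Gauss diagram with one circle and `n` arrows, that is, a Gauss diagram of a long virtual
knot: a based arrow diagram in which every arrow has a sign.  Arrows point from the overpass to the
underpass, and the sign of an arrow is the writhe of the crossing. -/
structure GaussDiagram (n : ℕ) extends ArrowDiagram n where
  sign : Fin (2 * n) → ℤˣ
  sign_partner : ∀ i, sign (partner i) = sign i

namespace ArrowDiagram

variable {n : ℕ}

lemma partner_involutive (A : ArrowDiagram n) : Function.Involutive A.partner := A.partner_partner

noncomputable instance : Fintype (ArrowDiagram n) :=
  Fintype.ofInjective (fun A : ArrowDiagram n => (A.partner, A.isHead)) (by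
    rintro ⟨p, hp, t, ht⟩ ⟨p', hp', t', ht'⟩ h
    simp only [Prod.mk.injEq] at h
    obtain ⟨rfl, rfl⟩ := h
    rfl)

/-- The passage along the boundary of the surface `Σ(A)`, which is made of the disk bounded by the
circle and of one untwisted ribbon along each arrow.  A passage that follows the circle and comes to
the end point `i` runs along the ribbon to the other end point of that arrow, and then follows the
circle again to the next end point. -/
def trace (A : ArrowDiagram n) : Equiv.Perm (Fin (2 * n)) :=
  A.partner_involutive.toPerm.trans (finRotate (2 * n))

/-- The number of boundary components of `Σ(A)`.  (Without arrows, `Σ(A)` is a disk.) -/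
noncomputable def boundaryComponents (A : ArrowDiagram n) : ℕ :=
  if n = 0 then 1 else Nat.card (Quotient (Equiv.Perm.SameCycle.setoid A.trace))

/-- Every arrow is met for the first time at its head, in the passage along the boundary of `Σ(A)`
that starts at the base point: whenever the passage comes to a tail, it came to the head of the same
arrow before.  That is, every ribbon is passed first in the direction opposite to its arrow. -/
def FirstAtHead (A : ArrowDiagram n) : Prop :=
  ∀ start : Fin (2 * n), start.val = 0 → ∀ k : ℕ, A.isHead ((A.trace ^ k) start) = false →
    ∃ l < k, (A.trace ^ l) start = A.partner ((A.trace ^ k) start)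

/-- Every arrow is met for the first time at its tail. -/
def FirstAtTail (A : ArrowDiagram n) : Prop :=
  ∀ start : Fin (2 * n), start.val = 0 → ∀ k : ℕ, A.isHead ((A.trace ^ k) start) = true →
    ∃ l < k, (A.trace ^ l) start = A.partner ((A.trace ^ k) start)

/-- Ascending arrow diagrams with one boundary component. -/
def IsAscending (A : ArrowDiagram n) : Prop := A.boundaryComponents = 1 ∧ A.FirstAtHead

/-- Descending arrow diagrams with one boundary component. -/
def IsDescending (A : ArrowDiagram n) : Prop := A.boundaryComponents = 1 ∧ A.FirstAtTail

/-- Homomorphisms `A → G` of based diagrams.  An orientation preserving homeomorphism of the circles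
that respects the base points and maps arrows injectively to arrows is determined, as far as the
diagrams are concerned, by the increasing map that it induces on end points. -/
structure IsHom {k n : ℕ} (A : ArrowDiagram k) (G : ArrowDiagram n)
    (f : Fin (2 * k) → Fin (2 * n)) : Prop where
  strictMono : StrictMono f
  map_partner : ∀ i, f (A.partner i) = G.partner (f i)
  map_isHead : ∀ i, G.isHead (f i) = A.isHead i

end ArrowDiagram

namespace GaussDiagram

variable {n : ℕ}

open Classical in
/-- The pairing `⟨A, G⟩`: the sum over the homomorphisms `A → G` of the product of the signs of the
arrows in the image.  (Each arrow is counted once, at its head.) -/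
noncomputable def pairing {k : ℕ} (A : ArrowDiagram k) (G : GaussDiagram n) : ℤ :=
  ∑ f : Fin (2 * k) → Fin (2 * n) with A.IsHom G.toArrowDiagram f,
    ∏ i : Fin (2 * k) with A.isHead i = true, ((G.sign (f i) : ℤˣ) : ℤ)

open Classical in
/-- The sum of `⟨A, G⟩` over all ascending `A` with `k` arrows and one boundary component. -/
noncomputable def ascCount (G : GaussDiagram n) (k : ℕ) : ℤ :=
  ∑ A : ArrowDiagram k with A.IsAscending, G.pairing A

open Classical in
/-- The sum of `⟨A, G⟩` over all descending `A` with `k` arrows and one boundary component. -/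
noncomputable def descCount (G : GaussDiagram n) (k : ℕ) : ℤ :=
  ∑ A : ArrowDiagram k with A.IsDescending, G.pairing A

/-- The polynomial `∇_A(G) = ∑ₖ Aₖ(G) zᵏ`.  There are no terms with `k > n`, see `coeff_nablaA`. -/
noncomputable def nablaA (G : GaussDiagram n) : ℤ[X] :=
  ∑ k ∈ Finset.range (n + 1), C (G.ascCount k) * X ^ k

/-- The polynomial `∇_D(G) = ∑ₖ Dₖ(G) zᵏ`.  There are no terms with `k > n`, see `coeff_nablaD`. -/
noncomputable def nablaD (G : GaussDiagram n) : ℤ[X] :=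
  ∑ k ∈ Finset.range (n + 1), C (G.descCount k) * X ^ k

/-- The polynomial `∇_{A-D}(G) = ∇_A(G) - ∇_D(G)`. -/
noncomputable def nablaAD (G : GaussDiagram n) : ℤ[X] := G.nablaA - G.nablaD

lemma pairing_eq_zero {k : ℕ} (A : ArrowDiagram k) (G : GaussDiagram n) (h : n < k) :
    G.pairing A = 0 := by
  classical
  unfold pairing
  refine Finset.sum_eq_zero fun f hf => ?_
  have hf' := (Finset.mem_filter.mp hf).2.strictMono.injective
  have := Fintype.card_le_of_injective f hf'
  simp only [Fintype.card_fin] at this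
  omega

/-- The coefficients of `∇_A(G)` are the numbers `Aₖ(G)`, for all `k`. -/
lemma coeff_nablaA (G : GaussDiagram n) (k : ℕ) : G.nablaA.coeff k = G.ascCount k := by
  simp only [nablaA, finsetSum_coeff, coeff_C_mul_X_pow]
  rw [Finset.sum_ite_eq]
  split_ifs with h
  · rfl
  · rw [Finset.mem_range] at h
    exact (Finset.sum_eq_zero fun A _ => pairing_eq_zero A G (by omega)).symm

/-- The coefficients of `∇_D(G)` are the numbers `Dₖ(G)`, for all `k`. -/
lemma coeff_nablaD (G : GaussDiagram n) (k : ℕ) : G.nablaD.coeff k = G.descCount k := by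
  simp only [nablaD, finsetSum_coeff, coeff_C_mul_X_pow]
  rw [Finset.sum_ite_eq]
  split_ifs with h
  · rfl
  · rw [Finset.mem_range] at h
    exact (Finset.sum_eq_zero fun A _ => pairing_eq_zero A G (by omega)).symm

/-- The diagram obtained from `G` by moving every end point `i` to the place `σ i`. -/
def transport (G : GaussDiagram n) (σ : Equiv.Perm (Fin (2 * n))) : GaussDiagram n where
  partner i := σ (G.partner (σ.symm i))
  partner_partner i := by simp [G.partner_partner]
  isHead i := G.isHead (σ.symm i)
  isHead_partner i := by simp [G.isHead_partner]
  sign i := G.sign (σ.symm i)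
  sign_partner i := by simp [G.sign_partner]

/-- The same Gauss diagram with the base point moved forward across `j` end points: the end point
that was numbered `i + j` (modulo `2 * n`) is now numbered `i`. -/
def basedAt (G : GaussDiagram n) (j : ℕ) : GaussDiagram n :=
  G.transport ((finRotate (2 * n) ^ j).symm)

/-! ### Reidemeister moves and virtual knots -/

/-- `f` identifies `G` with the diagram that is left of `G'` when the arrows of `G'` outside of the
image of `f` are erased. -/
structure IsEmbedding {m n : ℕ} (G : GaussDiagram m) (G' : GaussDiagram n)
    (f : Fin (2 * m) → Fin (2 * n)) : Prop
    extends ArrowDiagram.IsHom G.toArrowDiagram G'.toArrowDiagram f where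
  map_sign : ∀ i, G'.sign (f i) = G.sign i

/-- The first Reidemeister move: `G'` has one more arrow than `G`, of any sign and direction, and
its end points `p`, `p'` are neighbours. -/
def Omega1 (G : GaussDiagram n) (G' : GaussDiagram (n + 1)) : Prop :=
  ∃ f, G.IsEmbedding G' f ∧ ∃ p p', p'.val = p.val + 1 ∧ G'.partner p = p' ∧
    ∀ i, f i ≠ p ∧ f i ≠ p'

/-- The second Reidemeister move: `G'` has two more arrows than `G`, of opposite signs, whose tails
`p`, `p'` are neighbours and whose heads `q`, `q'` are neighbours. -/
def Omega2 (G : GaussDiagram n) (G' : GaussDiagram (n + 2)) : Prop :=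
  ∃ f, G.IsEmbedding G' f ∧ ∃ p p' q q', p'.val = p.val + 1 ∧ q'.val = q.val + 1 ∧
    G'.isHead p = false ∧ G'.isHead p' = false ∧
    ((G'.partner p = q ∧ G'.partner p' = q') ∨ (G'.partner p = q' ∧ G'.partner p' = q)) ∧
    G'.sign p' = -G'.sign p ∧
    ∀ i, f i ≠ p ∧ f i ≠ p' ∧ f i ≠ q ∧ f i ≠ q'

/-- The third Reidemeister move (all its oriented versions).  It involves three arrows, with tails
`a`, `b`, `c`: the first one leads from the top strand to the middle strand, the second one from the
top strand to the bottom strand, and the third one from the middle strand to the bottom strand.  On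
each of the three strands the two end points are neighbours, and the move exchanges them.  The
equations say which orders of the end points on the three strands occur for given signs in three
pairwise crossing oriented lines: writing `o_T = 1` if the end point of the first arrow precedes that
of the second arrow on the top strand and `o_T = -1` otherwise, and similarly `o_M` (first and third
arrow) and `o_B` (second and third arrow), one has
`(o_T, o_M, o_B) = ±(sign b, sign c, sign a * sign b * sign c)`. -/
def Omega3 (G G' : GaussDiagram n) : Prop :=
  ∃ a b c : Fin (2 * n), a ≠ c ∧
    G.isHead a = false ∧ G.isHead b = false ∧ G.isHead c = false ∧
    (∃ η : ℤˣ,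
      (b.val : ℤ) - a.val = (η * G.sign b : ℤˣ) ∧
      (c.val : ℤ) - (G.partner a).val = (η * G.sign c : ℤˣ) ∧
      ((G.partner c).val : ℤ) - (G.partner b).val =
        (η * (G.sign a * G.sign b * G.sign c) : ℤˣ)) ∧
    G' = G.transport
      (Equiv.swap a b * Equiv.swap (G.partner a) c * Equiv.swap (G.partner b) (G.partner c))

/-- A Reidemeister move of Gauss diagrams, applied away from the base point. -/
inductive ReidemeisterMove : (Σ n, GaussDiagram n) → (Σ n, GaussDiagram n) → Prop
  | omega1 {n : ℕ} {G : GaussDiagram n} {G' : GaussDiagram (n + 1)} (h : Omega1 G G') :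
      ReidemeisterMove ⟨n, G⟩ ⟨n + 1, G'⟩
  | omega2 {n : ℕ} {G : GaussDiagram n} {G' : GaussDiagram (n + 2)} (h : Omega2 G G') :
      ReidemeisterMove ⟨n, G⟩ ⟨n + 2, G'⟩
  | omega3 {n : ℕ} {G G' : GaussDiagram n} (h : Omega3 G G') : ReidemeisterMove ⟨n, G⟩ ⟨n, G'⟩

/-- A Reidemeister move, or a move of the base point across an end point. -/
inductive VirtualKnotMove : (Σ n, GaussDiagram n) → (Σ n, GaussDiagram n) → Prop
  | reidemeister {G G' : Σ n, GaussDiagram n} (h : ReidemeisterMove G G') : VirtualKnotMove G G'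
  | basePoint {n : ℕ} (G : GaussDiagram n) : VirtualKnotMove ⟨n, G⟩ ⟨n, G.basedAt 1⟩

/-- The two based Gauss diagrams represent the same long virtual knot. -/
def LongEquiv {m n : ℕ} (G : GaussDiagram m) (G' : GaussDiagram n) : Prop :=
  Relation.EqvGen ReidemeisterMove ⟨m, G⟩ ⟨n, G'⟩

/-- The two Gauss diagrams, with their base points forgotten, represent the same virtual knot. -/
def VirtualEquiv {m n : ℕ} (G : GaussDiagram m) (G' : GaussDiagram n) : Prop :=
  Relation.EqvGen VirtualKnotMove ⟨m, G⟩ ⟨n, G'⟩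

/-! ### Classical knots -/

/-- Each crossing of a knot diagram has four half-edges.  `(i, true)` is the half-edge that leaves
the crossing after the end point `i` has been passed, and `(i, false)` is the half-edge along which
the strand comes to `i`.  This is the other half of the edge to which a half-edge belongs. -/
def otherHalf (_G : GaussDiagram n) : Equiv.Perm (Fin (2 * n) × Bool) where
  toFun x := if x.2 then (finRotate (2 * n) x.1, false) else ((finRotate (2 * n)).symm x.1, true)
  invFun x := if x.2 then (finRotate (2 * n) x.1, false) else ((finRotate (2 * n)).symm x.1, true)
  left_inv := by rintro ⟨i, _ | _⟩ <;> simp [-finRotate_apply, -finRotate_symm_apply]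
  right_inv := by rintro ⟨i, _ | _⟩ <;> simp [-finRotate_apply, -finRotate_symm_apply]

/-- Whether the other strand of the crossing passes, as seen from the strand through `i`, from the
left to the right. -/
def crossesRightward (G : GaussDiagram n) (i : Fin (2 * n)) : Bool :=
  (G.isHead i).xor (decide (G.sign i = -1))

/-- The next half-edge at the same crossing, counterclockwise.  At a positive crossing the
counterclockwise order is: over out, under out, over in, under in.  At a negative crossing it is:
over out, under in, over in, under out. -/
def nextHalf (G : GaussDiagram n) : Equiv.Perm (Fin (2 * n) × Bool) where
  toFun x := (G.partner x.1, x.2.xor (G.crossesRightward x.1))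
  invFun x := (G.partner x.1, x.2.xor (G.crossesRightward (G.partner x.1)))
  left_inv := by rintro ⟨i, d⟩; simp [G.partner_partner]
  right_inv := by rintro ⟨i, d⟩; simp [G.partner_partner]

/-- The number of faces: complementary regions of the 4-valent graph of the diagram in the closed
oriented surface in which it is cellularly embedded with the given cyclic orders at the crossings. -/
noncomputable def faces (G : GaussDiagram n) : ℕ :=
  Nat.card (Quotient (Equiv.Perm.SameCycle.setoid (G.otherHalf.trans G.nextHalf)))

/-- `G` is the Gauss diagram of a classical knot diagram, a diagram in the plane or, equivalently,
in the sphere: either there are no crossings, or the 4-valent connected graph of the diagram, with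
the cyclic orders at its `n` vertices and its `2 * n` edges, has Euler characteristic `2`. -/
def IsClassical (G : GaussDiagram n) : Prop :=
  n = 0 ∨ (n : ℤ) - 2 * n + G.faces = 2

/-- The virtual knot represented by `G` (with the base point forgotten) is a classical knot. -/
def RepresentsClassicalKnot (G : GaussDiagram n) : Prop :=
  ∃ (m : ℕ) (H : GaussDiagram m), H.IsClassical ∧ VirtualEquiv G H

end GaussDiagram

/-- The Gauss diagram of the Kishino knot with Gauss code `U1 O2 O1 U2 O3 U4 U3 O4` and signs `ε`,
`-ε`, `δ`, `-δ` of the crossings `1`, `2`, `3`, `4`.  It is the connected sum of the diagrams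
`U1 O2 O1 U2` and `O3 U4 U3 O4` of the trivial knot, and it is based at a point of connection. -/
def kishino (ε δ : ℤˣ) : GaussDiagram 4 where
  partner := ![2, 3, 0, 1, 6, 7, 4, 5]
  partner_partner := by decide
  isHead := ![true, false, false, true, false, true, true, false]
  isHead_partner := by decide
  sign := ![ε, -ε, ε, -ε, δ, -δ, δ, -δ]
  sign_partner := by intro i; fin_cases i <;> rfl

/-- The Kishino knot cut between the crossing points `U4` and `U3`. -/
def kishinoG (ε δ : ℤˣ) : GaussDiagram 4 := (kishino ε δ).basedAt 6

/-- The Kishino knot cut between the crossing points `O2` and `O1`. -/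
def kishinoG' (ε δ : ℤˣ) : GaussDiagram 4 := (kishino ε δ).basedAt 2

/-! Invariance. Both polynomials are state sums over sets of arrows. A set of arrows is recorded as
a set `S` of end points closed under `partner`, and it counts if a potential exists (`Ascends`): a
function that increases along the walk round the surface with ribbons in `S`, except on arrival at
the base point, and that is smaller at heads than at tails. This encodes both the single boundary
component and the order of the passages, and it survives the erasing of arrows outside `S`
(`ascends_image_iff`). Reversing all arrows turns the descending sum into the ascending one. The
first Reidemeister move creates no new states, since an isolated arrow bounds a component of its
own. In the second move no state contains both arrows, and the states with exactly one of them
cancel in pairs. For the third move the outside of the triangle enters only through the way in which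
the three strands are connected and the order in which they are entered. For each such pattern and
each number of arrows the local signed counts before and after the move agree, which is a finite
check (`signedCount_not_aux`, `sum_good_not`).

Classical diagrams. The equality of the two polynomials comes from the Alexander polynomial. The
normalized determinant `burauDet` of a Burau type matrix satisfies a skein relation
(`burauDet_skein`). Walking from the base point and applying this relation at each crossing that is
first met at its head expresses the determinant as a sum over ascending sets (`exploration`); the
same walk on the reversed diagram, with over and under exchanged, gives the sum over descending
sets. Leaves of the skein tree with several components contribute zero, and the leaves with one
component contribute the same power of `q` in both trees. Planarity enters twice: through an
eigenvector built from a height function on the edges, and through `firstSum_eq`, by which the signs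
at first passages have a sum that does not depend on the smoothed arrows. Since `q⁻¹ - q` takes
every real value, the polynomials agree (`ascSum_flip`). Independence of the base point follows:
crossing a tail does not change the ascending sum, crossing a head does not change the descending
one, and for classical diagrams the two sums are equal.

Height functions come from a dimension count. Flows on the edges are orthogonal to differences of
functions on the crossings, so they have dimension at most `n + 1`; the jumps of functions on `n +
2` faces already fill this dimension (`exists_faceJump_eq`).

The Kishino knot. The polynomials are evaluated directly. Since they are only invariants of long
knots, another argument is used for non-classicality: the flat invariant `loopInvariant`, cubic in
the indices and intersection numbers of the loops at the crossings, is unchanged by all moves,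
including those of the base point. In a planar diagram every loop has index zero, so the invariant
vanishes, whereas it is nonzero for all choices of signs of the Kishino diagram. -/

/-! ### The linear and the cyclic order of points on the circle -/

/-- The sign of `y - x`. -/
def posSign {m : ℕ} (x y : Fin m) : ℤ :=
  if x.val < y.val then 1 else if y.val < x.val then -1 else 0

/-- The cyclic order of three points on the circle: `1` or `-1` for distinct points, and `0`
otherwise. -/
def cyclicSign {m : ℕ} (x y z : Fin m) : ℤ := posSign x y * posSign y z * posSign x z

lemma posSign_comp {m n : ℕ} {f : Fin m → Fin n} (hf : StrictMono f) (x y : Fin m) :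
    posSign (f x) (f y) = posSign x y := by
  have h1 : (f x).val < (f y).val ↔ x.val < y.val := hf.lt_iff_lt
  have h2 : (f y).val < (f x).val ↔ y.val < x.val := hf.lt_iff_lt
  simp only [posSign, h1, h2]

lemma cyclicSign_comp {m n : ℕ} {f : Fin m → Fin n} (hf : StrictMono f) (x y z : Fin m) :
    cyclicSign (f x) (f y) (f z) = cyclicSign x y z := by
  simp only [cyclicSign, posSign_comp hf]

lemma finRotate_val {m : ℕ} (i : Fin m) :
    (finRotate m i).val = if i.val + 1 = m then 0 else i.val + 1 := by
  cases m with
  | zero => exact i.elim0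
  | succ m =>
    split_ifs with h
    · have : i = Fin.last m := Fin.ext (by simpa using h)
      subst this
      simp
    · rw [coe_finRotate_of_ne_last]
      intro hi
      apply h
      simp [hi]

lemma posSign_swap {m : ℕ} (x y : Fin m) : posSign y x = -posSign x y := by
  simp only [posSign]
  split_ifs <;> first | rfl | omega

lemma posSign_mul_self {m : ℕ} {x y : Fin m} (h : x ≠ y) : posSign x y * posSign x y = 1 := by
  have h1 : x.val ≠ y.val := fun h' => h (Fin.ext h')
  simp only [posSign]
  split_ifs <;> first | rfl | omega

/-- A rotation moves the last point to the front and keeps the order of all others, so each argument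
contributes a sign exactly if it is the last point. -/
lemma posSign_finRotate {m : ℕ} (x y : Fin m) : posSign (finRotate m x) (finRotate m y) =
    (if x.val + 1 = m then -1 else 1) * (if y.val + 1 = m then -1 else 1) * posSign x y := by
  have hx := x.isLt
  have hy := y.isLt
  simp only [posSign, finRotate_val]
  generalize x.val = a at *
  generalize y.val = b at *
  by_cases ha : a + 1 = m <;> by_cases hb : b + 1 = m <;> simp only [ha, hb, if_true, if_false] <;>
    split_ifs <;> first | rfl | omega

/-- Each of the three points occurs in two of the three factors, so the signs of `posSign_finRotate`
cancel. -/
lemma cyclicSign_finRotate {m : ℕ} (x y z : Fin m) :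
    cyclicSign (finRotate m x) (finRotate m y) (finRotate m z) = cyclicSign x y z := by
  simp only [cyclicSign, posSign_finRotate]
  split_ifs <;> ring

lemma cyclicSign_swap {m : ℕ} (x y z : Fin m) : cyclicSign z y x = -cyclicSign x y z := by
  simp only [cyclicSign, posSign_swap x y, posSign_swap y z, posSign_swap x z]
  ring

lemma cyclicSign_rotate {m : ℕ} (x y z : Fin m) : cyclicSign y z x = cyclicSign x y z := by
  simp only [cyclicSign, posSign_swap x y, posSign_swap x z]
  ring

lemma cyclicSign_self_left {m : ℕ} (x z : Fin m) : cyclicSign x x z = 0 := by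
  simp [cyclicSign, posSign]

lemma cyclicSign_self_right {m : ℕ} (x z : Fin m) : cyclicSign z x x = 0 := by
  simp [cyclicSign, posSign]

/-! ### Intersection numbers of loops and a flat invariant -/

namespace GaussDiagram

variable {n : ℕ} (G : GaussDiagram n)

/-- The sign of the intersection of the strand through `z` with the other strand of the crossing:
the writhe if `z` is the overpass, and the opposite of the writhe otherwise. -/
def flatSign (z : Fin (2 * n)) : ℤ := if G.isHead z = true then -(G.sign z : ℤ) else (G.sign z : ℤ)

lemma flatSign_partner (z : Fin (2 * n)) : G.flatSign (G.partner z) = -G.flatSign z := by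
  simp only [flatSign, G.isHead_partner, G.sign_partner]
  cases G.isHead z <;> simp

lemma sum_partner {M : Type*} [AddCommMonoid M] (g : Fin (2 * n) → M) :
    ∑ z, g (G.partner z) = ∑ z, g z :=
  Equiv.sum_comp G.partner_involutive.toPerm g

lemma partner_ne (z : Fin (2 * n)) : G.partner z ≠ z := by
  intro h
  have := G.isHead_partner z
  rw [h] at this
  cases hb : G.isHead z <;> simp [hb] at this

lemma sum_flatSign : ∑ z, G.flatSign z = 0 := by
  have h := G.sum_partner G.flatSign
  simp only [flatSign_partner, Finset.sum_neg_distrib] at h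
  omega

section loops

variable (C : Fin (2 * n) → Fin (2 * n) → Fin (2 * n) → ℤ)

/-- The coefficient, at `z`, of the difference of the two loops into which the circle is cut at the
crossing point `x`.  The cyclic order of the circle is `C`. -/
def loopCoeff (x z : Fin (2 * n)) : ℤ := C x z (G.partner x)

/-- The intersection number of the loops at `x` with the whole curve. -/
def loopIndex (x : Fin (2 * n)) : ℤ := ∑ z, G.flatSign z * G.loopCoeff C x z

/-- The intersection pairing of functions on the end points. -/
def intersect (u v : Fin (2 * n) → ℤ) : ℤ := ∑ z, G.flatSign z * u z * v (G.partner z)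

/-- The weight of a loop, which is quadratic in its intersection numbers with the other loops. -/
def loopWeight (x : Fin (2 * n)) : ℤ :=
  ∑ y, G.flatSign y * G.loopIndex C y * G.intersect (G.loopCoeff C x) (G.loopCoeff C y) ^ 2

/-- A flat invariant of virtual knots, computed from the intersection numbers of the loops at the
crossings. -/
def loopInvariant : ℤ := ∑ x, G.flatSign x * G.loopIndex C x * G.loopWeight C x

/-- Summing over the other end points exchanges the two functions and reverses every flat sign. -/
lemma intersect_swap (u v : Fin (2 * n) → ℤ) : G.intersect u v = -G.intersect v u := by
  unfold intersect
  rw [← G.sum_partner, ← Finset.sum_neg_distrib]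
  refine Finset.sum_congr rfl fun z _ => ?_
  rw [flatSign_partner, G.partner_partner]
  ring

lemma intersect_add_right (u v w : Fin (2 * n) → ℤ) :
    G.intersect u (fun z => v z + w z) = G.intersect u v + G.intersect u w := by
  simp only [intersect, mul_add, Finset.sum_add_distrib]

lemma intersect_neg_right (u v : Fin (2 * n) → ℤ) :
    G.intersect u (fun z => - v z) = - G.intersect u v := by
  simp only [intersect, mul_neg, Finset.sum_neg_distrib]

end loops

lemma loopCoeff_partner (x z : Fin (2 * n)) :
    G.loopCoeff cyclicSign (G.partner x) z = -G.loopCoeff cyclicSign x z := by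
  simp only [loopCoeff, G.partner_partner]
  exact cyclicSign_swap _ _ _

lemma loopIndex_partner (x : Fin (2 * n)) :
    G.loopIndex cyclicSign (G.partner x) = -G.loopIndex cyclicSign x := by
  simp only [loopIndex, loopCoeff_partner, mul_neg, Finset.sum_neg_distrib]

lemma intersect_loopCoeff_partner (u : Fin (2 * n) → ℤ) (x : Fin (2 * n)) :
    G.intersect u (G.loopCoeff cyclicSign (G.partner x)) =
      -G.intersect u (G.loopCoeff cyclicSign x) := by
  rw [← intersect_neg_right]
  congr 1
  ext z
  exact G.loopCoeff_partner x z

lemma loopWeight_partner (x : Fin (2 * n)) :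
    G.loopWeight cyclicSign (G.partner x) = G.loopWeight cyclicSign x := by
  unfold loopWeight
  refine Finset.sum_congr rfl fun y _ => ?_
  rw [G.intersect_swap (G.loopCoeff _ (G.partner x)), intersect_loopCoeff_partner,
    G.intersect_swap (G.loopCoeff _ x)]
  ring

/-! ### Relabelling -/

lemma transport_flatSign (τ : Equiv.Perm (Fin (2 * n))) (z : Fin (2 * n)) :
    (G.transport τ).flatSign (τ z) = G.flatSign z := by
  simp [flatSign, transport]

lemma transport_partner (τ : Equiv.Perm (Fin (2 * n))) (z : Fin (2 * n)) :
    (G.transport τ).partner (τ z) = τ (G.partner z) := by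
  simp [transport]

section transport
variable (τ : Equiv.Perm (Fin (2 * n))) (C : Fin (2 * n) → Fin (2 * n) → Fin (2 * n) → ℤ)

lemma transport_loopCoeff (x z : Fin (2 * n)) : (G.transport τ).loopCoeff C (τ x) (τ z) =
    G.loopCoeff (fun x y z => C (τ x) (τ y) (τ z)) x z := by
  simp only [loopCoeff, transport_partner]

lemma transport_loopIndex (x : Fin (2 * n)) : (G.transport τ).loopIndex C (τ x) =
    G.loopIndex (fun x y z => C (τ x) (τ y) (τ z)) x := by
  unfold loopIndex
  rw [← Equiv.sum_comp τ]
  simp only [transport_flatSign, transport_loopCoeff]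

lemma transport_intersect (x y : Fin (2 * n)) :
    (G.transport τ).intersect ((G.transport τ).loopCoeff C (τ x))
      ((G.transport τ).loopCoeff C (τ y)) =
    G.intersect (G.loopCoeff (fun x y z => C (τ x) (τ y) (τ z)) x)
      (G.loopCoeff (fun x y z => C (τ x) (τ y) (τ z)) y) := by
  unfold intersect
  rw [← Equiv.sum_comp τ]
  simp only [transport_flatSign, transport_partner, transport_loopCoeff]

lemma transport_loopWeight (x : Fin (2 * n)) : (G.transport τ).loopWeight C (τ x) =
    G.loopWeight (fun x y z => C (τ x) (τ y) (τ z)) x := by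
  unfold loopWeight
  rw [← Equiv.sum_comp τ]
  simp only [transport_flatSign, transport_loopIndex, transport_intersect]

lemma transport_loopInvariant : (G.transport τ).loopInvariant C =
    G.loopInvariant (fun x y z => C (τ x) (τ y) (τ z)) := by
  unfold loopInvariant
  rw [← Equiv.sum_comp τ]
  simp only [transport_flatSign, transport_loopIndex, transport_loopWeight]

end transport

/-- Moving the base point rotates the labels, and the labels enter only through their cyclic order.
-/
lemma loopInvariant_basedAt_one :
    (G.basedAt 1).loopInvariant cyclicSign = G.loopInvariant cyclicSign := by
  rw [basedAt, transport_loopInvariant]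
  congr 1
  ext x y z
  have h : ∀ u, u = finRotate (2 * n) ((finRotate (2 * n) ^ 1).symm u) := by
    intro u
    simp only [pow_one, Equiv.apply_symm_apply]
  conv_rhs => rw [h x, h y, h z]
  rw [cyclicSign_finRotate]

/-- For the third move: the indices and the pairwise intersection numbers of the loops determine the
invariant. -/
lemma loopInvariant_congr {C C' : Fin (2 * n) → Fin (2 * n) → Fin (2 * n) → ℤ}
    (h1 : ∀ x, G.loopIndex C x = G.loopIndex C' x)
    (h2 : ∀ x y, G.intersect (G.loopCoeff C x) (G.loopCoeff C y) =
      G.intersect (G.loopCoeff C' x) (G.loopCoeff C' y)) :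
    G.loopInvariant C = G.loopInvariant C' := by
  simp only [loopInvariant, loopWeight, h1, h2]

/-! ### Embedded diagrams -/

end GaussDiagram

lemma sum_eq_sum_range_add {α β M : Type*} [Fintype α] [Fintype β] [DecidableEq β]
    [AddCommMonoid M] {f : α → β} (hf : Function.Injective f) {D : Finset β}
    (hD : ∀ i, f i ∉ D) (hcard : Fintype.card α + D.card = Fintype.card β) (g : β → M) :
    ∑ z, g z = ∑ i, g (f i) + ∑ z ∈ D, g z := by
  have hdisj : Disjoint (Finset.univ.map ⟨f, hf⟩) D := by
    rw [Finset.disjoint_left]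
    intro z hz
    obtain ⟨i, -, rfl⟩ := Finset.mem_map.mp hz
    exact hD i
  have huniv : (Finset.univ.map ⟨f, hf⟩).disjUnion D hdisj = Finset.univ := by
    rw [← Finset.card_eq_iff_eq_univ, Finset.card_disjUnion, Finset.card_map, Finset.card_univ,
      hcard]
  rw [← huniv, Finset.sum_disjUnion, Finset.sum_map]
  rfl

lemma posSign_succ_right {m : ℕ} {p p' u : Fin m} (h : p'.val = p.val + 1) (hu : u ≠ p)
    (hu' : u ≠ p') : posSign u p' = posSign u p := by
  have h1 : u.val ≠ p.val := fun h => hu (Fin.ext h)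
  have h2 : u.val ≠ p'.val := fun h => hu' (Fin.ext h)
  simp only [posSign]
  split_ifs <;> first | rfl | omega

lemma posSign_succ_left {m : ℕ} {p p' u : Fin m} (h : p'.val = p.val + 1) (hu : u ≠ p)
    (hu' : u ≠ p') : posSign p' u = posSign p u := by
  have h1 : u.val ≠ p.val := fun h => hu (Fin.ext h)
  have h2 : u.val ≠ p'.val := fun h => hu' (Fin.ext h)
  simp only [posSign]
  split_ifs <;> first | rfl | omega

/-- A loop whose corners are elsewhere does not separate two neighbouring points. -/
lemma cyclicSign_succ {m : ℕ} {p p' x z : Fin m} (h : p'.val = p.val + 1) (hx : x ≠ p)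
    (hx' : x ≠ p') (hz : z ≠ p) (hz' : z ≠ p') : cyclicSign x p' z = cyclicSign x p z := by
  simp only [cyclicSign, posSign_succ_right h hx hx', posSign_succ_left h hz hz']

lemma cyclicSign_succ_eq_one {m : ℕ} {p p' w : Fin m} (h : p'.val = p.val + 1) (hw : w ≠ p)
    (hw' : w ≠ p') : cyclicSign p p' w = 1 := by
  have h1 : posSign p p' = 1 := by simp [posSign, h]
  rw [cyclicSign, h1, posSign_succ_left h hw hw', one_mul, posSign_mul_self hw.symm]

lemma cyclicSign_succ_eq_neg_one {m : ℕ} {p p' w : Fin m} (h : p'.val = p.val + 1) (hw : w ≠ p)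
    (hw' : w ≠ p') : cyclicSign p' p w = -1 := by
  rw [cyclicSign_rotate w p' p, cyclicSign_swap, cyclicSign_succ_eq_one h hw hw']

/-! ### The flat invariant under the first two moves -/

namespace GaussDiagram

namespace IsEmbedding

variable {m n : ℕ} {G : GaussDiagram m} {G' : GaussDiagram n} {f : Fin (2 * m) → Fin (2 * n)}

lemma flatSign (hf : G.IsEmbedding G' f) (z) : G'.flatSign (f z) = G.flatSign z := by
  simp only [GaussDiagram.flatSign, hf.map_isHead, hf.map_sign]

lemma loopCoeff (hf : G.IsEmbedding G' f) (x z) :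
    G'.loopCoeff cyclicSign (f x) (f z) = G.loopCoeff cyclicSign x z := by
  simp only [GaussDiagram.loopCoeff, ← hf.map_partner, cyclicSign_comp hf.strictMono]

end IsEmbedding

/-- The loops at the new crossing have index zero, because one of them is empty and all flat signs
add up to zero. An old loop has equal coefficients at the two new points, whose flat signs are
opposite, so its numbers do not change. -/
lemma loopInvariant_omega1 {G : GaussDiagram n} {G' : GaussDiagram (n + 1)} (h : Omega1 G G') :
    G'.loopInvariant cyclicSign = G.loopInvariant cyclicSign := by
  obtain ⟨f, hf, p, p', hpp', hp, hfp⟩ := h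
  have hne : p ≠ p' := fun h => by rw [h] at hpp'; omega
  have hp' : G'.partner p' = p := by rw [← hp, G'.partner_partner]
  have hχ : G'.flatSign p' = -G'.flatSign p := by rw [← hp, flatSign_partner]
  have hsum : ∀ g : Fin (2 * (n + 1)) → ℤ, ∑ z, g z = ∑ i, g (f i) + (g p + g p') := by
    intro g
    rw [sum_eq_sum_range_add hf.strictMono.injective (D := {p, p'})
      (fun i => by simpa using hfp i) (by rw [Finset.card_pair hne]; simp; ring),
      Finset.sum_pair hne]
  have hside : ∀ x, G'.loopCoeff cyclicSign (f x) p' = G'.loopCoeff cyclicSign (f x) p := by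
    intro x
    simp only [loopCoeff, ← hf.map_partner]
    exact cyclicSign_succ hpp' (hfp _).1 (hfp _).2 (hfp _).1 (hfp _).2
  have hN : ∀ x, G'.loopIndex cyclicSign (f x) = G.loopIndex cyclicSign x := by
    intro x
    simp only [loopIndex, hsum, hf.flatSign, hf.loopCoeff, hside, hχ]
    ring
  have hB : ∀ x y, G'.intersect (G'.loopCoeff cyclicSign (f x)) (G'.loopCoeff cyclicSign (f y)) =
      G.intersect (G.loopCoeff cyclicSign x) (G.loopCoeff cyclicSign y) := by
    intro x y
    simp only [intersect, hsum, hf.flatSign, hf.loopCoeff, hside, hχ, hp, hp', ← hf.map_partner]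
    ring
  have hNp : G'.loopIndex cyclicSign p = 0 := by
    have h0 : ∀ z, G'.loopCoeff cyclicSign p z =
        -1 + (if z = p then 1 else 0) + (if z = p' then 1 else 0) := by
      intro z
      simp only [loopCoeff, hp, cyclicSign, posSign, Fin.ext_iff]
      split_ifs <;> first | rfl | omega
    simp only [loopIndex, h0, mul_add, Finset.sum_add_distrib, mul_ite, mul_one, mul_zero,
      Finset.sum_ite_eq', Finset.mem_univ, if_true, hχ, mul_neg, Finset.sum_neg_distrib,
      sum_flatSign]
    ring
  have hNp' : G'.loopIndex cyclicSign p' = 0 := by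
    rw [← hp, loopIndex_partner, hNp, neg_zero]
  have hW : ∀ x, G'.loopWeight cyclicSign (f x) = G.loopWeight cyclicSign x := by
    intro x
    simp only [loopWeight, hsum, hN, hB, hf.flatSign, hNp, hNp']
    ring
  simp only [loopInvariant, hsum, hN, hW, hf.flatSign, hNp, hNp']
  ring

/-- The two new loops have equal indices and equal intersection numbers with every loop, while their
flat signs are opposite. Hence they cancel, both inside each weight and in the outer sum, and the
numbers of the old loops do not change. -/
lemma loopInvariant_omega2 {G : GaussDiagram n} {G' : GaussDiagram (n + 2)} (h : Omega2 G G') :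
    G'.loopInvariant cyclicSign = G.loopInvariant cyclicSign := by
  obtain ⟨f, hf, p, p', q, q', hpp', hqq', htp, htp', hpq, hs, hfp⟩ := h
  have hp1 : ∀ i, f i ≠ p := fun i => (hfp i).1
  have hp2 : ∀ i, f i ≠ p' := fun i => (hfp i).2.1
  have hp3 : ∀ i, f i ≠ q := fun i => (hfp i).2.2.1
  have hp4 : ∀ i, f i ≠ q' := fun i => (hfp i).2.2.2
  have hhead : G'.isHead q = true ∧ G'.isHead q' = true := by
    rcases hpq with ⟨h1, h2⟩ | ⟨h1, h2⟩
    · rw [← h1, ← h2, G'.isHead_partner, G'.isHead_partner, htp, htp']; simp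
    · rw [← h1, ← h2, G'.isHead_partner, G'.isHead_partner, htp, htp']; simp
  have hne : ∀ u v, G'.isHead u = false → G'.isHead v = true → u.val ≠ v.val := by
    intro u v hu hv huv
    rw [Fin.ext huv, hv] at hu
    exact Bool.noConfusion hu
  have e1 : p ≠ q := fun h => hne p q htp hhead.1 (by rw [h])
  have e2 : p ≠ q' := fun h => hne p q' htp hhead.2 (by rw [h])
  have e3 : p' ≠ q := fun h => hne p' q htp' hhead.1 (by rw [h])
  have e4 : p' ≠ q' := fun h => hne p' q' htp' hhead.2 (by rw [h])
  have e5 : p ≠ p' := fun h => by rw [h] at hpp'; omega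
  have e6 : q ≠ q' := fun h => by rw [h] at hqq'; omega
  have hχ : G'.flatSign p' = -G'.flatSign p := by
    simp only [flatSign, htp, htp', hs]; simp
  have hsum : ∀ g : Fin (2 * (n + 2)) → ℤ,
      ∑ z, g z = ∑ i, g (f i) + (g p + g p' + g q + g q') := by
    intro g
    have d1 : p ∉ ({p', q, q'} : Finset (Fin (2 * (n + 2)))) := by
      simp [e1, e2, e5]
    have d2 : p' ∉ ({q, q'} : Finset (Fin (2 * (n + 2)))) := by
      simp [e3, e4]
    have d3 : q ∉ ({q'} : Finset (Fin (2 * (n + 2)))) := by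
      simp [e6]
    rw [sum_eq_sum_range_add hf.strictMono.injective (D := {p, p', q, q'})
      (fun i => by simpa using hfp i)
      (by rw [Finset.card_insert_of_notMem d1, Finset.card_insert_of_notMem d2,
            Finset.card_insert_of_notMem d3]; simp; ring),
      Finset.sum_insert d1, Finset.sum_insert d2, Finset.sum_insert d3, Finset.sum_singleton]
    ring
  have hside : ∀ x, G'.loopCoeff cyclicSign (f x) p' = G'.loopCoeff cyclicSign (f x) p := by
    intro x
    simp only [loopCoeff, ← hf.map_partner]
    exact cyclicSign_succ hpp' (hp1 _) (hp2 _) (hp1 _) (hp2 _)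
  have hside' : ∀ x, G'.loopCoeff cyclicSign (f x) q' = G'.loopCoeff cyclicSign (f x) q := by
    intro x
    simp only [loopCoeff, ← hf.map_partner]
    exact cyclicSign_succ hqq' (hp3 _) (hp4 _) (hp3 _) (hp4 _)
  have hχq : G'.flatSign q' = -G'.flatSign q := by
    rcases hpq with ⟨h1, h2⟩ | ⟨h1, h2⟩
    · rw [← h1, ← h2, flatSign_partner, flatSign_partner, hχ]
    · rw [← h1, ← h2, flatSign_partner, flatSign_partner, hχ]; ring
  have hN : ∀ x, G'.loopIndex cyclicSign (f x) = G.loopIndex cyclicSign x := by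
    intro x
    simp only [loopIndex, hsum, hf.flatSign, hf.loopCoeff, hside, hside', hχ, hχq]
    ring
  have hB : ∀ x y, G'.intersect (G'.loopCoeff cyclicSign (f x)) (G'.loopCoeff cyclicSign (f y)) =
      G.intersect (G.loopCoeff cyclicSign x) (G.loopCoeff cyclicSign y) := by
    intro x y
    rcases hpq with ⟨h1, h2⟩ | ⟨h1, h2⟩ <;>
    · have h3 := G'.partner_partner p
      have h4 := G'.partner_partner p'
      rw [h1] at h3
      rw [h2] at h4
      simp only [intersect, hsum, hf.flatSign, hf.loopCoeff, hside, hside', hχ, hχq, h1, h2, h3, h4,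
        ← hf.map_partner]
      ring
  have hold : ∀ i, G'.loopCoeff cyclicSign p' (f i) = G'.loopCoeff cyclicSign p (f i) := by
    intro i
    rcases hpq with ⟨h1, h2⟩ | ⟨h1, h2⟩
    · simp only [loopCoeff, h1, h2, cyclicSign, posSign_succ_left hpp' (hp1 i) (hp2 i),
        posSign_succ_right hqq' (hp3 i) (hp4 i), posSign_succ_left hpp' e2.symm e4.symm,
        posSign_succ_right hqq' e1 e2]
    · simp only [loopCoeff, h1, h2, cyclicSign, posSign_succ_left hpp' (hp1 i) (hp2 i),
        posSign_succ_right hqq' (hp3 i) (hp4 i), posSign_succ_left hpp' e1.symm e3.symm,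
        posSign_succ_right hqq' e1 e2]
  -- Here `ε` is `1` if the heads follow each other in the same order as the tails, and `-1` if they
  -- follow in the opposite order.
  have hval : ∃ ε : ℤ, G'.flatSign q = -ε * G'.flatSign p ∧
      G'.loopCoeff cyclicSign p p = 0 ∧ G'.loopCoeff cyclicSign p p' = 1 ∧
      G'.loopCoeff cyclicSign p' p = -1 ∧ G'.loopCoeff cyclicSign p' p' = 0 ∧
      G'.loopCoeff cyclicSign p q - G'.loopCoeff cyclicSign p' q = -ε ∧
      G'.loopCoeff cyclicSign p q' - G'.loopCoeff cyclicSign p' q' = -ε ∧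
      G'.loopCoeff cyclicSign p q' - G'.loopCoeff cyclicSign p q = -1 := by
    rcases hpq with ⟨h1, h2⟩ | ⟨h1, h2⟩
    · refine ⟨1, by rw [← h1, flatSign_partner]; ring, ?_⟩
      simp only [loopCoeff, h1, h2, cyclicSign_self_left, cyclicSign_self_right,
        cyclicSign_succ_eq_one hpp' e1.symm e3.symm,
        cyclicSign_succ_eq_neg_one hpp' e2.symm e4.symm]
      rw [← cyclicSign_rotate p' q q', ← cyclicSign_rotate p q' q, cyclicSign_succ_eq_neg_one hqq' e1 e2,
        cyclicSign_succ_eq_one hqq' e3 e4]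
      norm_num
    · refine ⟨-1, by rw [← h2, flatSign_partner, hχ]; ring, ?_⟩
      simp only [loopCoeff, h1, h2, cyclicSign_self_left, cyclicSign_self_right,
        cyclicSign_succ_eq_one hpp' e2.symm e4.symm,
        cyclicSign_succ_eq_neg_one hpp' e1.symm e3.symm]
      rw [← cyclicSign_rotate p q q', ← cyclicSign_rotate p' q' q,
        cyclicSign_succ_eq_neg_one hqq' e3 e4, cyclicSign_succ_eq_one hqq' e1 e2]
      norm_num
  obtain ⟨ε, hε, c1, c2, c3, c4, c5, c6, c7⟩ := hval
  have hNp : G'.loopIndex cyclicSign p' = G'.loopIndex cyclicSign p := by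
    simp only [loopIndex, hsum, hold, hχ, hχq, hε, c1, c2, c3, c4]
    linear_combination (-ε * G'.flatSign p) * (c6 - c5)
  -- Any loop changes by opposite amounts across the pair of tails and across the pair of heads. For
  -- old loops both changes are zero.
  have hR : ∀ x, G'.loopCoeff cyclicSign x p' - G'.loopCoeff cyclicSign x p +
      (G'.loopCoeff cyclicSign x q' - G'.loopCoeff cyclicSign x q) = 0 := by
    have r1 : G'.loopCoeff cyclicSign p p' - G'.loopCoeff cyclicSign p p +
      (G'.loopCoeff cyclicSign p q' - G'.loopCoeff cyclicSign p q) = 0 := by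
      linear_combination c2 - c1 + c7
    have r2 : G'.loopCoeff cyclicSign p' p' - G'.loopCoeff cyclicSign p' p +
      (G'.loopCoeff cyclicSign p' q' - G'.loopCoeff cyclicSign p' q) = 0 := by
      linear_combination c4 - c3 + c7 + c5 - c6
    have r3 : ∀ x, G'.loopCoeff cyclicSign x p' - G'.loopCoeff cyclicSign x p +
      (G'.loopCoeff cyclicSign x q' - G'.loopCoeff cyclicSign x q) = 0 →
      G'.loopCoeff cyclicSign (G'.partner x) p' - G'.loopCoeff cyclicSign (G'.partner x) p +
      (G'.loopCoeff cyclicSign (G'.partner x) q' - G'.loopCoeff cyclicSign (G'.partner x) q) =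
        0 := by
      intro x hx
      simp only [loopCoeff_partner]
      linear_combination -hx
    have r4 : (G'.loopCoeff cyclicSign q p' - G'.loopCoeff cyclicSign q p +
      (G'.loopCoeff cyclicSign q q' - G'.loopCoeff cyclicSign q q) = 0) ∧
      (G'.loopCoeff cyclicSign q' p' - G'.loopCoeff cyclicSign q' p +
      (G'.loopCoeff cyclicSign q' q' - G'.loopCoeff cyclicSign q' q) = 0) := by
      rcases hpq with ⟨h1, h2⟩ | ⟨h1, h2⟩
      · exact ⟨h1 ▸ r3 _ r1, h2 ▸ r3 _ r2⟩
      · exact ⟨h2 ▸ r3 _ r2, h1 ▸ r3 _ r1⟩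
    intro x
    by_contra hx
    have hx1 : ∀ i, x ≠ f i := by
      rintro i rfl
      apply hx
      rw [hside, hside']
      ring
    -- Every point is old or one of the four new ones: otherwise the sum of its indicator function
    -- would be zero.
    have := hsum (fun z => if z = x then 1 else 0)
    simp only [Finset.sum_ite_eq', Finset.mem_univ, if_true] at this
    rw [Finset.sum_eq_zero (fun i _ => if_neg (hx1 i).symm)] at this
    have n1 : p ≠ x := by rintro rfl; exact hx r1
    have n2 : p' ≠ x := by rintro rfl; exact hx r2
    have n3 : q ≠ x := by rintro rfl; exact hx r4.1
    have n4 : q' ≠ x := by rintro rfl; exact hx r4.2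
    simp [n1, n2, n3, n4] at this
  -- The loops at `p` and `p'` agree at the old points. What is left at the four new points is a
  -- multiple of `hR x`.
  have hBp : ∀ x, G'.intersect (G'.loopCoeff cyclicSign x) (G'.loopCoeff cyclicSign p') =
      G'.intersect (G'.loopCoeff cyclicSign x) (G'.loopCoeff cyclicSign p) := by
    intro x
    rw [G'.intersect_swap, G'.intersect_swap (G'.loopCoeff cyclicSign x)]
    congr 1
    simp only [intersect, hsum, hold, hχ, hχq, hε, c1, c2, c3, c4]
    rcases hpq with ⟨h1, h2⟩ | ⟨h1, h2⟩
    · have h3 := G'.partner_partner p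
      have h4 := G'.partner_partner p'
      rw [h1] at h3
      rw [h2] at h4
      have hε1 : ε = 1 := by
        have : G'.flatSign q = -G'.flatSign p := by rw [← h1, flatSign_partner]
        have h0 : G'.flatSign p ≠ 0 := by simp [flatSign, htp]
        apply mul_right_cancel₀ h0
        linarith
      subst hε1
      rw [h1, h2, h3, h4]
      linear_combination (G'.flatSign p) * hR x + (G'.flatSign p * G'.loopCoeff cyclicSign x p) * c5
        - (G'.flatSign p * G'.loopCoeff cyclicSign x p') * c6
    · have h3 := G'.partner_partner p
      have h4 := G'.partner_partner p'
      rw [h1] at h3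
      rw [h2] at h4
      have hε1 : ε = -1 := by
        have : G'.flatSign q = G'.flatSign p := by rw [← h2, flatSign_partner, hχ]; ring
        have h0 : G'.flatSign p ≠ 0 := by simp [flatSign, htp]
        apply mul_right_cancel₀ h0
        linarith
      subst hε1
      rw [h1, h2, h3, h4]
      linear_combination (-G'.flatSign p) * hR x - (G'.flatSign p * G'.loopCoeff cyclicSign x p') * c5
        + (G'.flatSign p * G'.loopCoeff cyclicSign x p) * c6
  -- Both end points of an arrow give the same summand, so heads may be replaced by tails.
  have hNB : ∀ x y, G'.flatSign (G'.partner y) * G'.loopIndex cyclicSign (G'.partner y) *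
      G'.intersect (G'.loopCoeff cyclicSign x) (G'.loopCoeff cyclicSign (G'.partner y)) ^ 2 =
      G'.flatSign y * G'.loopIndex cyclicSign y *
      G'.intersect (G'.loopCoeff cyclicSign x) (G'.loopCoeff cyclicSign y) ^ 2 := by
    intro x y
    rw [flatSign_partner, loopIndex_partner, intersect_loopCoeff_partner]
    ring
  have hW : ∀ x, G'.loopWeight cyclicSign (f x) = G.loopWeight cyclicSign x := by
    intro x
    simp only [loopWeight, hsum, hN, hB, hf.flatSign]
    rcases hpq with ⟨h1, h2⟩ | ⟨h1, h2⟩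
    · rw [← h1, ← h2, hNB, hNB, hNp, hBp, hχ]
      ring
    · rw [← h1, ← h2, hNB, hNB, hNp, hBp, hχ]
      ring
  have hWp : G'.loopWeight cyclicSign p' = G'.loopWeight cyclicSign p := by
    unfold loopWeight
    refine Finset.sum_congr rfl fun y _ => ?_
    rw [G'.intersect_swap (G'.loopCoeff _ p'), hBp, ← G'.intersect_swap]
  have hNW : ∀ y, G'.flatSign (G'.partner y) * G'.loopIndex cyclicSign (G'.partner y) *
      G'.loopWeight cyclicSign (G'.partner y) =
      G'.flatSign y * G'.loopIndex cyclicSign y * G'.loopWeight cyclicSign y := by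
    intro y
    rw [flatSign_partner, loopIndex_partner, loopWeight_partner]
    ring
  simp only [loopInvariant, hsum, hN, hW, hf.flatSign]
  rcases hpq with ⟨h1, h2⟩ | ⟨h1, h2⟩
  · rw [← h1, ← h2, hNW, hNW, hNp, hWp, hχ]
    ring
  · rw [← h1, ← h2, hNW, hNW, hNp, hWp, hχ]
    ring

end GaussDiagram

/-! ### The flat invariant under the third move -/

namespace GaussDiagram

variable {n : ℕ} {G G' : GaussDiagram n}

/-- Three arrows to which the third Reidemeister move applies. -/
structure IsTriangle (G : GaussDiagram n) (a b c : Fin (2 * n)) (η : ℤˣ) : Prop where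
  ne : a ≠ c
  tail_a : G.isHead a = false
  tail_b : G.isHead b = false
  tail_c : G.isHead c = false
  top : (b.val : ℤ) - a.val = (η * G.sign b : ℤˣ)
  middle : (c.val : ℤ) - (G.partner a).val = (η * G.sign c : ℤˣ)
  bottom : ((G.partner c).val : ℤ) - (G.partner b).val =
    (η * (G.sign a * G.sign b * G.sign c) : ℤˣ)

/-- The exchange of the end points in the third Reidemeister move. -/
def triangleSwap (G : GaussDiagram n) (a b c : Fin (2 * n)) : Equiv.Perm (Fin (2 * n)) :=
  Equiv.swap a b * Equiv.swap (G.partner a) c * Equiv.swap (G.partner b) (G.partner c)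

lemma omega3_iff : Omega3 G G' ↔
    ∃ a b c η, G.IsTriangle a b c η ∧ G' = G.transport (G.triangleSwap a b c) := by
  constructor
  · rintro ⟨a, b, c, h1, h2, h3, h4, ⟨η, h5, h6, h7⟩, h8⟩
    exact ⟨a, b, c, η, ⟨h1, h2, h3, h4, h5, h6, h7⟩, h8⟩
  · rintro ⟨a, b, c, η, ⟨h1, h2, h3, h4, h5, h6, h7⟩, h8⟩
    exact ⟨a, b, c, h1, h2, h3, h4, ⟨η, h5, h6, h7⟩, h8⟩

lemma units_sub_eq {x y : ℕ} {u : ℤˣ} (h : (y : ℤ) - x = (u : ℤ)) : y = x + 1 ∨ x = y + 1 := by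
  rcases Int.units_eq_one_or u with rfl | rfl
  · left; simp at h; omega
  · right; simp at h; omega

lemma partner_injective (G : GaussDiagram n) : Function.Injective G.partner :=
  G.partner_involutive.injective

namespace IsTriangle

variable {a b c : Fin (2 * n)} {η : ℤˣ} (h : G.IsTriangle a b c η)
include h

lemma ne_ab : a ≠ b := by
  rintro rfl
  have := h.top
  rcases Int.units_eq_one_or (η * G.sign a) with h | h <;> simp [h] at this

lemma ne_bc : b ≠ c := by
  rintro rfl
  have := h.bottom
  rcases Int.units_eq_one_or (η * (G.sign a * G.sign b * G.sign b)) with h | h <;>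
    simp [h] at this

lemma isHead_pa : G.isHead (G.partner a) = true := by rw [G.isHead_partner, h.tail_a]; rfl
lemma isHead_pb : G.isHead (G.partner b) = true := by rw [G.isHead_partner, h.tail_b]; rfl
lemma isHead_pc : G.isHead (G.partner c) = true := by rw [G.isHead_partner, h.tail_c]; rfl

end IsTriangle

end GaussDiagram

/-- Exchanging two neighbours reverses the order of these two and of no other pair. -/
lemma posSign_swap_apply {m : ℕ} {u v : Fin m} (huv : v.val = u.val + 1 ∨ u.val = v.val + 1)
    (x y : Fin m) : posSign (Equiv.swap u v x) (Equiv.swap u v y) =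
      (if (x = u ∧ y = v) ∨ (x = v ∧ y = u) then -1 else 1) * posSign x y := by
  have hne : u ≠ v := by rintro rfl; omega
  have hs : ∀ w, w = u ∨ w = v ∨ (w ≠ u ∧ w ≠ v) := by tauto
  have hl : ∀ w, w ≠ u → w ≠ v → posSign w u = posSign w v := by
    intro w h1 h2
    rcases huv with h | h
    · exact (posSign_succ_right h h1 h2).symm
    · exact posSign_succ_right h h2 h1
  have hz : ∀ w : Fin m, posSign w w = 0 := by intro w; simp [posSign]
  rcases hs x with rfl | rfl | ⟨hx, hx'⟩ <;> rcases hs y with rfl | rfl | ⟨hy, hy'⟩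
  · simp [hz]
  · simp [posSign_swap x y]
  · rw [Equiv.swap_apply_left, Equiv.swap_apply_of_ne_of_ne hy hy', if_neg (by tauto), one_mul,
      posSign_swap y, posSign_swap y, hl y hy hy']
  · simp [posSign_swap y x]
  · simp [hz]
  · rw [Equiv.swap_apply_right, Equiv.swap_apply_of_ne_of_ne hy hy', if_neg (by tauto), one_mul,
      posSign_swap y, posSign_swap y, hl y hy hy']
  · rw [Equiv.swap_apply_left, Equiv.swap_apply_of_ne_of_ne hx hx', if_neg (by tauto), one_mul,
      hl x hx hx']
  · rw [Equiv.swap_apply_right, Equiv.swap_apply_of_ne_of_ne hx hx', if_neg (by tauto), one_mul,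
      hl x hx hx']
  · rw [Equiv.swap_apply_of_ne_of_ne hx hx', Equiv.swap_apply_of_ne_of_ne hy hy',
      if_neg (by tauto), one_mul]

/-- The order relative to `x` is reversed only at `u`, and that relative to `p` only at `v`. Hence
the coefficient changes its sign at these two points, that is, `-2` times its value is added there.
-/
lemma cyclicSign_comp_of_posSign {m : ℕ} {τ : Fin m → Fin m} {x p u v : Fin m}
    (hx : ∀ z, posSign (τ x) (τ z) = (if z = u then -1 else 1) * posSign x z)
    (hp : ∀ z, posSign (τ p) (τ z) = (if z = v then -1 else 1) * posSign p z)
    (hpu : p ≠ u) (huv : u ≠ v) (z : Fin m) :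
    cyclicSign (τ x) (τ z) (τ p) = cyclicSign x z p +
      ((if z = u then -2 * cyclicSign x u p else 0) +
        (if z = v then -2 * cyclicSign x v p else 0)) := by
  simp only [cyclicSign, hx, posSign_swap (τ p) (τ _), hp, posSign_swap p _, if_neg hpu]
  split_ifs with z1 z2 z2
  · exact absurd (z1.symm.trans z2) huv
  · subst z1; ring
  · subst z2; ring
  · ring

lemma cyclicSign_eq_sub {m : ℕ} {p p' w : Fin m} {u : ℤˣ} (h : (p'.val : ℤ) - p.val = u)
    (hw : w ≠ p) (hw' : w ≠ p') : cyclicSign p p' w = u := by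
  rcases Int.units_eq_one_or u with rfl | rfl
  · exact cyclicSign_succ_eq_one (by simp at h; omega) hw hw'
  · rw [cyclicSign_succ_eq_neg_one (by simp at h; omega) hw' hw]
    simp

namespace GaussDiagram

variable {n : ℕ} {G G' : GaussDiagram n}

lemma intersect_single (u : Fin (2 * n) → ℤ) (w : Fin (2 * n)) (k : ℤ) :
    G.intersect u (fun z => if z = w then k else 0) =
      G.flatSign (G.partner w) * u (G.partner w) * k := by
  unfold intersect
  rw [Finset.sum_eq_single (G.partner w)]
  · simp [G.partner_partner]
  · intro z _ hz
    dsimp only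
    rw [if_neg, mul_zero]
    rintro rfl
    exact hz (G.partner_partner z).symm
  · simp

namespace IsTriangle

variable {a b c : Fin (2 * n)} {η : ℤˣ} (h : G.IsTriangle a b c η)
include h

lemma distinct : a ≠ b ∧ a ≠ c ∧ b ≠ c ∧ (a ≠ G.partner a ∧ a ≠ G.partner b ∧ a ≠ G.partner c) ∧
    (b ≠ G.partner a ∧ b ≠ G.partner b ∧ b ≠ G.partner c) ∧
    (c ≠ G.partner a ∧ c ≠ G.partner b ∧ c ≠ G.partner c) ∧
    G.partner a ≠ G.partner b ∧ G.partner a ≠ G.partner c ∧ G.partner b ≠ G.partner c := by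
  have key : ∀ u v, G.isHead u = false → G.isHead v = true → u ≠ v := by
    rintro u v h1 h2 rfl
    rw [h1] at h2
    exact Bool.noConfusion h2
  have ha := h.tail_a
  have hb := h.tail_b
  have hc := h.tail_c
  have ha' := h.isHead_pa
  have hb' := h.isHead_pb
  have hc' := h.isHead_pc
  refine ⟨h.ne_ab, h.ne, h.ne_bc, ⟨?_, ?_, ?_⟩, ⟨?_, ?_, ?_⟩, ⟨?_, ?_, ?_⟩, ?_, ?_, ?_⟩
  · exact key _ _ ha ha'
  · exact key _ _ ha hb'
  · exact key _ _ ha hc'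
  · exact key _ _ hb ha'
  · exact key _ _ hb hb'
  · exact key _ _ hb hc'
  · exact key _ _ hc ha'
  · exact key _ _ hc hb'
  · exact key _ _ hc hc'
  · exact fun e => h.ne_ab (G.partner_injective e)
  · exact fun e => h.ne (G.partner_injective e)
  · exact fun e => h.ne_bc (G.partner_injective e)

/-- The three transpositions of neighbours have disjoint supports, so each one contributes the
reversal of its own pair. -/
lemma posSign_triangleSwap (x y : Fin (2 * n)) :
    posSign (G.triangleSwap a b c x) (G.triangleSwap a b c y) =
      (if (x = a ∧ y = b) ∨ (x = b ∧ y = a) then -1 else 1) *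
      (if (x = G.partner a ∧ y = c) ∨ (x = c ∧ y = G.partner a) then -1 else 1) *
      (if (x = G.partner b ∧ y = G.partner c) ∨ (x = G.partner c ∧ y = G.partner b)
        then -1 else 1) * posSign x y := by
  obtain ⟨h1, h2, h3, ⟨h4, h5, h6⟩, ⟨h7, h8, h9⟩, ⟨h10, h11, h12⟩, h13, h14, h15⟩ := h.distinct
  have e1 : ∀ u, Equiv.swap (G.partner a) c (Equiv.swap (G.partner b) (G.partner c) u) = a ↔
      u = a := by
    intro u
    rw [Equiv.swap_apply_eq_iff, Equiv.swap_apply_eq_iff,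
      Equiv.swap_apply_of_ne_of_ne h4 h2, Equiv.swap_apply_of_ne_of_ne h5 h6]
  have e2 : ∀ u, Equiv.swap (G.partner a) c (Equiv.swap (G.partner b) (G.partner c) u) = b ↔
      u = b := by
    intro u
    rw [Equiv.swap_apply_eq_iff, Equiv.swap_apply_eq_iff,
      Equiv.swap_apply_of_ne_of_ne h7 h3, Equiv.swap_apply_of_ne_of_ne h8 h9]
  have e3 : ∀ u, Equiv.swap (G.partner b) (G.partner c) u = G.partner a ↔ u = G.partner a := by
    intro u
    rw [Equiv.swap_apply_eq_iff, Equiv.swap_apply_of_ne_of_ne h13 h14]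
  have e4 : ∀ u, Equiv.swap (G.partner b) (G.partner c) u = c ↔ u = c := by
    intro u
    rw [Equiv.swap_apply_eq_iff, Equiv.swap_apply_of_ne_of_ne h11 h12]
  simp only [triangleSwap, Equiv.Perm.mul_apply]
  rw [posSign_swap_apply (units_sub_eq h.top), posSign_swap_apply (units_sub_eq h.middle),
    posSign_swap_apply (units_sub_eq h.bottom)]
  simp only [e1, e2, e3, e4]
  ring

end IsTriangle

/-- Statements about loops are insensitive to the choice of the end point of an arrow, so only the
three tails and the points outside the triangle need a proof. -/
lemma IsTriangle.induction_end {a b c : Fin (2 * n)} {P : Fin (2 * n) → Prop} (ha : P a) (hb : P b) (hc : P c)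
    (hp : ∀ x, P x → P (G.partner x))
    (ho : ∀ x, x ≠ a → x ≠ b → x ≠ c → x ≠ G.partner a → x ≠ G.partner b → x ≠ G.partner c → P x)
    (x : Fin (2 * n)) : P x := by
  by_cases h1 : x = a
  · exact h1 ▸ ha
  by_cases h2 : x = b
  · exact h2 ▸ hb
  by_cases h3 : x = c
  · exact h3 ▸ hc
  by_cases h4 : x = G.partner a
  · exact h4 ▸ hp _ ha
  by_cases h5 : x = G.partner b
  · exact h5 ▸ hp _ hb
  by_cases h6 : x = G.partner c
  · exact h6 ▸ hp _ hc
  exact ho x h1 h2 h3 h4 h5 h6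

/-- The constant function `1` stands for the whole curve. In this way the formulas for intersection
numbers also cover the indices. -/
lemma loopIndex_eq_intersect (C : Fin (2 * n) → Fin (2 * n) → Fin (2 * n) → ℤ) (x : Fin (2 * n)) :
    G.loopIndex C x = -G.intersect (fun _ => 1) (G.loopCoeff C x) := by
  rw [intersect_swap, neg_neg]
  simp [intersect, loopIndex]

/-- The cyclic order after the third Reidemeister move. -/
def swappedOrder (G : GaussDiagram n) (a b c x y z : Fin (2 * n)) : ℤ :=
  cyclicSign (G.triangleSwap a b c x) (G.triangleSwap a b c y) (G.triangleSwap a b c z)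

lemma loopCoeff_swappedOrder_partner (a b c x z : Fin (2 * n)) :
    G.loopCoeff (G.swappedOrder a b c) (G.partner x) z =
      -G.loopCoeff (G.swappedOrder a b c) x z := by
  simp only [loopCoeff, swappedOrder, G.partner_partner]
  exact cyclicSign_swap _ _ _

namespace IsTriangle

variable {a b c : Fin (2 * n)} {η : ℤˣ} (h : G.IsTriangle a b c η)
include h

lemma posSign_a (z) : posSign (G.triangleSwap a b c a) (G.triangleSwap a b c z) =
    (if z = b then -1 else 1) * posSign a z := by
  obtain ⟨h1, h2, h3, ⟨h4, h5, h6⟩, ⟨h7, h8, h9⟩, ⟨h10, h11, h12⟩, h13, h14, h15⟩ := h.distinct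
  simp [h.posSign_triangleSwap, h1, h2, h4, h5, h6]

lemma posSign_b (z) : posSign (G.triangleSwap a b c b) (G.triangleSwap a b c z) =
    (if z = a then -1 else 1) * posSign b z := by
  obtain ⟨h1, h2, h3, ⟨h4, h5, h6⟩, ⟨h7, h8, h9⟩, ⟨h10, h11, h12⟩, h13, h14, h15⟩ := h.distinct
  simp [h.posSign_triangleSwap, h1.symm, h3, h7, h8, h9]

lemma posSign_c (z) : posSign (G.triangleSwap a b c c) (G.triangleSwap a b c z) =
    (if z = G.partner a then -1 else 1) * posSign c z := by
  obtain ⟨h1, h2, h3, ⟨h4, h5, h6⟩, ⟨h7, h8, h9⟩, ⟨h10, h11, h12⟩, h13, h14, h15⟩ := h.distinct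
  simp [h.posSign_triangleSwap, h2.symm, h3.symm, h10, h11, h12]

lemma posSign_pa (z) :
    posSign (G.triangleSwap a b c (G.partner a)) (G.triangleSwap a b c z) =
      (if z = c then -1 else 1) * posSign (G.partner a) z := by
  obtain ⟨h1, h2, h3, ⟨h4, h5, h6⟩, ⟨h7, h8, h9⟩, ⟨h10, h11, h12⟩, h13, h14, h15⟩ := h.distinct
  simp [h.posSign_triangleSwap, h4.symm, h7.symm, h10.symm, h13, h14]

lemma posSign_pb (z) :
    posSign (G.triangleSwap a b c (G.partner b)) (G.triangleSwap a b c z) =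
      (if z = G.partner c then -1 else 1) * posSign (G.partner b) z := by
  obtain ⟨h1, h2, h3, ⟨h4, h5, h6⟩, ⟨h7, h8, h9⟩, ⟨h10, h11, h12⟩, h13, h14, h15⟩ := h.distinct
  simp [h.posSign_triangleSwap, h5.symm, h8.symm, h11.symm, h13.symm, h15]

lemma posSign_pc (z) :
    posSign (G.triangleSwap a b c (G.partner c)) (G.triangleSwap a b c z) =
      (if z = G.partner b then -1 else 1) * posSign (G.partner c) z := by
  obtain ⟨h1, h2, h3, ⟨h4, h5, h6⟩, ⟨h7, h8, h9⟩, ⟨h10, h11, h12⟩, h13, h14, h15⟩ := h.distinct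
  simp [h.posSign_triangleSwap, h6.symm, h9.symm, h12.symm, h14.symm, h15.symm]

/-- The partner on a strand lies directly before or after the corner of the loop, so the coefficient
there is, up to sign, the orientation that the definition of a triangle prescribes. -/
lemma loopCoeff_values :
    G.loopCoeff cyclicSign a b = (η * G.sign b : ℤˣ) ∧
    G.loopCoeff cyclicSign a c = -((η * G.sign c : ℤˣ) : ℤ) ∧
    G.loopCoeff cyclicSign b a = -((η * G.sign b : ℤˣ) : ℤ) ∧
    G.loopCoeff cyclicSign b (G.partner c) =
      -((η * (G.sign a * G.sign b * G.sign c) : ℤˣ) : ℤ) ∧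
    G.loopCoeff cyclicSign c (G.partner a) = -((η * G.sign c : ℤˣ) : ℤ) ∧
    G.loopCoeff cyclicSign c (G.partner b) =
      ((η * (G.sign a * G.sign b * G.sign c) : ℤˣ) : ℤ) := by
  obtain ⟨h1, h2, h3, ⟨h4, h5, h6⟩, ⟨h7, h8, h9⟩, ⟨h10, h11, h12⟩, h13, h14, h15⟩ := h.distinct
  refine ⟨cyclicSign_eq_sub h.top h4.symm h7.symm, ?_, ?_, ?_, ?_, ?_⟩ <;> unfold loopCoeff
  · rw [cyclicSign_swap, cyclicSign_eq_sub h.middle h4 h2]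
  · rw [cyclicSign_swap, ← cyclicSign_rotate, cyclicSign_eq_sub h.top h5.symm h8.symm]
  · rw [cyclicSign_swap, cyclicSign_eq_sub h.bottom h8 h9]
  · rw [cyclicSign_swap, ← cyclicSign_rotate, cyclicSign_eq_sub h.middle h14.symm h12.symm]
  · rw [← cyclicSign_rotate, cyclicSign_eq_sub h.bottom h11 h12]

/-- The corners of this loop are exchanged with `b` on the top strand and with `c` on the middle
strand. Only there do the coefficients change. -/
lemma loopCoeff_a (z : Fin (2 * n)) : G.loopCoeff (G.swappedOrder a b c) a z =
    G.loopCoeff cyclicSign a z + ((if z = b then -2 * ((η * G.sign b : ℤˣ) : ℤ) else 0) +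
      (if z = c then 2 * ((η * G.sign c : ℤˣ) : ℤ) else 0)) := by
  obtain ⟨h1, h2, h3, ⟨h4, h5, h6⟩, ⟨h7, h8, h9⟩, ⟨h10, h11, h12⟩, h13, h14, h15⟩ := h.distinct
  obtain ⟨v1, v2, v3, v4, v5, v6⟩ := h.loopCoeff_values
  unfold loopCoeff at v1 v2
  simp only [loopCoeff, swappedOrder]
  rw [cyclicSign_comp_of_posSign (τ := G.triangleSwap a b c) h.posSign_a h.posSign_pa h7.symm h3 z, v1, v2]
  simp only [mul_neg, neg_mul, neg_neg]

lemma loopCoeff_b (z : Fin (2 * n)) : G.loopCoeff (G.swappedOrder a b c) b z =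
    G.loopCoeff cyclicSign b z + ((if z = a then 2 * ((η * G.sign b : ℤˣ) : ℤ) else 0) +
      (if z = G.partner c then
        2 * ((η * (G.sign a * G.sign b * G.sign c) : ℤˣ) : ℤ) else 0)) := by
  obtain ⟨h1, h2, h3, ⟨h4, h5, h6⟩, ⟨h7, h8, h9⟩, ⟨h10, h11, h12⟩, h13, h14, h15⟩ := h.distinct
  obtain ⟨v1, v2, v3, v4, v5, v6⟩ := h.loopCoeff_values
  unfold loopCoeff at v3 v4
  simp only [loopCoeff, swappedOrder]
  rw [cyclicSign_comp_of_posSign (τ := G.triangleSwap a b c) h.posSign_b h.posSign_pb h5.symm h6 z, v3, v4]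
  simp only [mul_neg, neg_mul, neg_neg]

lemma loopCoeff_c (z : Fin (2 * n)) : G.loopCoeff (G.swappedOrder a b c) c z =
    G.loopCoeff cyclicSign c z + ((if z = G.partner a then 2 * ((η * G.sign c : ℤˣ) : ℤ) else 0) +
      (if z = G.partner b then
        -2 * ((η * (G.sign a * G.sign b * G.sign c) : ℤˣ) : ℤ) else 0)) := by
  obtain ⟨h1, h2, h3, ⟨h4, h5, h6⟩, ⟨h7, h8, h9⟩, ⟨h10, h11, h12⟩, h13, h14, h15⟩ := h.distinct
  obtain ⟨v1, v2, v3, v4, v5, v6⟩ := h.loopCoeff_values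
  unfold loopCoeff at v5 v6
  simp only [loopCoeff, swappedOrder]
  rw [cyclicSign_comp_of_posSign (τ := G.triangleSwap a b c) h.posSign_c h.posSign_pc h14.symm h13 z, v5, v6]
  simp only [mul_neg, neg_mul, neg_neg]

lemma loopCoeff_values' :
    G.loopCoeff (G.swappedOrder a b c) a b = -((η * G.sign b : ℤˣ) : ℤ) ∧
    G.loopCoeff (G.swappedOrder a b c) a c = ((η * G.sign c : ℤˣ) : ℤ) ∧
    G.loopCoeff (G.swappedOrder a b c) b a = ((η * G.sign b : ℤˣ) : ℤ) ∧
    G.loopCoeff (G.swappedOrder a b c) b (G.partner c) =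
      ((η * (G.sign a * G.sign b * G.sign c) : ℤˣ) : ℤ) ∧
    G.loopCoeff (G.swappedOrder a b c) c (G.partner a) = ((η * G.sign c : ℤˣ) : ℤ) ∧
    G.loopCoeff (G.swappedOrder a b c) c (G.partner b) =
      -((η * (G.sign a * G.sign b * G.sign c) : ℤˣ) : ℤ) := by
  obtain ⟨h1, h2, h3, ⟨h4, h5, h6⟩, ⟨h7, h8, h9⟩, ⟨h10, h11, h12⟩, h13, h14, h15⟩ := h.distinct
  obtain ⟨v1, v2, v3, v4, v5, v6⟩ := h.loopCoeff_values
  rw [h.loopCoeff_a, h.loopCoeff_a, h.loopCoeff_b, h.loopCoeff_b, h.loopCoeff_c, h.loopCoeff_c,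
    v1, v2, v3, v4, v5, v6, if_pos rfl, if_neg h3, if_neg h3.symm, if_pos rfl, if_pos rfl,
    if_neg h6, if_neg h6.symm, if_pos rfl, if_pos rfl, if_neg h13, if_neg h13.symm, if_pos rfl]
  refine ⟨?_, ?_, ?_, ?_, ?_, ?_⟩ <;> ring

lemma loopCoeff_of_ne {x : Fin (2 * n)} (h1 : x ≠ a) (h2 : x ≠ b) (h3 : x ≠ c)
    (h4 : x ≠ G.partner a) (h5 : x ≠ G.partner b) (h6 : x ≠ G.partner c) (z : Fin (2 * n)) :
    G.loopCoeff (G.swappedOrder a b c) x z = G.loopCoeff cyclicSign x z := by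
  have key : ∀ u v, G.partner u = v → u = G.partner v := by
    rintro u v rfl; exact (G.partner_partner u).symm
  have k1 : G.partner x ≠ a := fun e => h4 (key _ _ e)
  have k2 : G.partner x ≠ b := fun e => h5 (key _ _ e)
  have k3 : G.partner x ≠ c := fun e => h6 (key _ _ e)
  have k4 : G.partner x ≠ G.partner a := fun e => h1 (G.partner_injective e)
  have k5 : G.partner x ≠ G.partner b := fun e => h2 (G.partner_injective e)
  have k6 : G.partner x ≠ G.partner c := fun e => h3 (G.partner_injective e)
  simp only [loopCoeff, swappedOrder, cyclicSign, h.posSign_triangleSwap, h1, h2, h3, h4, h5, h6, k1, k2, k3,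
    k4, k5, k6, false_and, and_false, or_self, if_false, one_mul]

/-- Neighbouring points on a strand lie on the same side of any loop with its corner outside the
triangle. -/
lemma loopCoeff_adjacent {x : Fin (2 * n)} (h1 : x ≠ a) (h2 : x ≠ b) (h3 : x ≠ c)
    (h4 : x ≠ G.partner a) (h5 : x ≠ G.partner b) (h6 : x ≠ G.partner c) :
    G.loopCoeff cyclicSign x b = G.loopCoeff cyclicSign x a ∧
    G.loopCoeff cyclicSign x c = G.loopCoeff cyclicSign x (G.partner a) ∧
    G.loopCoeff cyclicSign x (G.partner c) = G.loopCoeff cyclicSign x (G.partner b) := by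
  have key : ∀ u v, G.partner u = v → u = G.partner v := by
    rintro u v rfl; exact (G.partner_partner u).symm
  have k1 : G.partner x ≠ a := fun e => h4 (key _ _ e)
  have k2 : G.partner x ≠ b := fun e => h5 (key _ _ e)
  have k3 : G.partner x ≠ c := fun e => h6 (key _ _ e)
  have k4 : G.partner x ≠ G.partner a := fun e => h1 (G.partner_injective e)
  have k5 : G.partner x ≠ G.partner b := fun e => h2 (G.partner_injective e)
  have k6 : G.partner x ≠ G.partner c := fun e => h3 (G.partner_injective e)
  refine ⟨?_, ?_, ?_⟩
  · rcases units_sub_eq h.top with e | e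
    · exact cyclicSign_succ e h1 h2 k1 k2
    · exact (cyclicSign_succ e h2 h1 k2 k1).symm
  · rcases units_sub_eq h.middle with e | e
    · exact cyclicSign_succ e h4 h3 k4 k3
    · exact (cyclicSign_succ e h3 h4 k3 k4).symm
  · rcases units_sub_eq h.bottom with e | e
    · exact cyclicSign_succ e h5 h6 k5 k6
    · exact (cyclicSign_succ e h6 h5 k6 k5).symm

/-- The corrections sit at `b` and `c` and carry the signs of these arrows, which also occur in the
flat signs. As they square to `1`, what remains is the difference of `u` at two neighbouring points
of the bottom strand; this vanishes for constant `u` and for loops with their corners elsewhere. -/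
lemma intersect_a (u : Fin (2 * n) → ℤ) :
    G.intersect u (G.loopCoeff (G.swappedOrder a b c) a) =
      G.intersect u (G.loopCoeff cyclicSign a) +
        2 * (η : ℤ) * (u (G.partner b) - u (G.partner c)) := by
  have hb : (G.sign b : ℤ) * G.sign b = 1 := by
    rw [← Units.val_mul, Int.units_mul_self]; rfl
  have hc : (G.sign c : ℤ) * G.sign c = 1 := by
    rw [← Units.val_mul, Int.units_mul_self]; rfl
  rw [funext h.loopCoeff_a, intersect_add_right, intersect_add_right, intersect_single,
    intersect_single, flatSign_partner, flatSign_partner]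
  simp only [flatSign, h.tail_b, h.tail_c, Units.val_mul, Bool.false_eq_true, if_false]
  linear_combination (2 * (η : ℤ) * u (G.partner b)) * hb - (2 * (η : ℤ) * u (G.partner c)) * hc

lemma intersect_b (u : Fin (2 * n) → ℤ) :
    G.intersect u (G.loopCoeff (G.swappedOrder a b c) b) =
      G.intersect u (G.loopCoeff cyclicSign b) +
        2 * (η * G.sign a * G.sign b : ℤ) * (u c - u (G.partner a)) := by
  have hc : (G.sign c : ℤ) * G.sign c = 1 := by
    rw [← Units.val_mul, Int.units_mul_self]; rfl
  rw [funext h.loopCoeff_b, intersect_add_right, intersect_add_right, intersect_single,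
    intersect_single, flatSign_partner, G.partner_partner]
  simp only [flatSign, h.tail_a, h.tail_c, Units.val_mul, Bool.false_eq_true, if_false]
  linear_combination (2 * (η * G.sign a * G.sign b : ℤ) * u c) * hc

lemma intersect_c (u : Fin (2 * n) → ℤ) :
    G.intersect u (G.loopCoeff (G.swappedOrder a b c) c) =
      G.intersect u (G.loopCoeff cyclicSign c) +
        2 * (η * G.sign a * G.sign c : ℤ) * (u a - u b) := by
  have hb : (G.sign b : ℤ) * G.sign b = 1 := by
    rw [← Units.val_mul, Int.units_mul_self]; rfl
  rw [funext h.loopCoeff_c, intersect_add_right, intersect_add_right, intersect_single,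
    intersect_single, G.partner_partner, G.partner_partner]
  simp only [flatSign, h.tail_a, h.tail_b, Units.val_mul, Bool.false_eq_true, if_false]
  linear_combination -(2 * (η * G.sign a * G.sign c : ℤ) * u b) * hb

/-- All corrections are differences of values of `u`, and here `u` is constant. -/
lemma loopIndex_swappedOrder (x : Fin (2 * n)) :
    G.loopIndex (G.swappedOrder a b c) x = G.loopIndex cyclicSign x := by
  refine induction_end (G := G) (a := a) (b := b) (c := c) (P := fun x => G.loopIndex (G.swappedOrder a b c) x = G.loopIndex cyclicSign x)
    ?_ ?_ ?_ ?_ ?_ x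
  · rw [loopIndex_eq_intersect, loopIndex_eq_intersect, h.intersect_a]; ring
  · rw [loopIndex_eq_intersect, loopIndex_eq_intersect, h.intersect_b]; ring
  · rw [loopIndex_eq_intersect, loopIndex_eq_intersect, h.intersect_c]; ring
  · intro x hx
    rw [loopIndex_partner, ← hx]
    simp only [loopIndex, loopCoeff_swappedOrder_partner, mul_neg, Finset.sum_neg_distrib]
  · intro x h1 h2 h3 h4 h5 h6
    simp only [loopIndex, h.loopCoeff_of_ne h1 h2 h3 h4 h5 h6]

lemma intersect_swappedOrder_of_ne {x : Fin (2 * n)} (h1 : x ≠ a) (h2 : x ≠ b) (h3 : x ≠ c)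
    (h4 : x ≠ G.partner a) (h5 : x ≠ G.partner b) (h6 : x ≠ G.partner c) (y : Fin (2 * n)) :
    G.intersect (G.loopCoeff (G.swappedOrder a b c) x) (G.loopCoeff (G.swappedOrder a b c) y) =
      G.intersect (G.loopCoeff cyclicSign x) (G.loopCoeff cyclicSign y) := by
  obtain ⟨k1, k2, k3⟩ := h.loopCoeff_adjacent h1 h2 h3 h4 h5 h6
  rw [funext (h.loopCoeff_of_ne h1 h2 h3 h4 h5 h6)]
  refine induction_end (G := G) (a := a) (b := b) (c := c) (P := fun y => G.intersect (G.loopCoeff cyclicSign x) (G.loopCoeff (G.swappedOrder a b c) y) =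
      G.intersect (G.loopCoeff cyclicSign x) (G.loopCoeff cyclicSign y))
    ?_ ?_ ?_ ?_ ?_ y
  · rw [h.intersect_a, k3]; ring
  · rw [h.intersect_b, k2]; ring
  · rw [h.intersect_c, k1]; ring
  · intro y hy
    rw [intersect_loopCoeff_partner, ← hy, ← intersect_neg_right,
      funext (G.loopCoeff_swappedOrder_partner a b c y)]
  · intro y g1 g2 g3 g4 g5 g6
    rw [funext (h.loopCoeff_of_ne g1 g2 g3 g4 g5 g6)]

/-- If one of the loops has its corner outside the triangle, no correction arises. For two loops at
the triangle the corrections of the first and of the second loop are nonzero, but cancel. -/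
lemma intersect_swappedOrder (x y : Fin (2 * n)) :
    G.intersect (G.loopCoeff (G.swappedOrder a b c) x) (G.loopCoeff (G.swappedOrder a b c) y) =
      G.intersect (G.loopCoeff cyclicSign x) (G.loopCoeff cyclicSign y) := by
  have ho := @h.intersect_swappedOrder_of_ne
  have hself : ∀ u, G.intersect u u = 0 := fun u => by have := G.intersect_swap u u; omega
  have hp : ∀ u x, G.intersect u (G.loopCoeff (G.swappedOrder a b c) (G.partner x)) =
      -G.intersect u (G.loopCoeff (G.swappedOrder a b c) x) := by
    intro u x
    rw [← intersect_neg_right, funext (G.loopCoeff_swappedOrder_partner a b c x)]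
  have hz : ∀ u, G.loopCoeff cyclicSign u u = 0 ∧ G.loopCoeff cyclicSign u (G.partner u) = 0 ∧
      G.loopCoeff (G.swappedOrder a b c) u u = 0 ∧
      G.loopCoeff (G.swappedOrder a b c) u (G.partner u) = 0 := by
    intro u
    simp [loopCoeff, swappedOrder, cyclicSign_self_left, cyclicSign_self_right]
  obtain ⟨v1, v2, v3, v4, v5, v6⟩ := h.loopCoeff_values
  obtain ⟨w1, w2, w3, w4, w5, w6⟩ := h.loopCoeff_values'
  have hη : (η : ℤ) * η = 1 := by rw [← Units.val_mul, Int.units_mul_self]; rfl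
  have hb2 : (G.sign b : ℤ) * G.sign b = 1 := by rw [← Units.val_mul, Int.units_mul_self]; rfl
  have hc2 : (G.sign c : ℤ) * G.sign c = 1 := by rw [← Units.val_mul, Int.units_mul_self]; rfl
  -- The loops are replaced one after the other: the correction for `b` is taken with the new loop
  -- at `a`, and the correction for `a` with the old loop at `b`.
  have hab : G.intersect (G.loopCoeff (G.swappedOrder a b c) a)
      (G.loopCoeff (G.swappedOrder a b c) b) =
      G.intersect (G.loopCoeff cyclicSign a) (G.loopCoeff cyclicSign b) := by
    rw [h.intersect_b, G.intersect_swap _ (G.loopCoeff cyclicSign b), h.intersect_a,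
      G.intersect_swap (G.loopCoeff cyclicSign b), (hz a).2.2.2, (hz b).2.1, w2, v4]
    simp only [Units.val_mul]
    ring
  have hac : G.intersect (G.loopCoeff (G.swappedOrder a b c) a)
      (G.loopCoeff (G.swappedOrder a b c) c) =
      G.intersect (G.loopCoeff cyclicSign a) (G.loopCoeff cyclicSign c) := by
    rw [h.intersect_c, G.intersect_swap _ (G.loopCoeff cyclicSign c), h.intersect_a,
      G.intersect_swap (G.loopCoeff cyclicSign c), (hz a).2.2.1, (hz c).2.1, w1, v6]
    simp only [Units.val_mul]
    ring
  have hbc : G.intersect (G.loopCoeff (G.swappedOrder a b c) b)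
      (G.loopCoeff (G.swappedOrder a b c) c) =
      G.intersect (G.loopCoeff cyclicSign b) (G.loopCoeff cyclicSign c) := by
    rw [h.intersect_c, G.intersect_swap _ (G.loopCoeff cyclicSign c), h.intersect_b,
      G.intersect_swap (G.loopCoeff cyclicSign c), (hz b).2.2.1, (hz c).1, w3, v5]
    simp only [Units.val_mul]
    ring
  have hsymm : ∀ x y, G.intersect (G.loopCoeff (G.swappedOrder a b c) x)
      (G.loopCoeff (G.swappedOrder a b c) y) =
      G.intersect (G.loopCoeff cyclicSign x) (G.loopCoeff cyclicSign y) →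
      G.intersect (G.loopCoeff (G.swappedOrder a b c) y)
      (G.loopCoeff (G.swappedOrder a b c) x) =
      G.intersect (G.loopCoeff cyclicSign y) (G.loopCoeff cyclicSign x) := by
    intro x y hxy
    rw [G.intersect_swap, hxy, ← G.intersect_swap]
  have hstep : ∀ x y, G.intersect (G.loopCoeff (G.swappedOrder a b c) x)
      (G.loopCoeff (G.swappedOrder a b c) y) =
      G.intersect (G.loopCoeff cyclicSign x) (G.loopCoeff cyclicSign y) →
      G.intersect (G.loopCoeff (G.swappedOrder a b c) x)
      (G.loopCoeff (G.swappedOrder a b c) (G.partner y)) =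
      G.intersect (G.loopCoeff cyclicSign x) (G.loopCoeff cyclicSign (G.partner y)) := by
    intro x y hxy
    rw [hp, hxy, intersect_loopCoeff_partner]
  refine induction_end (G := G) (a := a) (b := b) (c := c) (P := fun x => G.intersect (G.loopCoeff (G.swappedOrder a b c) x)
      (G.loopCoeff (G.swappedOrder a b c) y) =
      G.intersect (G.loopCoeff cyclicSign x) (G.loopCoeff cyclicSign y))
    ?_ ?_ ?_ ?_ ?_ x
  · refine induction_end (G := G) (a := a) (b := b) (c := c) (P := fun y => G.intersect (G.loopCoeff (G.swappedOrder a b c) a)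
        (G.loopCoeff (G.swappedOrder a b c) y) =
        G.intersect (G.loopCoeff cyclicSign a) (G.loopCoeff cyclicSign y))
        ?_ hab hac (hstep a) ?_ y
    · rw [hself, hself]
    · exact fun y g1 g2 g3 g4 g5 g6 => hsymm _ _ (ho g1 g2 g3 g4 g5 g6 a)
  · refine induction_end (G := G) (a := a) (b := b) (c := c) (P := fun y => G.intersect (G.loopCoeff (G.swappedOrder a b c) b)
        (G.loopCoeff (G.swappedOrder a b c) y) =
        G.intersect (G.loopCoeff cyclicSign b) (G.loopCoeff cyclicSign y))
      (hsymm _ _ hab) ?_ hbc (hstep b) ?_ y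
    · rw [hself, hself]
    · exact fun y g1 g2 g3 g4 g5 g6 => hsymm _ _ (ho g1 g2 g3 g4 g5 g6 b)
  · refine induction_end (G := G) (a := a) (b := b) (c := c) (P := fun y => G.intersect (G.loopCoeff (G.swappedOrder a b c) c)
        (G.loopCoeff (G.swappedOrder a b c) y) =
        G.intersect (G.loopCoeff cyclicSign c) (G.loopCoeff cyclicSign y))
      (hsymm _ _ hac) (hsymm _ _ hbc) ?_
        (hstep c) ?_ y
    · rw [hself, hself]
    · exact fun y g1 g2 g3 g4 g5 g6 => hsymm _ _ (ho g1 g2 g3 g4 g5 g6 c)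
  · exact fun x hx => hsymm _ _ (hstep _ _ (hsymm _ _ hx))
  · exact fun x g1 g2 g3 g4 g5 g6 => ho g1 g2 g3 g4 g5 g6 y

end IsTriangle

lemma loopInvariant_omega3 (h : Omega3 G G') :
    G'.loopInvariant cyclicSign = G.loopInvariant cyclicSign := by
  obtain ⟨a, b, c, η, ht, rfl⟩ := omega3_iff.mp h
  rw [transport_loopInvariant]
  exact G.loopInvariant_congr ht.loopIndex_swappedOrder ht.intersect_swappedOrder

end GaussDiagram

/-! ### The value of the flat invariant on the Kishino knot -/

namespace GaussDiagram

variable {n : ℕ}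

lemma loopInvariant_eq_of_eqvGen {G G' : Σ n, GaussDiagram n}
    (h : Relation.EqvGen VirtualKnotMove G G') :
    G.2.loopInvariant cyclicSign = G'.2.loopInvariant cyclicSign := by
  induction h with
  | rel _ _ h =>
    cases h with
    | reidemeister h =>
      cases h with
      | omega1 h => exact (loopInvariant_omega1 h).symm
      | omega2 h => exact (loopInvariant_omega2 h).symm
      | omega3 h => exact (loopInvariant_omega3 h).symm
    | basePoint G => exact G.loopInvariant_basedAt_one.symm
  | refl => rfl
  | symm _ _ _ ih => exact ih.symm
  | trans _ _ _ _ _ ih1 ih2 => exact ih1.trans ih2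

lemma loopInvariant_eq_zero {G : GaussDiagram n} (h : ∀ x, G.loopIndex cyclicSign x = 0) :
    G.loopInvariant cyclicSign = 0 := by
  simp [loopInvariant, h]

lemma loopInvariant_kishino_ne_zero (ε δ : ℤˣ) : (kishino ε δ).loopInvariant cyclicSign ≠ 0 := by
  rcases Int.units_eq_one_or ε with rfl | rfl <;> rcases Int.units_eq_one_or δ with rfl | rfl <;>
    decide +kernel

end GaussDiagram

/-! ### Flows, faces and height functions of planar diagrams -/

/-- The rotation is a single cycle: one climbs from `i` to the last point, passes to `0`, and climbs
again. -/
lemma finRotate_induction {m : ℕ} {P : Fin m → Prop} {i : Fin m} (hi : P i)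
    (hs : ∀ j, P j → P (finRotate m j)) (j : Fin m) : P j := by
  have up : ∀ i : Fin m, P i → ∀ k, ∀ j : Fin m, j.val = i.val + k → P j := by
    intro i hi k
    induction k with
    | zero => exact fun j hj => Fin.ext (by simpa using hj) ▸ hi
    | succ k ih =>
      intro j hj
      have hk : i.val + k < m := by omega
      have := hs _ (ih ⟨i.val + k, hk⟩ rfl)
      have e : finRotate m ⟨i.val + k, hk⟩ = j := by
        apply Fin.ext
        rw [finRotate_val, if_neg (by simp; omega)]
        simp; omega
      rwa [e] at this
  have hm : 0 < m := by have := i.isLt; omega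
  have hlast : P ⟨m - 1, by omega⟩ := up i hi (m - 1 - i.val) _ (by simp; omega)
  have hzero : P ⟨0, hm⟩ := by
    have e : finRotate m ⟨m - 1, by omega⟩ = ⟨0, hm⟩ := by
      apply Fin.ext
      rw [finRotate_val, if_pos (by simp; omega)]
    exact e ▸ hs _ hlast
  exact up _ hzero j.val j (by simp)

lemma finrank_le_one_of_constant {ι : Type*} {V : Submodule ℝ (ι → ℝ)}
    (h : ∀ v ∈ V, ∀ i j, v i = v j) : Module.finrank ℝ V ≤ 1 := by
  have : V ≤ Submodule.span ℝ {fun _ => 1} := by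
    intro v hv
    rw [Submodule.mem_span_singleton]
    rcases isEmpty_or_nonempty ι with hι | ⟨⟨i⟩⟩
    · exact ⟨0, Subsingleton.elim _ _⟩
    · exact ⟨v i, funext fun j => by simp [h v hv j i]⟩
  exact (Submodule.finrank_mono this).trans (by
    simpa using finrank_span_le_card (R := ℝ) ({fun _ => 1} : Set (ι → ℝ)))

namespace GaussDiagram

variable {n : ℕ} (G : GaussDiagram n)

/-- A function on the edges (an edge is denoted by its terminal point) is a flow if it satisfies
Kirchhoff's law at every crossing. -/
def IsFlow (c : Fin (2 * n) → ℝ) : Prop :=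
  ∀ z, c z + c (G.partner z) =
    c (finRotate (2 * n) z) + c (finRotate (2 * n) (G.partner z))

def flows : Submodule ℝ (Fin (2 * n) → ℝ) where
  carrier := {c | G.IsFlow c}
  add_mem' := by
    intro a b ha hb z
    have := ha z
    have := hb z
    simp only [Pi.add_apply]
    linarith
  zero_mem' := by intro z; simp
  smul_mem' := by
    intro r c hc z
    have := hc z
    simp only [Pi.smul_apply, smul_eq_mul, ← mul_add, this]

/-- The faces of the diagram. -/
abbrev Face : Type :=
  Quotient (Equiv.Perm.SameCycle.setoid (G.otherHalf.trans G.nextHalf))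

/-- The face to the left of the edge that ends at `z`. -/
def leftFace (z : Fin (2 * n)) : G.Face := Quotient.mk _ (z, false)

/-- The face to the right of the edge that ends at `z`. -/
def rightFace (z : Fin (2 * n)) : G.Face := Quotient.mk _ ((finRotate (2 * n)).symm z, true)

/-- A face is an orbit of the passage along its boundary. -/
lemma face_mk_eq (x : Fin (2 * n) × Bool) :
    (Quotient.mk _ (G.nextHalf (G.otherHalf x)) : G.Face) = Quotient.mk _ x := by
  apply Quotient.sound
  exact (Equiv.Perm.sameCycle_apply_left
    (f := G.otherHalf.trans G.nextHalf)).mpr (Equiv.Perm.SameCycle.refl _ _)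

lemma crossesRightward_partner (z : Fin (2 * n)) :
    G.crossesRightward (G.partner z) = !G.crossesRightward z := by
  simp [crossesRightward, G.isHead_partner, G.sign_partner]

lemma crossesRightward_iff (z : Fin (2 * n)) :
    (G.crossesRightward z = true ↔ G.flatSign z = -1) ∧
    (G.crossesRightward z = false ↔ G.flatSign z = 1) := by
  unfold crossesRightward flatSign
  rcases Int.units_eq_one_or (G.sign z) with h | h <;> cases hb : G.isHead z <;> simp [h]

lemma rightFace_eq (z : Fin (2 * n)) :
    G.rightFace z = Quotient.mk _ (G.partner z, G.crossesRightward z) := by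
  rw [rightFace, ← face_mk_eq]
  congr 1
  simp [otherHalf, nextHalf, -finRotate_apply, -finRotate_symm_apply]

lemma leftFace_finRotate (z : Fin (2 * n)) : G.leftFace (finRotate (2 * n) z) =
    Quotient.mk _ (G.partner z, !G.crossesRightward z) := by
  rw [leftFace, ← face_mk_eq]
  congr 1
  simp [otherHalf, nextHalf, -finRotate_apply, -finRotate_symm_apply]

lemma rightFace_finRotate (z : Fin (2 * n)) :
    G.rightFace (finRotate (2 * n) z) = Quotient.mk _ (z, true) := by
  simp [rightFace, -finRotate_apply, -finRotate_symm_apply]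

/-- The four faces at a crossing. -/
lemma faces_at_crossing {z : Fin (2 * n)} (h : G.crossesRightward z = true) :
    G.rightFace z = G.rightFace (finRotate (2 * n) (G.partner z)) ∧
    G.rightFace (G.partner z) = G.leftFace z ∧
    G.leftFace (finRotate (2 * n) z) = G.leftFace (G.partner z) ∧
    G.leftFace (finRotate (2 * n) (G.partner z)) = G.rightFace (finRotate (2 * n) z) := by
  refine ⟨?_, ?_, ?_, ?_⟩
  · rw [rightFace_eq, h, rightFace_finRotate]
  · rw [rightFace_eq, crossesRightward_partner, h, G.partner_partner]
    rfl
  · rw [leftFace_finRotate, h]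
    rfl
  · rw [leftFace_finRotate, crossesRightward_partner, h, G.partner_partner, rightFace_finRotate]
    rfl

/-- The jump of a function on the faces across the edges. -/
def faceJump : (G.Face → ℝ) →ₗ[ℝ] (Fin (2 * n) → ℝ) where
  toFun J z := J (G.leftFace z) - J (G.rightFace z)
  map_add' J J' := by ext z; simp; ring
  map_smul' r J := by ext z; simp; ring

lemma faceJump_apply (J : G.Face → ℝ) (z : Fin (2 * n)) :
    G.faceJump J z = J (G.leftFace z) - J (G.rightFace z) := rfl

/-- The total jump across the two incoming edges and that across the two outgoing edges both compare
the same two opposite faces at the crossing. -/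
lemma isFlow_faceJump (J : G.Face → ℝ) : G.IsFlow (G.faceJump J) := by
  intro z
  simp only [faceJump_apply]
  cases h : G.crossesRightward z with
  | true =>
    obtain ⟨h1, h2, h3, h4⟩ := G.faces_at_crossing h
    rw [h1, h2, h3, h4]
    ring
  | false =>
    have h' : G.crossesRightward (G.partner z) = true := by
      rw [crossesRightward_partner, h]; rfl
    obtain ⟨h1, h2, h3, h4⟩ := G.faces_at_crossing h'
    rw [G.partner_partner] at *
    rw [h1, h2, h3, h4]
    ring

/-- The sum of the values of a function on the faces to the left and to the right of an edge. -/
def edgeHeight (J : G.Face → ℝ) (z : Fin (2 * n)) : ℝ := -(J (G.leftFace z) + J (G.rightFace z))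

/-- Both identities are linear in the values of `J` at the four faces round the crossing. The flat
sign records the direction in which the other strand passes. -/
lemma edgeHeight_finRotate (J : G.Face → ℝ) (z : Fin (2 * n)) :
    G.edgeHeight J (finRotate (2 * n) z) - G.edgeHeight J z =
      G.flatSign z * (G.faceJump J (G.partner z) +
        G.faceJump J (finRotate (2 * n) (G.partner z))) ∧
    G.edgeHeight J (finRotate (2 * n) (G.partner z)) - G.edgeHeight J z =
      G.flatSign z * (G.faceJump J (finRotate (2 * n) (G.partner z)) - G.faceJump J z) := by
  simp only [edgeHeight, faceJump_apply]
  cases h : G.crossesRightward z with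
  | true =>
    obtain ⟨h1, h2, h3, h4⟩ := G.faces_at_crossing h
    rw [(G.crossesRightward_iff z).1.mp h, h1, h2, h3, h4]
    constructor <;> push_cast <;> ring
  | false =>
    have h' : G.crossesRightward (G.partner z) = true := by
      rw [crossesRightward_partner, h]; rfl
    obtain ⟨h1, h2, h3, h4⟩ := G.faces_at_crossing h'
    rw [G.partner_partner] at *
    rw [(G.crossesRightward_iff z).2.mp h, h1, h2, h3, h4]
    constructor <;> push_cast <;> ring

/-- If `J` has no jumps, its height is constant along the whole curve. Every face borders on an
edge, and there the height is `-2` times the value of `J`. -/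
lemma finrank_ker_faceJump : Module.finrank ℝ (LinearMap.ker G.faceJump) ≤ 1 := by
  apply finrank_le_one_of_constant
  intro J hJ
  have h0 : ∀ z, J (G.leftFace z) = J (G.rightFace z) := by
    intro z
    have := congrFun (LinearMap.mem_ker.mp hJ) z
    rw [faceJump_apply] at this
    simpa [sub_eq_zero] using this
  have h1 : ∀ z, G.edgeHeight J (finRotate (2 * n) z) = G.edgeHeight J z := by
    intro z
    have := (G.edgeHeight_finRotate J z).1
    simp only [faceJump_apply, h0] at this
    linarith
  have h2 : ∀ x y, G.edgeHeight J y = G.edgeHeight J x := fun x y =>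
    finRotate_induction (P := fun y => G.edgeHeight J y = G.edgeHeight J x) rfl
      (fun j hj => (h1 j).trans hj) y
  have h3 : ∀ q, ∃ z, 2 * J q = -G.edgeHeight J z := by
    intro q
    induction q using Quotient.inductionOn with
    | h x =>
      obtain ⟨x, _ | _⟩ := x
      · refine ⟨x, ?_⟩
        have := h0 x
        simp only [edgeHeight]
        change 2 * J (G.leftFace x) = _
        linarith
      · refine ⟨finRotate (2 * n) x, ?_⟩
        have := h0 (finRotate (2 * n) x)
        simp only [edgeHeight]
        rw [← rightFace_finRotate]
        linarith
  intro q r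
  obtain ⟨z, hz⟩ := h3 q
  obtain ⟨w, hw⟩ := h3 r
  have := h2 z w
  linarith

lemma card_heads : Fintype.card {z // G.isHead z = true} = n := by
  have e : {z // G.isHead z = true} ≃ {z // ¬ G.isHead z = true} :=
    { toFun := fun z => ⟨G.partner z.1, by simp [G.isHead_partner, z.2]⟩
      invFun := fun z => ⟨G.partner z.1, by have := z.2; simp at this; simp [G.isHead_partner, this]⟩
      left_inv := fun z => Subtype.ext (G.partner_partner _)
      right_inv := fun z => Subtype.ext (G.partner_partner _) }
  have h1 := Fintype.card_congr e
  have h2 := Fintype.card_subtype_compl (fun z => G.isHead z = true)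
  have h3 := Fintype.card_subtype_le (fun z => G.isHead z = true)
  rw [Fintype.card_fin] at h2 h3
  omega

/-- The head of the arrow through `z`. -/
def headOf (z : Fin (2 * n)) : {z // G.isHead z = true} :=
  if h : G.isHead z = true then ⟨z, h⟩ else ⟨G.partner z, by simp [G.isHead_partner, h]⟩

lemma headOf_partner (z : Fin (2 * n)) : G.headOf (G.partner z) = G.headOf z := by
  apply Subtype.ext
  unfold headOf
  by_cases h : G.isHead z = true
  · rw [dif_pos h, dif_neg (by simp [G.isHead_partner, h])]
    exact G.partner_partner z
  · rw [dif_neg h, dif_pos (by simp [G.isHead_partner, h])]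

lemma headOf_coe (z : {z // G.isHead z = true}) : G.headOf z.1 = z := by
  simp [headOf, z.2]

/-- The differences, along the edges, of a function on the crossings. -/
def crossingJump : ({z // G.isHead z = true} → ℝ) →ₗ[ℝ] (Fin (2 * n) → ℝ) where
  toFun g z := g (G.headOf z) - g (G.headOf ((finRotate (2 * n)).symm z))
  map_add' J J' := by ext z; simp; ring
  map_smul' r J := by ext z; simp; ring

/-- The curve runs through all crossings, so the graph of the diagram is connected. -/
lemma finrank_ker_crossingJump : Module.finrank ℝ (LinearMap.ker G.crossingJump) ≤ 1 := by
  apply finrank_le_one_of_constant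
  intro g hg
  have h1 : ∀ z, g (G.headOf (finRotate (2 * n) z)) = g (G.headOf z) := by
    intro z
    have := congrFun (LinearMap.mem_ker.mp hg) (finRotate (2 * n) z)
    simpa [crossingJump, sub_eq_zero, -finRotate_apply, -finRotate_symm_apply] using this
  intro x y
  have h2 := finRotate_induction (P := fun z => g (G.headOf z) = g (G.headOf x.1)) rfl
    (fun j hj => (h1 j).trans hj) y.1
  rw [headOf_coe, headOf_coe] at h2
  exact h2.symm

/-- Summation by parts: a flow is orthogonal to every difference of a function on the crossings. A
common element is therefore orthogonal to itself. -/
lemma disjoint_flows_crossingJump : Disjoint G.flows (LinearMap.range G.crossingJump) := by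
  rw [Submodule.disjoint_def]
  rintro c hc ⟨g, rfl⟩
  set c := G.crossingJump g with hcdef
  have key : ∑ z, c z * c z = 0 := by
    have h1 : ∑ z, c z * c z = ∑ z, c z * g (G.headOf z) -
        ∑ z, c (finRotate (2 * n) z) * g (G.headOf z) := by
      have h2 : ∑ z, c (finRotate (2 * n) z) * g (G.headOf z) =
          ∑ z, c z * g (G.headOf ((finRotate (2 * n)).symm z)) := by
        have := Equiv.sum_comp (finRotate (2 * n))
          fun z => c z * g (G.headOf ((finRotate (2 * n)).symm z))
        simpa only [Equiv.symm_apply_apply] using this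
      rw [h2, ← Finset.sum_sub_distrib]
      refine Finset.sum_congr rfl fun z _ => ?_
      rw [← mul_sub]
      rfl
    -- The two end points of a crossing are paired; their excesses of inflow over outflow are
    -- opposite, by Kirchhoff's law.
    have h3 : ∑ z, (c z - c (finRotate (2 * n) z)) * g (G.headOf z) =
        -∑ z, (c z - c (finRotate (2 * n) z)) * g (G.headOf z) := by
      conv_lhs => rw [← G.sum_partner]
      rw [← Finset.sum_neg_distrib]
      refine Finset.sum_congr rfl fun z _ => ?_
      have := hc z
      rw [headOf_partner]
      linear_combination g (G.headOf z) * this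
    simp only [sub_mul, Finset.sum_sub_distrib] at h3
    linarith
  have h0 := (Finset.sum_eq_zero_iff_of_nonneg (fun z _ => mul_self_nonneg (c z))).mp key
  ext z
  simpa using h0 z (Finset.mem_univ z)

/-- The differences of functions on the `n` crossings have dimension at least `n - 1`, and they are
independent of the flows in a space of dimension `2 * n`. -/
lemma finrank_flows_le : Module.finrank ℝ G.flows ≤ n + 1 := by
  have h1 := Submodule.finrank_add_finrank_le_of_disjoint G.disjoint_flows_crossingJump
  have h2 := LinearMap.finrank_range_add_finrank_ker G.crossingJump
  have h3 := G.finrank_ker_crossingJump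
  rw [Module.finrank_fintype_fun_eq_card, card_heads] at h2
  rw [Module.finrank_fintype_fun_eq_card, Fintype.card_fin] at h1
  omega

/-- In a planar diagram every flow bounds: it is the jump of a function on the faces. -/
lemma exists_faceJump_eq (hn : n ≠ 0) (hG : G.IsClassical) {c : Fin (2 * n) → ℝ}
    (hc : G.IsFlow c) : ∃ J, G.faceJump J = c := by
  classical
  have hF : G.faces = n + 2 := by
    rcases hG with h | h
    · exact absurd h hn
    · omega
  have h1 := LinearMap.finrank_range_add_finrank_ker G.faceJump
  have h2 := G.finrank_ker_faceJump
  have h3 := G.finrank_flows_le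
  have h4 : Fintype.card G.Face = n + 2 := by rw [← hF, faces, Nat.card_eq_fintype_card]
  rw [Module.finrank_fintype_fun_eq_card, h4] at h1
  have hle : LinearMap.range G.faceJump ≤ G.flows := by
    rintro _ ⟨J, rfl⟩
    exact G.isFlow_faceJump J
  -- There are `n + 2` faces and the kernel is at most one-dimensional, so the jumps have dimension
  -- at least `n + 1`, the upper bound for flows.
  have heq := Submodule.eq_of_le_of_finrank_le hle (by omega)
  have : c ∈ G.flows := hc
  rw [← heq] at this
  exact this

/-- In a planar diagram every flow has a height function on the edges. -/
lemma exists_height (hn : n ≠ 0) (hG : G.IsClassical) {c : Fin (2 * n) → ℝ} (hc : G.IsFlow c) :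
    ∃ K : Fin (2 * n) → ℝ, ∀ z,
      K (finRotate (2 * n) z) - K z =
        G.flatSign z * (c (G.partner z) + c (finRotate (2 * n) (G.partner z))) ∧
      K (finRotate (2 * n) (G.partner z)) - K z =
        G.flatSign z * (c (finRotate (2 * n) (G.partner z)) - c z) := by
  obtain ⟨J, rfl⟩ := G.exists_faceJump_eq hn hG hc
  exact ⟨G.edgeHeight J, G.edgeHeight_finRotate J⟩

end GaussDiagram

lemma sum_Ioo_eq_sub {m : ℕ} {K g : Fin m → ℝ} (h : ∀ z, K (finRotate m z) - K z = g z)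
    {x y : Fin m} (hxy : x < y) : ∑ z ∈ Finset.Ioo x y, g z = K y - K (finRotate m x) := by
  have succ : ∀ {u v : Fin m}, v.val = u.val + 1 → finRotate m u = v := by
    intro u v huv
    apply Fin.ext
    have := v.isLt
    rw [finRotate_val, if_neg (by omega), huv]
  have key : ∀ k : ℕ, ∀ y : Fin m, y.val = x.val + 1 + k →
      ∑ z ∈ Finset.Ioo x y, g z = K y - K (finRotate m x) := by
    intro k
    induction k with
    | zero =>
      intro y hy
      rw [succ hy, sub_self, Finset.sum_eq_zero]
      intro z hz
      rw [Finset.mem_Ioo, Fin.lt_def, Fin.lt_def] at hz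
      omega
    | succ k ih =>
      intro y hy
      have hk : x.val + 1 + k < m := by have := y.isLt; omega
      have e : finRotate m ⟨x.val + 1 + k, hk⟩ = y := succ (by simp; omega)
      have hI : Finset.Ioo x y = insert ⟨x.val + 1 + k, hk⟩ (Finset.Ioo x ⟨x.val + 1 + k, hk⟩) := by
        ext z
        simp only [Finset.mem_Ioo, Finset.mem_insert, Fin.lt_def, Fin.ext_iff]
        omega
      rw [hI, Finset.sum_insert (by simp), ih _ rfl, ← h, e]
      ring
  rw [Fin.lt_def] at hxy
  exact key (y.val - x.val - 1) y (by omega)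

/-! ### Classical diagrams have vanishing loop indices -/

namespace GaussDiagram

variable {n : ℕ} {G : GaussDiagram n}

/-- The coefficients are `1` on the arc and `-1` off it. Adding the total of the flat signs, which
is zero, makes them `2` and `0`; the contributions of the two corners cancel. -/
lemma loopIndex_cyclicSign {x : Fin (2 * n)} (hx : x < G.partner x) :
    G.loopIndex cyclicSign x = 2 * ∑ z ∈ Finset.Ioo x (G.partner x), G.flatSign z := by
  have h : ∀ z, G.flatSign z * G.loopCoeff cyclicSign x z + G.flatSign z =
      2 * (if z ∈ Finset.Ioo x (G.partner x) then G.flatSign z else 0) +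
      ((if z = x then G.flatSign z else 0) + (if z = G.partner x then G.flatSign z else 0)) := by
    intro z
    rw [Fin.lt_def] at hx
    simp only [loopCoeff, cyclicSign, posSign, Finset.mem_Ioo, Fin.lt_def, Fin.ext_iff]
    split_ifs <;> omega
  have hs := Finset.sum_congr (rfl : (Finset.univ : Finset (Fin (2 * n))) = _) fun z _ => h z
  simp only [Finset.sum_add_distrib, ← Finset.mul_sum, Finset.sum_ite_eq', Finset.mem_univ,
    if_true, Finset.sum_ite_mem, Finset.univ_inter, sum_flatSign, flatSign_partner] at hs
  rw [loopIndex]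
  linarith

/-- For the constant flow `1` the height changes by twice the flat sign along the strand and does
not change in a turn at a crossing. Following the loop, the changes telescope to zero. -/
lemma IsClassical.loopIndex_eq_zero (hG : G.IsClassical) (x : Fin (2 * n)) :
    G.loopIndex cyclicSign x = 0 := by
  wlog hx : x < G.partner x generalizing x
  · have hlt : G.partner x < x := lt_of_le_of_ne (not_lt.mp hx) (G.partner_ne x)
    have := this (G.partner x) (by rwa [G.partner_partner])
    rw [loopIndex_partner] at this
    simpa using this
  have hn : n ≠ 0 := by
    rintro rfl
    exact x.elim0
  obtain ⟨K, hK⟩ := G.exists_height hn hG (c := fun _ => 1) (by intro z; simp)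
  have h1 := sum_Ioo_eq_sub (fun z => (hK z).1) hx
  have h2 := (hK (G.partner x)).2
  rw [G.partner_partner, sub_self, mul_zero] at h2
  have h3 : ∑ z ∈ Finset.Ioo x (G.partner x), ((G.flatSign z : ℤ) : ℝ) * (1 + 1) = 0 := by
    rw [h1]; linarith
  rw [← Finset.sum_mul, ← Int.cast_sum] at h3
  rw [loopIndex_cyclicSign hx]
  have h4 : ((∑ z ∈ Finset.Ioo x (G.partner x), G.flatSign z : ℤ) : ℝ) = 0 := by linarith
  rw [Int.cast_eq_zero.mp h4, mul_zero]

theorem not_representsClassicalKnot_kishino (ε δ : ℤˣ) :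
    ¬ (kishino ε δ).RepresentsClassicalKnot := by
  rintro ⟨m, H, hH, h⟩
  have := loopInvariant_eq_of_eqvGen h
  rw [loopInvariant_eq_zero hH.loopIndex_eq_zero] at this
  exact loopInvariant_kishino_ne_zero ε δ this

end GaussDiagram

/-! ### Cycles of permutations and potentials -/

/-- Starting at `y`, the potential grows as long as `x₀` is not met. It is bounded on a finite set,
so `x₀` is met and lies on the cycle of `y`. -/
lemma Equiv.Perm.exists_pow_eq_of_potential {X : Type*} [Finite X] {w : Equiv.Perm X} {x₀ : X}
    {q : X → ℕ} (hq : ∀ x, w x ≠ x₀ → q x < q (w x)) (y : X) : ∃ k : ℕ, (w ^ k) x₀ = y := by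
  have h1 : ∃ k : ℕ, (w ^ k) y = x₀ := by
    by_contra! h
    have hk : ∀ k : ℕ, k ≤ q ((w ^ k) y) := by
      intro k
      induction k with
      | zero => simp
      | succ k ih =>
        have h2 := h (k + 1)
        have := hq ((w ^ k) y)
        rw [pow_succ', Equiv.Perm.mul_apply] at h2 ⊢
        have := this h2
        omega
    obtain ⟨M, hM⟩ := (Set.finite_range q).bddAbove
    have := hk (M + 1)
    have := hM ⟨(w ^ (M + 1)) y, rfl⟩
    omega
  obtain ⟨k, hk⟩ := h1
  have : Equiv.Perm.SameCycle w x₀ y := ⟨-k, by rw [← hk, ← zpow_natCast, ← Equiv.Perm.mul_apply,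
    ← zpow_add, neg_add_cancel, zpow_zero, Equiv.Perm.one_apply]⟩
  obtain ⟨i, hi⟩ := this.exists_nat_pow_eq
  exact ⟨i, hi⟩

/-- The potential increases up to the first visit of `u`. If `v` came before `u`, its potential
would not exceed that of `u`. -/
lemma Equiv.Perm.pow_eq_of_potential {X : Type*} [Finite X] {w : Equiv.Perm X} {x₀ : X}
    {R : X → X → Prop} {q : X → ℕ} (hq : ∀ x, w x ≠ x₀ → q x < q (w x))
    (hR : ∀ u v, R u v → q u < q v) :
    (∀ y, ∃ k : ℕ, (w ^ k) x₀ = y) ∧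
      ∀ u v, R u v → ∀ k : ℕ, (w ^ k) x₀ = v → ∃ l < k, (w ^ l) x₀ = u := by
  classical
  have hr := Equiv.Perm.exists_pow_eq_of_potential hq
  refine ⟨hr, fun u v huv k hk => ?_⟩
  by_contra! hno
  have hm := Nat.find_spec (hr u)
  have hmin := fun j => @Nat.find_min _ _ (hr u) j
  set m := Nat.find (hr u)
  have hkm : k ≤ m := by
    by_contra! h
    exact hno m h hm
  have key : ∀ j, k + j ≤ m → q ((w ^ k) x₀) ≤ q ((w ^ (k + j)) x₀) := by
    intro j
    induction j with
    | zero => intro _; exact le_rfl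
    | succ j ih =>
      intro hj
      have h1 := ih (by omega)
      have h2 : w ((w ^ (k + j)) x₀) ≠ x₀ := by
        intro h3
        rw [← Equiv.Perm.mul_apply, ← pow_succ'] at h3
        refine hmin (m - (k + j + 1)) (by omega) ?_
        rw [← h3, ← Equiv.Perm.mul_apply, ← pow_add, Nat.sub_add_cancel (by omega), hm]
      have h3 := hq _ h2
      rw [← Equiv.Perm.mul_apply, ← pow_succ'] at h3
      rw [← add_assoc]
      omega
  have h1 := key (m - k) (by omega)
  rw [Nat.add_sub_cancel' hkm, hm, hk] at h1
  have := hR u v huv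
  omega

/-- The time of the first visit serves as the potential. -/
lemma Equiv.Perm.exists_tight_potential {X : Type*} {w : Equiv.Perm X} {x₀ : X}
    {R : X → X → Prop} (hr : ∀ y, ∃ k : ℕ, (w ^ k) x₀ = y)
    (hR : ∀ u v, R u v → ∀ k : ℕ, (w ^ k) x₀ = v → ∃ l < k, (w ^ l) x₀ = u) :
    ∃ q : X → ℕ, (∀ x, w x ≠ x₀ → q (w x) = q x + 1) ∧ ∀ u v, R u v → q u < q v := by
  classical
  refine ⟨fun x => Nat.find (hr x), fun x hx => ?_, fun u v huv => ?_⟩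
  · change Nat.find (hr (w x)) = Nat.find (hr x) + 1
    have hs := Nat.find_spec (hr (w x))
    have hle := Nat.find_min' (hr (w x)) (m := Nat.find (hr x) + 1)
      (by rw [pow_succ', Equiv.Perm.mul_apply, Nat.find_spec (hr x)])
    rcases hk : Nat.find (hr (w x)) with _ | k
    · rw [hk] at hs
      exact absurd hs.symm hx
    · rw [hk, pow_succ', Equiv.Perm.mul_apply] at hs
      have := Nat.find_min' (hr x) (w.injective hs)
      omega
  · obtain ⟨l, hl, hu⟩ := hR u v huv _ (Nat.find_spec (hr v))
    exact (Nat.find_min' (hr u) hu).trans_lt hl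

/-- A permutation consists of one cycle, whose points are met from `x₀` on in an order that satisfies
given conditions, if and only if there is a function that increases along the cycle. -/
lemma Equiv.Perm.exists_potential_iff {X : Type*} [Finite X] (w : Equiv.Perm X) (x₀ : X)
    (R : X → X → Prop) :
    (∃ q : X → ℕ, (∀ x, w x ≠ x₀ → q x < q (w x)) ∧ ∀ u v, R u v → q u < q v) ↔
      (∀ y, ∃ k : ℕ, (w ^ k) x₀ = y) ∧
        ∀ u v, R u v → ∀ k : ℕ, (w ^ k) x₀ = v → ∃ l < k, (w ^ l) x₀ = u := by
  constructor
  · rintro ⟨q, hq, hR⟩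
    exact Equiv.Perm.pow_eq_of_potential hq hR
  · rintro ⟨hr, hR⟩
    obtain ⟨q, hq, hR'⟩ := Equiv.Perm.exists_tight_potential hr hR
    exact ⟨q, fun x hx => by rw [hq x hx]; omega, hR'⟩

/-! ### Ascending sets of arrows -/

namespace ArrowDiagram

variable {n : ℕ}

/-- A set of end points that consists of arrows. -/
def IsClosed (A : ArrowDiagram n) (S : Finset (Fin (2 * n))) : Prop :=
  ∀ i, A.partner i ∈ S ↔ i ∈ S

/-- The other end point of the arrow, for the end points in `S`. -/
def jump (A : ArrowDiagram n) (S : Finset (Fin (2 * n))) (i : Fin (2 * n)) : Fin (2 * n) :=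
  if i ∈ S then A.partner i else i

/-- The passage along the boundary of the surface with ribbons along the arrows in `S`. -/
def walk (A : ArrowDiagram n) (S : Finset (Fin (2 * n))) (i : Fin (2 * n)) : Fin (2 * n) :=
  finRotate (2 * n) (A.jump S i)

/-- The arrows in `S` form an ascending diagram with one boundary component. -/
def Ascends (A : ArrowDiagram n) (S : Finset (Fin (2 * n))) : Prop :=
  ∃ q : Fin (2 * n) → ℕ, (∀ i, (A.walk S i).val ≠ 0 → q i < q (A.walk S i)) ∧
    ∀ i ∈ S, A.isHead i = true → q i < q (A.partner i)

lemma jump_mem_iff {A : ArrowDiagram n} {S : Finset (Fin (2 * n))} (hS : A.IsClosed S)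
    (i : Fin (2 * n)) : A.jump S i ∈ S ↔ i ∈ S := by
  unfold jump
  split_ifs with h
  · exact hS i
  · rfl

lemma jump_jump {A : ArrowDiagram n} {S : Finset (Fin (2 * n))} (hS : A.IsClosed S)
    (i : Fin (2 * n)) : A.jump S (A.jump S i) = i := by
  by_cases h : i ∈ S
  · rw [jump, if_pos ((jump_mem_iff hS i).mpr h), jump, if_pos h, A.partner_partner]
  · rw [jump, if_neg (fun h' => h ((jump_mem_iff hS i).mp h')), jump, if_neg h]

lemma isClosed_univ (A : ArrowDiagram n) : A.IsClosed Finset.univ := fun i => by simp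

lemma walk_univ (A : ArrowDiagram n) (i : Fin (2 * n)) : A.walk Finset.univ i = A.trace i := by
  simp [walk, jump, trace, -finRotate_apply]

lemma boundaryComponents_eq_one_iff (A : ArrowDiagram n) (x₀ : Fin (2 * n)) :
    A.boundaryComponents = 1 ↔ ∀ y, ∃ k : ℕ, (A.trace ^ k) x₀ = y := by
  have hn : n ≠ 0 := by rintro rfl; exact x₀.elim0
  rw [boundaryComponents, if_neg hn, Nat.card_eq_one_iff_unique]
  constructor
  · rintro ⟨h, -⟩ y
    have : Equiv.Perm.SameCycle A.trace x₀ y :=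
      Quotient.exact (h.elim (Quotient.mk _ x₀) (Quotient.mk _ y))
    exact this.exists_nat_pow_eq
  · intro h
    have h' : ∀ q : Quotient (Equiv.Perm.SameCycle.setoid A.trace), q = Quotient.mk _ x₀ := by
      intro q
      induction q using Quotient.inductionOn with
      | h y =>
        obtain ⟨k, hk⟩ := h y
        have : Equiv.Perm.SameCycle A.trace x₀ y := ⟨k, by simpa using hk⟩
        exact (Quotient.sound this).symm
    exact ⟨⟨fun a b => (h' a).trans (h' b).symm⟩, ⟨Quotient.mk _ x₀⟩⟩

/-- This is `Equiv.Perm.exists_potential_iff` for the passage along the boundary, where the relation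
says that `u` is a head and `v` the tail of the same arrow. -/
lemma isAscending_iff (A : ArrowDiagram n) : A.IsAscending ↔ A.Ascends Finset.univ := by
  rcases Nat.eq_zero_or_pos n with rfl | hn
  · refine iff_of_true ⟨by simp [boundaryComponents], fun i => i.elim0⟩
      ⟨fun i => i.elim0, fun i => i.elim0, fun i => i.elim0⟩
  set x₀ : Fin (2 * n) := ⟨0, by omega⟩
  have h0 : ∀ x : Fin (2 * n), x.val = 0 ↔ x = x₀ := fun x => by rw [Fin.ext_iff]
  have h := A.trace.exists_potential_iff x₀ fun u v => A.isHead u = true ∧ v = A.partner u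
  rw [IsAscending, A.boundaryComponents_eq_one_iff x₀]
  simp only [Ascends, walk_univ, ne_eq, h0, Finset.mem_univ, forall_const]
  refine Iff.trans ?_ (h.symm.trans (exists_congr fun q => and_congr_right fun _ =>
    ⟨fun hR u hu => hR u _ ⟨hu, rfl⟩, fun hR u v huv => huv.2 ▸ hR u huv.1⟩))
  refine and_congr_right fun _ => ⟨fun hF u v huv k hk => ?_, fun hF x hx k hk => ?_⟩
  · rw [huv.2] at hk
    obtain ⟨l, hl, e⟩ := hF x₀ rfl k (by rw [hk, A.isHead_partner, huv.1]; rfl)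
    exact ⟨l, hl, by rw [e, hk, A.partner_partner]⟩
  · rw [h0] at hx
    subst hx
    exact hF (A.partner ((A.trace ^ k) x₀)) _ ⟨by rw [A.isHead_partner, hk]; rfl, rfl⟩ k
      (A.partner_partner _).symm

lemma walk_bijective {A : ArrowDiagram n} {S : Finset (Fin (2 * n))} (hS : A.IsClosed S) :
    Function.Bijective (A.walk S) :=
  (finRotate (2 * n)).bijective.comp (Function.Involutive.bijective (jump_jump hS))

/-- The number of steps before a point is reached is a potential. -/
lemma Ascends.exists_tight {A : ArrowDiagram n} {S : Finset (Fin (2 * n))} (h : A.Ascends S)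
    (hS : A.IsClosed S) :
    ∃ q : Fin (2 * n) → ℕ, (∀ i, (A.walk S i).val ≠ 0 → q (A.walk S i) = q i + 1) ∧
      ∀ i ∈ S, A.isHead i = true → q i < q (A.partner i) := by
  rcases Nat.eq_zero_or_pos n with rfl | hn
  · exact ⟨fun i => i.elim0, fun i => i.elim0, fun i => i.elim0⟩
  set x₀ : Fin (2 * n) := ⟨0, by omega⟩
  have h0 : ∀ x : Fin (2 * n), x.val ≠ 0 ↔ x ≠ x₀ := fun x => by rw [Ne, Ne, Fin.ext_iff]
  obtain ⟨q, hq, hR⟩ := h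
  simp only [h0] at hq ⊢
  obtain ⟨h1, h2⟩ := Equiv.Perm.pow_eq_of_potential
    (w := Equiv.ofBijective _ (walk_bijective hS)) (x₀ := x₀)
    (R := fun u v => u ∈ S ∧ A.isHead u = true ∧ v = A.partner u) hq
    (by rintro u v ⟨hu, hh, rfl⟩; exact hR u hu hh)
  obtain ⟨q', hq', hR'⟩ := Equiv.Perm.exists_tight_potential h1 h2
  exact ⟨q', hq', fun i hi hh => hR' i _ ⟨hi, hh, rfl⟩⟩

end ArrowDiagram

lemma finRotate_val_of_ne_zero {m : ℕ} {i : Fin m} (h : (finRotate m i).val ≠ 0) :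
    (finRotate m i).val = i.val + 1 := by
  rw [finRotate_val] at h ⊢
  split_ifs at h ⊢ with h'
  · exact absurd rfl h
  · rfl

namespace ArrowDiagram

lemma IsHom.isClosed_image {k n : ℕ} {A : ArrowDiagram k} {B : ArrowDiagram n}
    {f : Fin (2 * k) → Fin (2 * n)} (hf : A.IsHom B f) {S : Finset (Fin (2 * k))}
    (hS : A.IsClosed S) : B.IsClosed (S.image f) := by
  have h : ∀ i, i ∈ S.image f → B.partner i ∈ S.image f := by
    intro i hi
    obtain ⟨j, hj, rfl⟩ := Finset.mem_image.mp hi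
    rw [← hf.map_partner]
    exact Finset.mem_image_of_mem _ ((hS j).mpr hj)
  exact fun i => ⟨fun hi => B.partner_partner i ▸ h _ hi, h i⟩

lemma IsHom.jump_image {k n : ℕ} {A : ArrowDiagram k} {B : ArrowDiagram n}
    {f : Fin (2 * k) → Fin (2 * n)} (hf : A.IsHom B f) (S : Finset (Fin (2 * k)))
    (i : Fin (2 * k)) : B.jump (S.image f) (f i) = f (A.jump S i) := by
  unfold jump
  simp only [hf.strictMono.injective.mem_finset_image]
  split_ifs
  · exact (hf.map_partner i).symm
  · rfl

lemma IsHom.walk_of_notMem {k n : ℕ} {B : ArrowDiagram n} {f : Fin (2 * k) → Fin (2 * n)}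
    (S : Finset (Fin (2 * k))) {x : Fin (2 * n)} (hx : ∀ j, f j ≠ x) :
    B.walk (S.image f) x = finRotate (2 * n) x := by
  rw [walk, jump, if_neg]
  rw [Finset.mem_image]
  rintro ⟨j, -, hj⟩
  exact hx j hj

/-- Erasing arrows that are not in `S` does not change whether `S` is ascending. -/
theorem IsHom.ascends_image_iff {k n : ℕ} {A : ArrowDiagram k} {B : ArrowDiagram n}
    {f : Fin (2 * k) → Fin (2 * n)} (hf : A.IsHom B f) {S : Finset (Fin (2 * k))}
    (hS : A.IsClosed S) : B.Ascends (S.image f) ↔ A.Ascends S := by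
  have hlt : ∀ {i j}, (f i).val < (f j).val ↔ i.val < j.val := fun {i j} => hf.strictMono.lt_iff_lt
  constructor
  · rintro ⟨Q, hQ, hord⟩
    refine ⟨fun i => Q (f i), fun i hi => ?_, fun i hi hh => ?_⟩
    · have hj := finRotate_val_of_ne_zero hi
      set j := A.jump S i with hjdef
      have hij : (f j).val < (f (A.walk S i)).val := hlt.mpr (by rw [walk, hj]; omega)
      -- Between two consecutive retained end points there are only erased ones. The walk in the
      -- larger diagram goes straight through them, and its potential increases at each.
      have key : ∀ t, ∀ y : Fin (2 * n), y.val = (f j).val + 1 + t → y.val ≤ (f (A.walk S i)).val →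
          Q (f i) < Q y := by
        intro t
        induction t with
        | zero =>
          intro y hy _
          have e : B.walk (S.image f) (f i) = y := by
            apply Fin.ext
            have := y.isLt
            rw [walk, hf.jump_image, ← hjdef, finRotate_val, if_neg (by omega), hy]
          exact e ▸ hQ (f i) (by rw [e]; omega)
        | succ t ih =>
          intro y hy hle
          have hlt' : (f j).val + 1 + t < 2 * n := by have := y.isLt; omega
          have h1 := ih ⟨_, hlt'⟩ rfl (by simp only; omega)
          have e : B.walk (S.image f) ⟨_, hlt'⟩ = y := by
            have := y.isLt
            rw [IsHom.walk_of_notMem]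
            · apply Fin.ext
              rw [finRotate_val, if_neg (by simp only; omega), hy]
              rfl
            · intro l hl
              have h2 := congrArg Fin.val hl
              simp only at h2
              have h3 := hlt.mp (show (f j).val < (f l).val by omega)
              have h4 := hlt.mp (show (f l).val < (f (A.walk S i)).val by omega)
              rw [walk, hj] at h4
              omega
          exact h1.trans (e ▸ hQ ⟨_, hlt'⟩ (by rw [e]; omega))
      exact key ((f (A.walk S i)).val - (f j).val - 1) _ (by omega) le_rfl
    · change Q (f i) < Q (f (A.partner i))
      rw [hf.map_partner]
      exact hord _ (Finset.mem_image_of_mem _ hi) (by rw [hf.map_isHead, hh])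
  · rintro ⟨q, hq, hord⟩
    -- Multiplying the old values by `N` leaves room for the numbers of the erased end points
    -- between them.
    set N := 2 * n + 1
    -- That is, `j` is the last retained end point before `x`.
    let IsPred : Fin (2 * k) → Fin (2 * n) → Prop := fun j x =>
      (f j).val < x.val ∧ ∀ j', (f j').val < x.val → j'.val ≤ j.val
    have huniq : ∀ {j j' x}, IsPred j x → IsPred j' x → j = j' := fun h h' =>
      Fin.ext (le_antisymm (h'.2 _ h.1) (h.2 _ h'.1))
    have hex : ∀ x, (∀ j, x.val ≤ (f j).val) ∨ ∃ j, IsPred j x := by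
      intro x
      rcases (Finset.univ.filter fun j => (f j).val < x.val).eq_empty_or_nonempty with h | h
      · left
        intro j
        by_contra hj
        have : j ∈ Finset.univ.filter fun j => (f j).val < x.val := by simpa using hj
        rw [h] at this
        simp at this
      · right
        obtain ⟨j, hj, hmax⟩ := Finset.exists_max_image _ (fun j => j.val) h
        exact ⟨j, by simpa using hj, fun j' hj' => hmax j' (by simpa using hj')⟩
    -- The walk comes to the stretch behind `f j` from the end point `A.jump S j`, so an erased
    -- point there gets the value of that end point plus its own number. Before the first retained
    -- point the number alone is used, and the `+ 1` at retained points keeps their values above it.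
    have hpot : ∀ x, ∃ v : ℕ, (∀ i, f i = x → v = N * (q i + 1)) ∧
        ((∀ i, f i ≠ x) → (∀ j, IsPred j x → v = N * (q (A.jump S j) + 1) + x.val) ∧
          ((∀ j, x.val ≤ (f j).val) → v = x.val)) := by
      intro x
      by_cases h : ∃ i, f i = x
      · obtain ⟨i, rfl⟩ := h
        exact ⟨_, fun i' h' => by rw [hf.strictMono.injective h'], fun h => absurd rfl (h i)⟩
      · rcases hex x with h' | ⟨j, hj⟩
        · exact ⟨x.val, fun i hi => absurd ⟨i, hi⟩ h, fun _ =>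
            ⟨fun j hj => absurd hj.1 (not_lt.mpr (h' j)), fun _ => rfl⟩⟩
        · exact ⟨_, fun i hi => absurd ⟨i, hi⟩ h, fun _ => ⟨fun j' hj' => by rw [huniq hj' hj],
            fun h' => absurd hj.1 (not_lt.mpr (h' j))⟩⟩
    choose Q hQ using hpot
    have hQf : ∀ i, Q (f i) = N * (q i + 1) := fun i => (hQ _).1 i rfl
    have hNlt : ∀ {a b : ℕ}, a < b → N * (a + 1) + 2 * n < N * (b + 1) := by
      intro a b hab
      have := Nat.mul_le_mul_left N (show a + 1 + 1 ≤ b + 1 by omega)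
      rw [Nat.mul_succ] at this
      omega
    have hsucc : ∀ {j y i'}, IsPred j y → f i' = y → A.walk S (A.jump S j) = i' ∧ i'.val ≠ 0 := by
      rintro j _ i' h rfl
      have h1 := hlt.mp h.1
      have h2 : i'.val = j.val + 1 := by
        by_contra hne
        have hb : j.val + 1 < 2 * k := by have := i'.isLt; omega
        have h3 := h.2 ⟨j.val + 1, hb⟩ (hlt.mpr (by simp only; omega))
        simp only at h3
        omega
      refine ⟨?_, by omega⟩
      apply Fin.ext
      have := i'.isLt
      rw [walk, jump_jump hS, finRotate_val, if_neg (by omega), h2]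
    refine ⟨Q, fun x hx => ?_, fun x hx hh => ?_⟩
    · set y := B.walk (S.image f) x with hy
      have hyn := y.isLt
      have hv : y.val = (B.jump (S.image f) x).val + 1 := finRotate_val_of_ne_zero hx
      by_cases h : ∃ i, f i = x
      · obtain ⟨i, rfl⟩ := h
        rw [hf.jump_image] at hv
        have hpred : IsPred (A.jump S i) y := ⟨by omega, fun j' hj' => by
          by_contra hlt'
          have := hlt.mpr (not_le.mp hlt')
          omega⟩
        rw [hQf]
        by_cases h' : ∃ i', f i' = y
        · obtain ⟨i', hi'⟩ := h'
          have h1 := hsucc hpred hi'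
          rw [jump_jump hS] at h1
          have h2 := hq i (by rw [h1.1]; exact h1.2)
          rw [h1.1] at h2
          rw [← hi', hQf]
          have := hNlt h2
          omega
        · rw [((hQ y).2 (fun i hi => h' ⟨i, hi⟩)).1 _ hpred, jump_jump hS]
          omega
      · have hx' : ∀ i, f i ≠ x := fun i hi => h ⟨i, hi⟩
        have hxv : ∀ i, (f i).val ≠ x.val := fun i hi => hx' i (Fin.ext hi)
        have hv' : y.val = x.val + 1 := by
          rw [hy, IsHom.walk_of_notMem S hx']
          apply finRotate_val_of_ne_zero
          rw [← IsHom.walk_of_notMem S hx' (B := B), ← hy]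
          exact hx
        rcases hex x with hlow | ⟨j, hj⟩
        · rw [((hQ x).2 hx').2 hlow]
          by_cases h' : ∃ i', f i' = y
          · obtain ⟨i', hi'⟩ := h'
            rw [← hi', hQf]
            have := Nat.le_mul_of_pos_right N (show 0 < q i' + 1 by omega)
            omega
          · rw [((hQ y).2 (fun i hi => h' ⟨i, hi⟩)).2 (fun j => by
              have := hlow j
              have := hxv j
              omega)]
            omega
        · rw [((hQ x).2 hx').1 j hj]
          have hpred : IsPred j y := ⟨by have := hj.1; omega, fun j' hj' => hj.2 j' (by
            have := hxv j'
            omega)⟩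
          by_cases h' : ∃ i', f i' = y
          · obtain ⟨i', hi'⟩ := h'
            have h1 := hsucc hpred hi'
            have h2 := hq (A.jump S j) (by rw [h1.1]; exact h1.2)
            rw [h1.1] at h2
            rw [← hi', hQf]
            have := hNlt h2
            omega
          · rw [((hQ y).2 (fun i hi => h' ⟨i, hi⟩)).1 _ hpred]
            omega
    · obtain ⟨i, hi, rfl⟩ := Finset.mem_image.mp hx
      rw [← hf.map_partner, hQf, hQf]
      have h1 := hNlt (hord i hi (by rw [← hf.map_isHead, hh]))
      omega

lemma IsHom.isAscending_iff {k n : ℕ} {A : ArrowDiagram k} {B : ArrowDiagram n}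
    {f : Fin (2 * k) → Fin (2 * n)} (hf : A.IsHom B f) :
    A.IsAscending ↔ B.Ascends (Finset.univ.image f) := by
  rw [A.isAscending_iff, hf.ascends_image_iff A.isClosed_univ]

/-- The points of `S` are numbered in increasing order and inherit the arrows. -/
lemma IsClosed.exists_isHom {n : ℕ} {B : ArrowDiagram n} {S : Finset (Fin (2 * n))}
    (hS : B.IsClosed S) {k : ℕ} (hk : S.card = 2 * k) :
    ∃ (A : ArrowDiagram k) (f : Fin (2 * k) → Fin (2 * n)), A.IsHom B f ∧
      Finset.univ.image f = S := by
  set e := S.orderIsoOfFin hk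
  have hp : ∀ i, B.partner (e i).1 ∈ S := fun i => (hS _).mpr (e i).2
  refine ⟨⟨fun i => e.symm ⟨B.partner (e i).1, hp i⟩, fun i => by simp [B.partner_partner],
    fun i => B.isHead (e i).1, fun i => by simp [B.isHead_partner]⟩, fun i => (e i).1,
    ⟨fun i j h => e.strictMono h, fun i => by simp, fun i => rfl⟩, ?_⟩
  ext x
  simp only [Finset.mem_image, Finset.mem_univ, true_and]
  exact ⟨by rintro ⟨i, rfl⟩; exact (e i).2, fun hx => ⟨e.symm ⟨x, hx⟩, by simp⟩⟩

lemma IsHom.ext {k n : ℕ} {A A' : ArrowDiagram k} {B : ArrowDiagram n}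
    {f f' : Fin (2 * k) → Fin (2 * n)} (hf : A.IsHom B f) (hf' : A'.IsHom B f')
    (h : Finset.univ.image f = Finset.univ.image f') : A = A' ∧ f = f' := by
  have e : f = f' := by
    apply hf.strictMono.range_inj hf'.strictMono |>.mp
    simpa [Set.ext_iff, Finset.ext_iff] using h
  subst e
  refine ⟨?_, rfl⟩
  have h1 : A.partner = A'.partner := funext fun i =>
    hf.strictMono.injective ((hf.map_partner i).trans (hf'.map_partner i).symm)
  have h2 : A.isHead = A'.isHead := funext fun i => (hf.map_isHead i).symm.trans (hf'.map_isHead i)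
  cases A
  cases A'
  simp only at h1 h2
  subst h1 h2
  rfl

end ArrowDiagram

/-! ### Reversal of arrows, and the polynomials as sums over sets of arrows -/

namespace ArrowDiagram

variable {n : ℕ}

/-- The diagram with all arrows reversed. -/
def flip (A : ArrowDiagram n) : ArrowDiagram n where
  partner := A.partner
  partner_partner := A.partner_partner
  isHead i := !A.isHead i
  isHead_partner i := by rw [A.isHead_partner]

lemma flip_flip (A : ArrowDiagram n) : A.flip.flip = A := by
  cases A
  simp [flip]

lemma isDescending_iff_flip (A : ArrowDiagram n) : A.IsDescending ↔ A.flip.IsAscending := by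
  have : A.FirstAtTail ↔ A.flip.FirstAtHead := by
    simp only [FirstAtTail, FirstAtHead, flip, Bool.not_eq_false']
    rfl
  rw [IsDescending, IsAscending, this]
  rfl

lemma IsHom.flip {k n : ℕ} {A : ArrowDiagram k} {B : ArrowDiagram n}
    {f : Fin (2 * k) → Fin (2 * n)} (hf : A.IsHom B f) : A.flip.IsHom B.flip f :=
  ⟨hf.strictMono, hf.map_partner, fun i => congrArg (fun b => !b) (hf.map_isHead i)⟩

lemma card_heads {S : Finset (Fin (2 * n))} {A : ArrowDiagram n} (hS : A.IsClosed S) :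
    S.card = 2 * (S.filter fun i => A.isHead i = true).card := by
  have h := Finset.card_filter_add_card_filter_not (s := S) fun i => A.isHead i = true
  suffices (S.filter fun i => ¬A.isHead i = true).card =
      (S.filter fun i => A.isHead i = true).card by omega
  refine Finset.card_bij' (fun i _ => A.partner i) (fun i _ => A.partner i) ?_ ?_ ?_ ?_
  · intro i hi
    rw [Finset.mem_filter] at hi ⊢
    exact ⟨(hS i).mpr hi.1, by rw [A.isHead_partner]; simpa using hi.2⟩
  · intro i hi
    rw [Finset.mem_filter] at hi ⊢
    exact ⟨(hS i).mpr hi.1, by rw [A.isHead_partner]; simpa using hi.2⟩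
  · exact fun i _ => A.partner_partner i
  · exact fun i _ => A.partner_partner i

end ArrowDiagram

namespace GaussDiagram

variable {n : ℕ}

/-- The Gauss diagram with all arrows reversed. -/
def flip (G : GaussDiagram n) : GaussDiagram n where
  toArrowDiagram := G.toArrowDiagram.flip
  sign := G.sign
  sign_partner := G.sign_partner

lemma prod_sign_partner (G : GaussDiagram n) {M : Type*} [CommMonoid M] (φ : ℤˣ → M)
    {S : Finset (Fin (2 * n))} (hS : G.IsClosed S) :
    ∏ i ∈ S with G.isHead i = false, φ (G.sign i) = ∏ i ∈ S with G.isHead i = true, φ (G.sign i) := by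
  refine Finset.prod_nbij' G.partner G.partner ?_ ?_ ?_ ?_ ?_
  · intro i hi
    rw [Finset.mem_filter] at hi ⊢
    exact ⟨(hS i).mpr hi.1, by rw [G.isHead_partner, hi.2]; rfl⟩
  · intro i hi
    rw [Finset.mem_filter] at hi ⊢
    exact ⟨(hS i).mpr hi.1, by rw [G.isHead_partner, hi.2]; rfl⟩
  · exact fun i _ => G.partner_partner i
  · exact fun i _ => G.partner_partner i
  · exact fun i _ => by rw [G.sign_partner]

open Classical in
/-- The sum over the ascending sets of arrows of the monomials with the product of their signs. -/
noncomputable def ascSum (G : GaussDiagram n) : ℤ[X] :=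
  ∑ S : Finset (Fin (2 * n)) with G.IsClosed S ∧ G.Ascends S,
    ∏ i ∈ S with G.isHead i = true, C ((G.sign i : ℤˣ) : ℤ) * X

open Classical in
-- A diagram together with its homomorphism into `G` is the same as the closed set of end points in
-- the image, since an increasing map is determined by its range.
lemma ascCount_eq (G : GaussDiagram n) (k : ℕ) :
    G.ascCount k = ∑ S : Finset (Fin (2 * n)) with
      (G.IsClosed S ∧ G.Ascends S) ∧ (S.filter fun i => G.isHead i = true).card = k,
        ∏ i ∈ S with G.isHead i = true, ((G.sign i : ℤˣ) : ℤ) := by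
  unfold ascCount pairing
  rw [Finset.sum_sigma']
  refine Finset.sum_bij (fun x _ => Finset.univ.image x.2) ?_ ?_ ?_ ?_
  · rintro ⟨A, f⟩ h
    simp only [Finset.mem_sigma, Finset.mem_filter, Finset.mem_univ, true_and] at h ⊢
    have hcl := h.2.isClosed_image A.isClosed_univ
    refine ⟨⟨hcl, h.2.isAscending_iff.mp h.1⟩, ?_⟩
    have h1 := ArrowDiagram.card_heads hcl
    rw [Finset.card_image_of_injective _ h.2.strictMono.injective, Finset.card_univ,
      Fintype.card_fin] at h1
    omega
  · rintro ⟨A, f⟩ h ⟨A', f'⟩ h' e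
    simp only [Finset.mem_sigma, Finset.mem_filter, Finset.mem_univ, true_and] at h h'
    obtain ⟨rfl, rfl⟩ := h.2.ext h'.2 e
    rfl
  · rintro S h
    simp only [Finset.mem_filter, Finset.mem_univ, true_and] at h
    have h1 := ArrowDiagram.card_heads h.1.1
    rw [h.2] at h1
    obtain ⟨A, f, hf, rfl⟩ := h.1.1.exists_isHom h1
    refine ⟨⟨A, f⟩, ?_, rfl⟩
    simp only [Finset.mem_sigma, Finset.mem_filter, Finset.mem_univ, true_and]
    exact ⟨hf.isAscending_iff.mpr h.1.2, hf⟩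
  · rintro ⟨A, f⟩ h
    simp only [Finset.mem_sigma, Finset.mem_filter, Finset.mem_univ, true_and] at h
    simp only [Finset.prod_filter, Finset.prod_image h.2.strictMono.injective.injOn, h.2.map_isHead]

theorem nablaA_eq_ascSum (G : GaussDiagram n) : G.nablaA = G.ascSum := by
  classical
  unfold nablaA ascSum
  simp only [ascCount_eq, map_sum, Finset.sum_mul]
  rw [← Finset.sum_fiberwise_of_maps_to
    (g := fun S : Finset (Fin (2 * n)) => (S.filter fun i => G.isHead i = true).card)
    (t := Finset.range (n + 1))]
  · refine Finset.sum_congr rfl fun k _ => ?_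
    rw [Finset.filter_filter]
    refine Finset.sum_congr rfl fun S hS => ?_
    rw [Finset.prod_mul_distrib, Finset.prod_const, (Finset.mem_filter.mp hS).2.2, map_prod]
  · intro S hS
    have h1 := ArrowDiagram.card_heads (Finset.mem_filter.mp hS).2.1
    have h2 := Finset.card_le_univ S
    rw [Fintype.card_fin] at h2
    rw [Finset.mem_range]
    omega

lemma pairing_flip {k : ℕ} (A : ArrowDiagram k) (G : GaussDiagram n) :
    pairing A.flip G.flip = pairing A G := by
  classical
  unfold pairing
  have h : ∀ f, A.flip.IsHom G.flip.toArrowDiagram f ↔ A.IsHom G.toArrowDiagram f := fun f =>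
    ⟨fun hf => by simpa only [flip, ArrowDiagram.flip_flip] using hf.flip, fun hf => hf.flip⟩
  simp only [h]
  refine Finset.sum_congr rfl fun f hf => ?_
  have hf' := (Finset.mem_filter.mp hf).2
  refine Finset.prod_nbij' A.partner A.partner ?_ ?_ ?_ ?_ ?_
  · intro i hi
    simpa [A.isHead_partner, ArrowDiagram.flip] using hi
  · intro i hi
    simpa [A.isHead_partner, ArrowDiagram.flip] using hi
  · exact fun i _ => A.partner_partner i
  · exact fun i _ => A.partner_partner i
  · intro i _
    rw [hf'.map_partner, G.sign_partner]
    rfl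

lemma descCount_eq (G : GaussDiagram n) (k : ℕ) : G.descCount k = G.flip.ascCount k := by
  classical
  unfold descCount ascCount
  refine Finset.sum_nbij' ArrowDiagram.flip ArrowDiagram.flip ?_ ?_ ?_ ?_ ?_
  · intro A hA
    simpa [ArrowDiagram.isDescending_iff_flip] using hA
  · intro A hA
    simpa [ArrowDiagram.isDescending_iff_flip, A.flip_flip] using hA
  · exact fun A _ => A.flip_flip
  · exact fun A _ => A.flip_flip
  · exact fun A _ => (pairing_flip A G).symm

/-- Reversing the arrows reduces every statement about descending diagrams to ascending ones. -/
theorem nablaD_eq_flip (G : GaussDiagram n) : G.nablaD = G.flip.nablaA := by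
  simp only [nablaD, nablaA, descCount_eq]

end GaussDiagram

namespace GaussDiagram

/-- The product of the signs of the arrows in `S`, times a power of the variable. -/
noncomputable def arrowWeight {n : ℕ} (G : GaussDiagram n) (S : Finset (Fin (2 * n))) : ℤ[X] :=
  ∏ i ∈ S with G.isHead i = true, C ((G.sign i : ℤˣ) : ℤ) * X

variable {m n : ℕ} {G : GaussDiagram m} {G' : GaussDiagram n} {f : Fin (2 * m) → Fin (2 * n)}

lemma IsEmbedding.arrowWeight_image (hf : G.IsEmbedding G' f) (S : Finset (Fin (2 * m))) :
    G'.arrowWeight (S.image f) = G.arrowWeight S := by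
  simp only [arrowWeight, Finset.prod_filter,
    Finset.prod_image hf.strictMono.injective.injOn, hf.map_isHead, hf.map_sign]

open Classical in
/-- The contribution of the arrows of a subdiagram. -/
lemma IsEmbedding.ascSum_eq (hf : G.IsEmbedding G' f) :
    G.ascSum = ∑ S : Finset (Fin (2 * n)) with
      (G'.IsClosed S ∧ G'.Ascends S) ∧ ∀ x ∈ S, ∃ i, f i = x, G'.arrowWeight S := by
  refine Finset.sum_bij (fun S _ => S.image f) ?_ ?_ ?_ ?_
  · intro S hS
    simp only [Finset.mem_filter, Finset.mem_univ, true_and] at hS ⊢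
    exact ⟨⟨hf.isClosed_image hS.1, (hf.ascends_image_iff hS.1).mpr hS.2⟩, fun x hx => by
      obtain ⟨i, -, hi⟩ := Finset.mem_image.mp hx; exact ⟨i, hi⟩⟩
  · intro S _ T _ h
    exact Finset.image_injective hf.strictMono.injective h
  · intro T hT
    simp only [Finset.mem_filter, Finset.mem_univ, true_and] at hT
    have e : (Finset.univ.filter fun i => f i ∈ T).image f = T := by
      ext x
      simp only [Finset.mem_image, Finset.mem_filter, Finset.mem_univ, true_and]
      constructor
      · rintro ⟨i, hi, rfl⟩
        exact hi
      · intro hx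
        obtain ⟨i, rfl⟩ := hT.2 x hx
        exact ⟨i, hx, rfl⟩
    have hcl : G.IsClosed (Finset.univ.filter fun i => f i ∈ T) := by
      intro i
      simp only [Finset.mem_filter, Finset.mem_univ, true_and, hf.map_partner]
      exact hT.1.1 _
    refine ⟨_, ?_, e⟩
    simp only [Finset.mem_filter, Finset.mem_univ, true_and] at hcl ⊢
    exact ⟨hcl, (hf.ascends_image_iff hcl).mp (by rw [e]; exact hT.1.2)⟩
  · intro S _
    exact (hf.arrowWeight_image S).symm

end GaussDiagram

/-! ### The ascending sum under the first two moves -/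

namespace ArrowDiagram

variable {n : ℕ} {A : ArrowDiagram n} {S : Finset (Fin (2 * n))}

lemma walk_of_mem {x y : Fin (2 * n)} (hx : x ∈ S) (hy : y.val = (A.partner x).val + 1) :
    A.walk S x = y := by
  apply Fin.ext
  have := y.isLt
  rw [walk, jump, if_pos hx, finRotate_val, if_neg (by omega), hy]

/-- An arrow with neighbouring end points yields a boundary component of its own. -/
lemma not_ascends_of_isolated {p p' : Fin (2 * n)} (hpp : p'.val = p.val + 1)
    (hp : A.partner p = p') (hp' : p' ∈ S) : ¬ A.Ascends S := by
  rintro ⟨q, hq, -⟩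
  have h : A.walk S p' = p' := walk_of_mem hp' (by rw [← hp, A.partner_partner, hp, hpp])
  have := hq p'
  rw [h] at this
  exact absurd (this (by omega)) (lt_irrefl _)

/-- Two neighbouring arrows of the same direction are not both in an ascending diagram. -/
lemma not_ascends_of_parallel {p p' q q' : Fin (2 * n)} (hpp : p'.val = p.val + 1)
    (hqq : q'.val = q.val + 1) (hp : A.isHead p = false) (hp' : A.isHead p' = false)
    (h : (A.partner p = q ∧ A.partner p' = q') ∨ (A.partner p = q' ∧ A.partner p' = q))
    (hS : A.IsClosed S) (hpS : p ∈ S) (hpS' : p' ∈ S) : ¬ A.Ascends S := by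
  intro hA
  -- The tight potential is needed: it grows by exactly `1` in each step away from the base point.
  obtain ⟨Q, hQ, hord⟩ := hA.exists_tight hS
  have hord' : ∀ x ∈ S, A.isHead x = false → Q (A.partner x) < Q x := by
    intro x hx hh
    have := hord (A.partner x) ((hS x).mpr hx) (by rw [A.isHead_partner, hh]; rfl)
    rwa [A.partner_partner] at this
  have h1 := hord' p hpS hp
  have h2 := hord' p' hpS' hp'
  rcases h with ⟨e, e'⟩ | ⟨e, e'⟩
  -- The walk leads from `p` to `q'` and from `q` to `p'`. Thus `q` before `p` forces `p'` before
  -- `q'`, against the order of the second arrow.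
  · have hq : A.partner q = p := by rw [← e, A.partner_partner]
    have h3 : A.walk S p = q' := walk_of_mem hpS (by rw [e, hqq])
    have h4 : A.walk S q = p' := walk_of_mem (by rw [← e, hS]; exact hpS) (by rw [hq, hpp])
    have h5 := hQ p (by rw [h3]; omega)
    have h6 := hQ q (by rw [h4]; omega)
    rw [h3] at h5
    rw [h4] at h6
    rw [e] at h1
    rw [e'] at h2
    omega
  -- The points `p'` and `q'` follow each other in both directions and form a closed component.
  · have hq' : A.partner q' = p := by rw [← e, A.partner_partner]
    have h3 : A.walk S p' = q' := walk_of_mem hpS' (by rw [e', hqq])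
    have h4 : A.walk S q' = p' := walk_of_mem (by rw [← e, hS]; exact hpS) (by rw [hq', hpp])
    have h5 := hQ p' (by rw [h3]; omega)
    have h6 := hQ q' (by rw [h4]; omega)
    rw [h3] at h5
    rw [h4] at h6
    omega

end ArrowDiagram

namespace GaussDiagram

lemma exists_eq_of_card {m n r : ℕ} {f : Fin (2 * m) → Fin (2 * n)} (hf : Function.Injective f)
    {T : Finset (Fin (2 * n))} (hT : ∀ i, f i ∉ T) (hcard : T.card = r) (hr : 2 * n = 2 * m + r)
    (x : Fin (2 * n)) (hx : x ∉ T) : ∃ i, f i = x := by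
  by_contra! h
  have h1 : (Finset.univ.image f).card = 2 * m := by
    rw [Finset.card_image_of_injective _ hf, Finset.card_univ, Fintype.card_fin]
  have h2 : Disjoint (Finset.univ.image f) (insert x T) := by
    rw [Finset.disjoint_left]
    intro y hy hy'
    obtain ⟨i, -, rfl⟩ := Finset.mem_image.mp hy
    rcases Finset.mem_insert.mp hy' with h' | h'
    · exact h i h'
    · exact hT i h'
  have h3 := Finset.card_le_univ ((Finset.univ.image f) ∪ insert x T)
  rw [Finset.card_union_of_disjoint h2, h1, Finset.card_insert_of_notMem hx, Fintype.card_fin] at h3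
  omega

variable {n : ℕ}

/-- No ascending set contains the isolated arrow, so the states are those of the smaller diagram. -/
theorem ascSum_omega1 {G : GaussDiagram n} {G' : GaussDiagram (n + 1)} (h : Omega1 G G') :
    G'.ascSum = G.ascSum := by
  classical
  obtain ⟨f, hf, p, p', hpp, hp, hmiss⟩ := h
  rw [hf.ascSum_eq]
  refine Finset.sum_congr ?_ fun _ _ => rfl
  refine Finset.filter_congr fun S _ => ⟨fun h => ⟨h, fun x hx => ?_⟩, fun h => h.1⟩
  have hp'S : p' ∉ S := fun h' => ArrowDiagram.not_ascends_of_isolated hpp hp h' h.2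
  have hpS : p ∉ S := fun h' => hp'S (hp ▸ (h.1 p).mpr h')
  have hne : p ≠ p' := fun e => by rw [e] at hpp; omega
  refine exists_eq_of_card hf.strictMono.injective (T := {p, p'}) (r := 2) (fun i hi => ?_)
    (Finset.card_pair hne) (by omega) x (fun hx' => ?_)
  · simp only [Finset.mem_insert, Finset.mem_singleton] at hi
    exact hi.elim (hmiss i).1 (hmiss i).2
  · simp only [Finset.mem_insert, Finset.mem_singleton] at hx'
    rcases hx' with rfl | rfl
    · exact hpS hx
    · exact hp'S hx

end GaussDiagram

/-- Only the pair of exchanged neighbours changes its order, and the map does not meet both of them.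
-/
lemma strictMono_swap_comp {k m : ℕ} {f : Fin k → Fin m} (hf : StrictMono f) {u v : Fin m}
    (huv : v.val = u.val + 1 ∨ u.val = v.val + 1) (h : ¬((∃ i, f i = u) ∧ ∃ i, f i = v)) :
    StrictMono fun i => Equiv.swap u v (f i) := by
  intro i j hij
  have hij' := hf hij
  have h1 : ¬ (f i = u ∧ f j = v) := fun h' => h ⟨⟨i, h'.1⟩, ⟨j, h'.2⟩⟩
  have h2 : ¬ (f i = v ∧ f j = u) := fun h' => h ⟨⟨j, h'.2⟩, ⟨i, h'.1⟩⟩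
  simp only [Equiv.swap_apply_def, Fin.lt_def, Fin.ext_iff] at *
  split_ifs <;> omega

namespace ArrowDiagram

variable {n : ℕ} {A : ArrowDiagram n} {S : Finset (Fin (2 * n))}

lemma partner_swap (A : ArrowDiagram n) (x y z : Fin (2 * n)) :
    A.partner (Equiv.swap x y z) = Equiv.swap (A.partner x) (A.partner y) (A.partner z) :=
  (A.partner_involutive.injective.swap_apply x y z).symm

lemma isHead_swap {x y : Fin (2 * n)} (h : A.isHead x = A.isHead y) (z : Fin (2 * n)) :
    A.isHead (Equiv.swap x y z) = A.isHead z := by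
  rw [Equiv.swap_apply_def]
  split_ifs with h1 h2
  · rw [h1, h]
  · rw [h2, h]
  · rfl

/-- The permutation that exchanges two arrows. -/
def arrowSwap (A : ArrowDiagram n) (x y : Fin (2 * n)) : Equiv.Perm (Fin (2 * n)) :=
  Equiv.swap x y * Equiv.swap (A.partner x) (A.partner y)

lemma arrowSwap_apply {x y : Fin (2 * n)} (hx : A.isHead x = false) (hy : A.isHead y = false)
    (z : Fin (2 * n)) : A.arrowSwap x y z =
      if A.isHead z = false then Equiv.swap x y z
      else Equiv.swap (A.partner x) (A.partner y) z := by
  have hpx : A.isHead (A.partner x) = true := by rw [A.isHead_partner, hx]; rfl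
  have hpy : A.isHead (A.partner y) = true := by rw [A.isHead_partner, hy]; rfl
  rw [arrowSwap, Equiv.Perm.mul_apply]
  split_ifs with h
  · rw [Equiv.swap_apply_of_ne_of_ne (x := z)]
    · rintro rfl; simp [h] at hpx
    · rintro rfl; simp [h] at hpy
  · apply Equiv.swap_apply_of_ne_of_ne
    · intro e
      have := congrArg A.isHead e
      rw [isHead_swap (hpx.trans hpy.symm), hx] at this
      exact h this
    · intro e
      have := congrArg A.isHead e
      rw [isHead_swap (hpx.trans hpy.symm), hy] at this
      exact h this

lemma isHead_arrowSwap {x y : Fin (2 * n)} (hx : A.isHead x = false) (hy : A.isHead y = false)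
    (z : Fin (2 * n)) : A.isHead (A.arrowSwap x y z) = A.isHead z := by
  rw [arrowSwap, Equiv.Perm.mul_apply, isHead_swap (hx.trans hy.symm),
    isHead_swap (by rw [A.isHead_partner, A.isHead_partner, hx, hy])]

lemma partner_arrowSwap {x y : Fin (2 * n)} (hx : A.isHead x = false) (hy : A.isHead y = false)
    (z : Fin (2 * n)) : A.partner (A.arrowSwap x y z) = A.arrowSwap x y (A.partner z) := by
  rw [arrowSwap_apply hx hy, arrowSwap_apply hx hy, A.isHead_partner]
  cases h : A.isHead z <;> simp [partner_swap, A.partner_partner]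

lemma arrowSwap_arrowSwap {x y : Fin (2 * n)} (hx : A.isHead x = false)
    (hy : A.isHead y = false) (z : Fin (2 * n)) : A.arrowSwap x y (A.arrowSwap x y z) = z := by
  rw [arrowSwap_apply hx hy, isHead_arrowSwap hx hy, arrowSwap_apply hx hy]
  split_ifs <;> simp

lemma mem_image_arrowSwap {x y : Fin (2 * n)} (hx : A.isHead x = false)
    (hy : A.isHead y = false) (z : Fin (2 * n)) :
    z ∈ S.image (A.arrowSwap x y) ↔ A.arrowSwap x y z ∈ S := by
  rw [Finset.mem_image]
  constructor
  · rintro ⟨w, hw, rfl⟩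
    rwa [arrowSwap_arrowSwap hx hy]
  · exact fun h => ⟨_, h, arrowSwap_arrowSwap hx hy z⟩

lemma image_image_arrowSwap {x y : Fin (2 * n)} (hx : A.isHead x = false)
    (hy : A.isHead y = false) : (S.image (A.arrowSwap x y)).image (A.arrowSwap x y) = S := by
  ext z
  rw [mem_image_arrowSwap hx hy, mem_image_arrowSwap hx hy, arrowSwap_arrowSwap hx hy]

lemma IsClosed.image_arrowSwap (hS : A.IsClosed S) {x y : Fin (2 * n)} (hx : A.isHead x = false)
    (hy : A.isHead y = false) : A.IsClosed (S.image (A.arrowSwap x y)) := by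
  intro z
  rw [mem_image_arrowSwap hx hy, mem_image_arrowSwap hx hy, ← partner_arrowSwap hx hy]
  exact hS _

lemma IsClosed.exists_isHom' (hS : A.IsClosed S) : ∃ (k : ℕ) (B : ArrowDiagram k)
    (f : Fin (2 * k) → Fin (2 * n)), B.IsHom A f ∧ Finset.univ.image f = S :=
  ⟨_, hS.exists_isHom (card_heads hS)⟩

/-- Neighbouring arrows of the same direction, of which only one is present, can be exchanged. -/
lemma Ascends.image_arrowSwap (hA : A.Ascends S) (hS : A.IsClosed S) {x y : Fin (2 * n)}
    (hx : A.isHead x = false) (hy : A.isHead y = false)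
    (hxy : y.val = x.val + 1 ∨ x.val = y.val + 1)
    (hpxy : (A.partner y).val = (A.partner x).val + 1 ∨ (A.partner x).val = (A.partner y).val + 1)
    (hno : ¬ (x ∈ S ∧ y ∈ S)) : A.Ascends (S.image (A.arrowSwap x y)) := by
  obtain ⟨k, B, f, hf, rfl⟩ := hS.exists_isHom'
  have hg : B.IsHom A fun i => A.arrowSwap x y (f i) := by
    refine ⟨?_, fun i => ?_, fun i => ?_⟩
    · have h1 := strictMono_swap_comp hf.strictMono hpxy (by
        rintro ⟨⟨i, hi⟩, ⟨j, hj⟩⟩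
        refine hno ⟨?_, ?_⟩
        · rw [← hS x, ← hi]
          exact Finset.mem_image_of_mem _ (Finset.mem_univ _)
        · rw [← hS y, ← hj]
          exact Finset.mem_image_of_mem _ (Finset.mem_univ _))
      refine strictMono_swap_comp h1 hxy ?_
      have key : ∀ z i, A.isHead z = false →
          Equiv.swap (A.partner x) (A.partner y) (f i) = z → f i = z := by
        intro z i hz hi
        rw [Equiv.swap_apply_def] at hi
        split_ifs at hi with h2 h3
        · rw [← hi, A.isHead_partner, hy] at hz
          exact absurd hz (by simp)
        · rw [← hi, A.isHead_partner, hx] at hz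
          exact absurd hz (by simp)
        · exact hi
      rintro ⟨⟨i, hi⟩, ⟨j, hj⟩⟩
      refine hno ⟨?_, ?_⟩
      · rw [← key x i hx hi]
        exact Finset.mem_image_of_mem _ (Finset.mem_univ _)
      · rw [← key y j hy hj]
        exact Finset.mem_image_of_mem _ (Finset.mem_univ _)
    · rw [hf.map_partner, partner_arrowSwap hx hy]
    · rw [isHead_arrowSwap hx hy, hf.map_isHead]
  have := hf.isAscending_iff.mpr hA
  rw [hg.isAscending_iff] at this
  rw [Finset.image_image]
  exact this

end ArrowDiagram

namespace GaussDiagram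

variable {n : ℕ}

lemma arrowWeight_eq_tails (G : GaussDiagram n) {S : Finset (Fin (2 * n))} (hS : G.IsClosed S) :
    G.arrowWeight S = ∏ i ∈ S with G.isHead i = false, C ((G.sign i : ℤˣ) : ℤ) * X :=
  (G.prod_sign_partner (fun s => C (s : ℤ) * X) hS).symm

/-- Exactly one arrow of the set is replaced, by one of the opposite sign. -/
lemma arrowWeight_image_arrowSwap (G : GaussDiagram n) {S : Finset (Fin (2 * n))}
    (hS : G.IsClosed S) {x y : Fin (2 * n)}
    (hx : G.isHead x = false) (hy : G.isHead y = false) (hs : G.sign y = -G.sign x)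
    (h : (x ∈ S ∧ y ∉ S) ∨ (x ∉ S ∧ y ∈ S)) :
    G.arrowWeight (S.image (G.arrowSwap x y)) = -G.arrowWeight S := by
  obtain ⟨u, hu, hh, hsu, hne⟩ : ∃ u ∈ S, G.isHead u = false ∧
      G.sign (G.arrowSwap x y u) = -G.sign u ∧
      ∀ z ∈ S, G.isHead z = false → z ≠ u → G.arrowSwap x y z = z := by
    have e1 : ∀ z, G.isHead z = false → G.arrowSwap x y z = Equiv.swap x y z := fun z hz => by
      rw [ArrowDiagram.arrowSwap_apply hx hy, if_pos hz]
    rcases h with ⟨h1, h2⟩ | ⟨h1, h2⟩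
    · refine ⟨x, h1, hx, by rw [e1 x hx, Equiv.swap_apply_left, hs], fun z hz hzh hne => ?_⟩
      rw [e1 z hzh, Equiv.swap_apply_of_ne_of_ne hne (by rintro rfl; exact h2 hz)]
    · refine ⟨y, h2, hy, by rw [e1 y hy, Equiv.swap_apply_right, hs, neg_neg],
        fun z hz hzh hne => ?_⟩
      rw [e1 z hzh, Equiv.swap_apply_of_ne_of_ne (by rintro rfl; exact h1 hz) hne]
  rw [arrowWeight_eq_tails G (hS.image_arrowSwap hx hy), arrowWeight_eq_tails G hS]
  simp only [Finset.prod_filter, Finset.prod_image (G.arrowSwap x y).injective.injOn,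
    ArrowDiagram.isHead_arrowSwap hx hy]
  rw [← Finset.mul_prod_erase S _ hu, ← Finset.mul_prod_erase S _ hu, ← neg_mul]
  congr 1
  · rw [if_pos hh, if_pos hh, hsu]
    simp
  · refine Finset.prod_congr rfl fun z hz => ?_
    by_cases hzh : G.isHead z = false
    · rw [hne z (Finset.mem_of_mem_erase hz) hzh (Finset.ne_of_mem_erase hz)]
    · rw [if_neg hzh, if_neg hzh]

/-- A state that is not one of the smaller diagram contains exactly one of the two new arrows.
Exchanging it for the other one is an involution that reverses the weight. -/
theorem ascSum_omega2 {G : GaussDiagram n} {G' : GaussDiagram (n + 2)} (h : Omega2 G G') :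
    G'.ascSum = G.ascSum := by
  classical
  obtain ⟨f, hf, p, p', q, q', hpp, hqq, hp, hp', hpart, hsign, hmiss⟩ := h
  have hadj : (G'.partner p').val = (G'.partner p).val + 1 ∨
      (G'.partner p).val = (G'.partner p').val + 1 := by
    rcases hpart with ⟨e, e'⟩ | ⟨e, e'⟩ <;> rw [e, e'] <;> omega
  have n1 : p ≠ p' := fun e => by rw [e] at hpp; omega
  have hne : ∀ {x y}, G'.isHead x = false → G'.isHead y = false → x ≠ G'.partner y := by
    rintro x y h1 h2 rfl
    simp [G'.isHead_partner, h2] at h1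
  have hmiss' : ∀ i, f i ≠ p ∧ f i ≠ p' ∧ f i ≠ G'.partner p ∧ f i ≠ G'.partner p' := by
    intro i
    obtain ⟨h1, h2, h3, h4⟩ := hmiss i
    rcases hpart with ⟨e, e'⟩ | ⟨e, e'⟩ <;> rw [e, e'] <;> exact ⟨h1, h2, by assumption, by assumption⟩
  have hcover : ∀ x, x ∉ ({p, p', G'.partner p, G'.partner p'} : Finset _) → ∃ i, f i = x := by
    refine exists_eq_of_card hf.strictMono.injective (r := 4) (fun i hi => ?_) ?_ (by omega)
    · simp only [Finset.mem_insert, Finset.mem_singleton] at hi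
      have := hmiss' i
      tauto
    · rw [Finset.card_insert_of_notMem, Finset.card_insert_of_notMem, Finset.card_pair]
      · exact fun e => n1 (G'.partner_involutive.injective e)
      · simp [hne hp' hp, hne hp' hp']
      · simp [n1, hne hp hp, hne hp hp']
  rw [hf.ascSum_eq]
  change ∑ S : Finset (Fin (2 * (n + 2))) with G'.IsClosed S ∧ G'.Ascends S, G'.arrowWeight S = _
  rw [← Finset.sum_filter_add_sum_filter_not _ (fun S => ∀ x ∈ S, ∃ i, f i = x),
    Finset.filter_filter, add_eq_left, Finset.filter_filter]
  have one : ∀ S, G'.IsClosed S → G'.Ascends S → (¬(∀ x ∈ S, ∃ i, f i = x) ↔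
      ((p ∈ S ∧ p' ∉ S) ∨ (p ∉ S ∧ p' ∈ S))) := by
    intro S h1 h2
    constructor
    · intro h3
      have h4 : ¬(p ∈ S ∧ p' ∈ S) := fun h =>
        ArrowDiagram.not_ascends_of_parallel hpp hqq hp hp' hpart h1 h.1 h.2 h2
      have h5 : ¬(p ∉ S ∧ p' ∉ S) := by
        refine fun h => h3 fun x hx => hcover x fun hx' => ?_
        simp only [Finset.mem_insert, Finset.mem_singleton] at hx'
        rcases hx' with rfl | rfl | rfl | rfl
        · exact h.1 hx
        · exact h.2 hx
        · exact h.1 ((h1 _).mp hx)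
        · exact h.2 ((h1 _).mp hx)
      tauto
    · rintro (h | h) h3
      · obtain ⟨i, hi⟩ := h3 p h.1
        exact (hmiss i).1 hi
      · obtain ⟨i, hi⟩ := h3 p' h.2
        exact (hmiss i).2.1 hi
  set τ := G'.arrowSwap p p' with hτ
  have τp : τ p = p' := by rw [hτ, ArrowDiagram.arrowSwap_apply hp hp', if_pos hp,
    Equiv.swap_apply_left]
  have τp' : τ p' = p := by rw [hτ, ArrowDiagram.arrowSwap_apply hp hp', if_pos hp',
    Equiv.swap_apply_right]
  have hmem : ∀ S : Finset _, ∀ z, z ∈ S.image τ ↔ τ z ∈ S := fun S z =>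
    ArrowDiagram.mem_image_arrowSwap hp hp' z
  refine Finset.sum_involution (fun S _ => S.image τ) ?_ ?_ ?_ ?_
  · intro S hS
    obtain ⟨⟨h1, h2⟩, h3⟩ := (Finset.mem_filter.mp hS).2
    rw [arrowWeight_image_arrowSwap G' h1 hp hp' hsign ((one S h1 h2).mp h3), add_neg_cancel]
  · intro S hS _ e
    obtain ⟨⟨h1, h2⟩, h3⟩ := (Finset.mem_filter.mp hS).2
    have h4 := (one S h1 h2).mp h3
    have h5 := hmem S p
    rw [e, τp] at h5
    tauto
  · intro S hS
    obtain ⟨⟨h1, h2⟩, h3⟩ := (Finset.mem_filter.mp hS).2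
    have h4 := (one S h1 h2).mp h3
    have h1' := h1.image_arrowSwap hp hp'
    have h2' := h2.image_arrowSwap h1 hp hp' (Or.inl hpp) hadj (by tauto)
    refine Finset.mem_filter.mpr ⟨Finset.mem_univ _, ⟨h1', h2'⟩, (one _ h1' h2').mpr ?_⟩
    rw [hmem, hmem, τp, τp']
    tauto
  · intro S _
    exact ArrowDiagram.image_image_arrowSwap hp hp'

end GaussDiagram

/-! ### The combinatorics of three pairwise crossing strands -/

namespace Strands

/-- The six end points of the three arrows of a triangle: the strand, and whether it is the second
of the two end points on this strand. -/
abbrev Place : Type := Fin 3 × Bool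

/-- The arrows are denoted by `0` (top to middle), `1` (top to bottom), `2` (middle to bottom). -/
def arrowAt (o : Fin 3 → Bool) (y : Place) : Fin 3 :=
  if y.2 = o y.1 then ![1, 2, 2] y.1 else ![0, 0, 1] y.1

/-- The value `o i` is true if, on the strand `i`, the arrow with the smaller number comes first. -/
def partner (o : Fin 3 → Bool) (y : Place) : Place :=
  ![if y.1 = 0 then (1, !o 1) else (0, !o 0), if y.1 = 0 then (2, !o 2) else (0, o 0),
    if y.1 = 1 then (2, o 2) else (1, o 1)] (arrowAt o y)

def isHead (o : Fin 3 → Bool) (y : Place) : Bool :=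
  ![false, decide (arrowAt o y = 0), true] y.1

/-- The function `T` tells which of the three arrows are present. -/
def jump (o T : Fin 3 → Bool) (y : Place) : Place := if T (arrowAt o y) then partner o y else y

/-- The strand along which the triangle was entered, and the number of steps since then. -/
def origin (f : Place → Place) : ℕ → Place → Fin 3 × ℕ
  | 0, y => (y.1, 0)
  | k + 1, y => if y.2 then let z := origin f k (f (y.1, false)); (z.1, z.2 + 1) else (y.1, 0)

/-- The strand along which the triangle was entered, if it is left along the strand `i`. -/
def entry (f : Place → Place) (i : Fin 3) : Fin 3 := (origin f 4 (f (i, true))).1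

/-- The conditions express that the recursion in `origin` has ended within its four rounds, that is,
every passage through the triangle comes from outside. The bound keeps the number of steps below the
scale factor of `innerPotential`. -/
structure IsTraversed (f : Place → Place) : Prop where
  step_fst : ∀ i, (origin f 4 (i, true)).1 = (origin f 4 (f (i, false))).1
  step_snd : ∀ i, (origin f 4 (i, true)).2 = (origin f 4 (f (i, false))).2 + 1
  bound : ∀ y, (origin f 4 y).2 < 9

instance (f : Place → Place) : Decidable (IsTraversed f) :=
  decidable_of_iff ((∀ i, (origin f 4 (i, true)).1 = (origin f 4 (f (i, false))).1) ∧
    (∀ i, (origin f 4 (i, true)).2 = (origin f 4 (f (i, false))).2 + 1) ∧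
    ∀ y, (origin f 4 y).2 < 9) ⟨fun h => ⟨h.1, h.2.1, h.2.2⟩, fun h => ⟨h.1, h.2, h.3⟩⟩

/-- The heads are met before the tails, if the strands are entered in the order `lt`. -/
def Ordered (o T : Fin 3 → Bool) (k : Fin 3 → ℕ) : Prop :=
  ∀ y : Place, T (arrowAt o y) = true → isHead o y = true →
    let u := origin (jump o T) 4 y
    let v := origin (jump o T) 4 (partner o y)
    k u.1 < k v.1 ∨ u.1 = v.1 ∧ u.2 < v.2

instance (o T : Fin 3 → Bool) (k : Fin 3 → ℕ) : Decidable (Ordered o T k) := by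
  unfold Ordered; infer_instance

/-- The alternative is that the walk is trapped on a closed curve inside the triangle, along which
no potential can increase. -/
lemma not_isTraversed : ∀ o T : Fin 3 → Bool, IsTraversed (jump o T) ∨
    ∃ i j k : Fin 3, jump o T (i, true) = (j, false) ∧ jump o T (j, true) = (k, false) ∧
      jump o T (k, true) = (i, false) := by decide +kernel

lemma partner_partner : ∀ o y, partner o (partner o y) = y := by decide +kernel

lemma arrowAt_partner : ∀ o y, arrowAt o (partner o y) = arrowAt o y := by decide +kernel


lemma jump_jump : ∀ o T y, jump o T (jump o T y) = y := by
  intro o T y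
  unfold jump
  by_cases h : T (arrowAt o y)
  · rw [if_pos h, arrowAt_partner, if_pos h, partner_partner]
  · rw [if_neg h, if_neg h]

/-- The signs of the three arrows, up to a change of the orientations of all three strands. -/
def triangleSign (o : Fin 3 → Bool) (i : Fin 3) : ℤ :=
  if ![(o 0 ^^ o 1) ^^ !o 2, !o 0, !o 1] i then -1 else 1

def orders : List (Fin 3 → Fin 3) :=
  [![0, 1, 2], ![1, 0, 2], ![2, 1, 0], ![0, 2, 1], ![1, 2, 0], ![2, 0, 1]]

lemma entry_mem_orders : ∀ o T : Fin 3 → Bool, IsTraversed (jump o T) →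
    entry (jump o T) ∈ orders := by decide +kernel

/-- The pattern `e` tells through which strand one entered if one leaves along a given strand, and
`k` is the order in which the strands are entered. -/
def signedCount (o : Fin 3 → Bool) (s : Fin 3 → ℤ) (e k : Fin 3 → Fin 3) (d : ℕ) : ℤ :=
  ∑ T : Fin 3 → Bool, if (∑ i, if T i then 1 else 0) = d ∧ IsTraversed (jump o T) ∧
    entry (jump o T) = e ∧ Ordered o T (fun i => (k i).val) then ∏ i, if T i then s i else 1 else 0

/-- The six-term relation. -/
lemma signedCount_not_aux : ∀ o : Fin 3 → Bool, ∀ d : Fin 4, ∀ e ∈ orders, ∀ k ∈ orders,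
    signedCount (fun i => !o i) (triangleSign o) e k d.val =
      signedCount o (triangleSign o) e k d.val := by
  decide +kernel

lemma signedCount_not {o : Fin 3 → Bool} {s : Fin 3 → ℤ}
    (hs : s = triangleSign o ∨ s = triangleSign fun i => !o i) {d : ℕ} (hd : d < 4)
    {e k : Fin 3 → Fin 3} (he : e ∈ orders) (hk : k ∈ orders) :
    signedCount (fun i => !o i) s e k d = signedCount o s e k d := by
  rcases hs with rfl | rfl
  · exact signedCount_not_aux o ⟨d, hd⟩ e he k hk
  · have := signedCount_not_aux (fun i => !o i) ⟨d, hd⟩ e he k hk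
    simp only [Bool.not_not] at this
    exact this.symm

lemma exists_order {Q : Fin 3 → ℕ} (hQ : Function.Injective Q) :
    ∃ k ∈ orders, ∀ i j, Q i < Q j ↔ (k i).val < (k j).val := by
  have h01 : Q 0 ≠ Q 1 := fun h => absurd (hQ h) (by decide)
  have h02 : Q 0 ≠ Q 2 := fun h => absurd (hQ h) (by decide)
  have h12 : Q 1 ≠ Q 2 := fun h => absurd (hQ h) (by decide)
  have key : ∀ k : Fin 3 → Fin 3, k ∈ orders → (Q 0 < Q 1 ↔ (k 0).val < (k 1).val) →
      (Q 0 < Q 2 ↔ (k 0).val < (k 2).val) → (Q 1 < Q 2 ↔ (k 1).val < (k 2).val) →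
      k 0 ≠ k 1 → k 0 ≠ k 2 → k 1 ≠ k 2 →
      ∃ k ∈ orders, ∀ i j, Q i < Q j ↔ (k i).val < (k j).val := by
    intro k hk a b c d e f
    rw [Ne, Fin.ext_iff] at d e f
    refine ⟨k, hk, fun i j => ?_⟩
    fin_cases i <;> fin_cases j <;> simp only [Fin.zero_eta, Fin.mk_one, Fin.reduceFinMk,
      lt_self_iff_false] <;> omega
  rcases lt_or_gt_of_ne h01 with a | a <;> rcases lt_or_gt_of_ne h02 with b | b <;>
    rcases lt_or_gt_of_ne h12 with c | c
  · exact key ![0, 1, 2] (by decide) (by simp; omega) (by simp; omega) (by simp; omega)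
      (by decide) (by decide) (by decide)
  · exact key ![0, 2, 1] (by decide) (by simp; omega) (by simp; omega) (by simp; omega)
      (by decide) (by decide) (by decide)
  · omega
  · exact key ![1, 2, 0] (by decide) (by simp; omega) (by simp; omega) (by simp; omega)
      (by decide) (by decide) (by decide)
  · exact key ![1, 0, 2] (by decide) (by simp; omega) (by simp; omega) (by simp; omega)
      (by decide) (by decide) (by decide)
  · omega
  · exact key ![2, 0, 1] (by decide) (by simp; omega) (by simp; omega) (by simp; omega)
      (by decide) (by decide) (by decide)
  · exact key ![2, 1, 0] (by decide) (by simp; omega) (by simp; omega) (by simp; omega)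
      (by decide) (by decide) (by decide)

end Strands

/-! ### Separation of the triangle from the rest of the diagram -/

lemma Equiv.Perm.potential_lt_of_find_lt {X : Type*} [DecidableEq X] {w : Equiv.Perm X} {x₀ : X}
    {q : X → ℕ} (hq : ∀ x, w x ≠ x₀ → q x < q (w x)) (hr : ∀ y, ∃ k : ℕ, (w ^ k) x₀ = y)
    {u v : X} (h : Nat.find (hr u) < Nat.find (hr v)) : q u < q v := by
  have hm := Nat.find_spec (hr v)
  have hmin := fun j => @Nat.find_min _ _ (hr v) j
  have hk := Nat.find_spec (hr u)
  set m := Nat.find (hr v)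
  set k := Nat.find (hr u)
  have key : ∀ j, k + j + 1 ≤ m → q u < q ((w ^ (k + j + 1)) x₀) := by
    intro j hj
    have step : ∀ i, k + i + 1 ≤ m → q ((w ^ (k + i)) x₀) < q ((w ^ (k + i + 1)) x₀) := by
      intro i hi
      have h2 : w ((w ^ (k + i)) x₀) ≠ x₀ := by
        intro h3
        rw [← Equiv.Perm.mul_apply, ← pow_succ'] at h3
        refine hmin (m - (k + i + 1)) (by omega) ?_
        rw [← h3, ← Equiv.Perm.mul_apply, ← pow_add, Nat.sub_add_cancel (by omega), hm]
      have h3 := hq _ h2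
      rwa [← Equiv.Perm.mul_apply, ← pow_succ'] at h3
    induction j with
    | zero => rw [← hk]; exact step 0 hj
    | succ j ih => exact (ih (by omega)).trans (step (j + 1) hj)
  have h1 := key (m - k - 1) (by omega)
  rwa [show k + (m - k - 1) + 1 = m by omega, hm] at h1

/-- A function that increases along a map of `Fin N`, except at the base point. -/
def IsPotential {N : ℕ} (w : Fin N → Fin N) (q : Fin N → ℕ) : Prop :=
  ∀ x, (w x).val ≠ 0 → q x < q (w x)

/-- Every potential orders the points by the times of their first visits. Hence all potentials
induce the same strict order. -/
lemma IsPotential.lt_and_injective {N : ℕ} {w : Fin N → Fin N} (hw : Function.Bijective w)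
    {q q' : Fin N → ℕ} (hq : IsPotential w q) (hq' : IsPotential w q') (u v : Fin N) :
    (q u < q v ↔ q' u < q' v) ∧ (q u = q v → u = v) := by
  have hN : 0 < N := by have := u.isLt; omega
  set x₀ : Fin N := ⟨0, hN⟩
  set W := Equiv.ofBijective w hw
  have h0 : ∀ {p : Fin N → ℕ}, IsPotential w p → ∀ x, W x ≠ x₀ → p x < p (W x) := by
    intro p hp x hx
    exact hp x fun h => hx (Fin.ext h)
  have hr := Equiv.Perm.exists_pow_eq_of_potential (h0 hq)
  have key : ∀ {p : Fin N → ℕ}, IsPotential w p → ∀ u v, Nat.find (hr u) < Nat.find (hr v) →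
      p u < p v := fun hp u v h => Equiv.Perm.potential_lt_of_find_lt (h0 hp) hr h
  rcases lt_trichotomy (Nat.find (hr u)) (Nat.find (hr v)) with h | h | h
  · have h1 := key hq _ _ h
    have h2 := key hq' _ _ h
    exact ⟨iff_of_true h1 h2, fun e => by omega⟩
  · have e : u = v := by
      rw [← Nat.find_spec (hr u), ← Nat.find_spec (hr v), h]
    subst e
    exact ⟨iff_of_false (lt_irrefl _) (lt_irrefl _), fun _ => rfl⟩
  · have h1 := key hq _ _ h
    have h2 := key hq' _ _ h
    exact ⟨iff_of_false (by omega) (by omega), fun e => by omega⟩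

namespace Strands

/-- The places of the six end points of a triangle. -/
structure IsPlacement {N : ℕ} (P : Place → Fin N) : Prop where
  injective : Function.Injective P
  succ : ∀ i, (P (i, true)).val = (P (i, false)).val + 1

variable {N : ℕ} {P : Place → Fin N} {J : Fin N → Fin N}

/-- The map `J` preserves the set of places, and is given there by `f`. -/
structure Extends (P : Place → Fin N) (f : Place → Place) (j J : Fin N → Fin N) : Prop where
  place : ∀ y, J (P y) = P (f y)
  off : ∀ x, (∀ y, P y ≠ x) → J x = j x
  off_off : ∀ x, (∀ y, P y ≠ x) → ∀ y, P y ≠ j x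

/-- Potentials outside of the triangle. -/
def IsOuterPotential (P : Place → Fin N) (j : Fin N → Fin N) (e : Fin 3 → Fin 3) (Q : Fin N → ℕ) :
    Prop :=
  (∀ x, (∀ y, P y ≠ x) → (finRotate N (j x)).val ≠ 0 → Q x < Q (finRotate N (j x))) ∧
    ∀ i, (finRotate N (P (i, true))).val ≠ 0 →
      Q (P (e i, false)) < Q (finRotate N (P (i, true)))

lemma IsPlacement.finRotate_false (hP : IsPlacement P) (i : Fin 3) :
    finRotate N (P (i, false)) = P (i, true) := by
  apply Fin.ext
  have h1 := hP.succ i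
  have h2 := (P (i, true)).isLt
  rw [finRotate_val, if_neg (by omega), h1]

lemma IsPlacement.finRotate_ne (hP : IsPlacement P) {x : Fin N} (hx : ∀ i, x ≠ P (i, false)) (i : Fin 3) :
    finRotate N x ≠ P (i, true) := by
  rw [← hP.finRotate_false]
  exact fun h => hx i ((finRotate N).injective h)

lemma origin_false (f : Place → Place) (i : Fin 3) : origin f 4 (i, false) = (i, 0) := by
  simp [origin]

/-- Only the passages through the triangle need an argument: the potential does not decrease from
the entry on, by induction on the number of steps, and it increases on leaving. -/
lemma IsPotential.isOuterPotential (hP : IsPlacement P) {f : Place → Place} (hf : ∀ y, f (f y) = y)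
    {j : Fin N → Fin N} (hJ : Extends P f j J) (ht : IsTraversed f) {q : Fin N → ℕ}
    (hq : IsPotential (fun x => finRotate N (J x)) q) : IsOuterPotential P j (entry f) q := by
  refine ⟨fun x hx hne => ?_, fun i hne => ?_⟩
  · have := hq x
    simp only [hJ.off x hx] at this
    exact this hne
  · have key : ∀ t y, (origin f 4 y).2 = t → q (P ((origin f 4 y).1, false)) ≤ q (P y) := by
      intro t
      induction t with
      | zero =>
        rintro ⟨i, _ | _⟩ h
        · rw [origin_false]
        · have := ht.step_snd i
          omega
      | succ t ih =>
        rintro ⟨i, _ | _⟩ h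
        · rw [origin_false] at h
          simp at h
        · rw [ht.step_snd] at h
          have h1 := ih (f (i, false)) (by omega)
          have h2 := hq (P (f (i, false)))
          simp only [hJ.place, hf, hP.finRotate_false] at h2
          have h3 := h2 (by rw [hP.succ]; omega)
          rw [ht.step_fst]
          omega
    have h1 := key _ (f (i, true)) rfl
    have h2 := hq (P (f (i, true)))
    simp only [hJ.place, hf] at h2
    exact h1.trans_lt (h2 hne)

open Classical in
/-- The extension of a potential to the triangle. -/
noncomputable def innerPotential (P : Place → Fin N) (f : Place → Place) (Q : Fin N → ℕ)
    (x : Fin N) : ℕ :=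
  if h : ∃ y, P y = x then
    10 * Q (P ((origin f 4 h.choose).1, false)) + (origin f 4 h.choose).2
  else 10 * Q x

lemma innerPotential_place (hP : IsPlacement P) (f : Place → Place) (Q : Fin N → ℕ) (y : Place) :
    innerPotential P f Q (P y) =
      10 * Q (P ((origin f 4 y).1, false)) + (origin f 4 y).2 := by
  have h : ∃ z, P z = P y := ⟨y, rfl⟩
  rw [innerPotential, dif_pos h, hP.injective h.choose_spec]

lemma innerPotential_off (f : Place → Place) (Q : Fin N → ℕ) {x : Fin N} (hx : ∀ y, P y ≠ x) :
    innerPotential P f Q x = 10 * Q x := by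
  rw [innerPotential, dif_neg (by push Not; exact hx)]

lemma innerPotential_of_ne (hP : IsPlacement P) (f : Place → Place) (Q : Fin N → ℕ) {x : Fin N}
    (hx : ∀ i, x ≠ P (i, true)) : innerPotential P f Q x = 10 * Q x := by
  by_cases h : ∃ y, P y = x
  · obtain ⟨⟨i, _ | _⟩, rfl⟩ := h
    · rw [innerPotential_place hP, origin_false]
      rfl
    · exact absurd rfl (hx i)
  · exact innerPotential_off f Q (by push Not at h; exact h)

/-- Scaling by ten leaves room for the steps inside the triangle, whose number is less than ten. -/
lemma IsOuterPotential.isPotential (hP : IsPlacement P) {f : Place → Place} (hf : ∀ y, f (f y) = y)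
    {j : Fin N → Fin N} (hJ : Extends P f j J) (ht : IsTraversed f) {Q : Fin N → ℕ}
    (hQ : IsOuterPotential P j (entry f) Q) :
    IsPotential (fun x => finRotate N (J x)) (innerPotential P f Q) := by
  intro x hx
  simp only at hx ⊢
  by_cases h : ∃ y, P y = x
  · obtain ⟨y, rfl⟩ := h
    rw [hJ.place] at hx ⊢
    rw [innerPotential_place hP]
    obtain ⟨i, hi⟩ : ∃ i, i = (f y).1 := ⟨_, rfl⟩
    cases hb : (f y).2 with
    | false =>
      have e : f y = (i, false) := Prod.ext hi.symm hb
      have e' : y = f (i, false) := by rw [← e, hf]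
      rw [e, hP.finRotate_false, innerPotential_place hP, ht.step_fst, ht.step_snd, ← e']
      omega
    | true =>
      have e : f y = (i, true) := Prod.ext hi.symm hb
      have e' : y = f (i, true) := by rw [← e, hf]
      rw [e] at hx ⊢
      rw [innerPotential_of_ne hP f Q (hP.finRotate_ne fun k h => by
        simpa using hP.injective h)]
      have h1 := hQ.2 i hx
      rw [entry, ← e'] at h1
      have := ht.bound y
      omega
  · have hx' : ∀ y, P y ≠ x := by push Not at h; exact h
    rw [hJ.off x hx'] at hx ⊢
    rw [innerPotential_off f Q hx', innerPotential_of_ne hP f Q (hP.finRotate_ne fun k h =>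
      hJ.off_off x hx' _ h.symm)]
    have := hQ.1 x hx' hx
    omega

/-- There is a potential for which the heads precede the tails, in the triangle, and which is in
agreement with `R` outside of it. -/
def Good (P : Place → Fin N) (R : Fin N → Fin N → Prop) (o T : Fin 3 → Bool) (J : Fin N → Fin N) :
    Prop :=
  ∃ q, IsPotential (fun x => finRotate N (J x)) q ∧ (∀ u v, R u v → q u < q v) ∧
    ∀ y, T (arrowAt o y) = true → isHead o y = true → q (P y) < q (P (partner o y))

lemma Extends.bijective {f : Place → Place} (hf : ∀ y, f (f y) = y)
    {j : Fin N → Fin N} (hj : ∀ x, j (j x) = x) (hJ : Extends P f j J) :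
    Function.Bijective fun x => finRotate N (J x) := by
  refine (finRotate N).bijective.comp (Function.Involutive.bijective fun x => ?_)
  by_cases h : ∃ y, P y = x
  · obtain ⟨y, rfl⟩ := h
    rw [hJ.place, hJ.place, hf]
  · have hx' : ∀ y, P y ≠ x := by push Not at h; exact h
    rw [hJ.off x hx', hJ.off _ (hJ.off_off x hx'), hj]

lemma ordered_congr {o T : Fin 3 → Bool} {k k' : Fin 3 → ℕ} (h : ∀ i j, k i < k j ↔ k' i < k' j) :
    Ordered o T k ↔ Ordered o T k' := by
  simp only [Ordered, h]

/-- As the number of steps is below ten, the comparison is lexicographic: first the entries, then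
the steps. -/
lemma innerPotential_lt_iff (hP : IsPlacement P) {f : Place → Place} (ht : IsTraversed f)
    (Q : Fin N → ℕ) {y z : Place}
    (hinj : ∀ i i', Q (P (i, false)) = Q (P (i', false)) → i = i') :
    innerPotential P f Q (P y) < innerPotential P f Q (P z) ↔
      Q (P ((origin f 4 y).1, false)) < Q (P ((origin f 4 z).1, false)) ∨
        (origin f 4 y).1 = (origin f 4 z).1 ∧ (origin f 4 y).2 < (origin f 4 z).2 := by
  rw [innerPotential_place hP, innerPotential_place hP]
  have h1 := ht.bound y
  have h2 := ht.bound z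
  by_cases h : (origin f 4 y).1 = (origin f 4 z).1
  · rw [h]
    simp
  · have : Q (P ((origin f 4 y).1, false)) ≠ Q (P ((origin f 4 z).1, false)) :=
      fun e => h (hinj _ _ e)
    simp only [h, false_and, or_false]
    omega

/-- Two outer potentials agree on the order in which the strands are entered. -/
lemma IsOuterPotential.lt_iff (hP : IsPlacement P) {f : Place → Place} (hf : ∀ y, f (f y) = y)
    {j : Fin N → Fin N} (hj : ∀ x, j (j x) = x) (hJ : Extends P f j J) (ht : IsTraversed f)
    {Q Q' : Fin N → ℕ} (hQ : IsOuterPotential P j (entry f) Q)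
    (hQ' : IsOuterPotential P j (entry f) Q') (i i' : Fin 3) :
    (Q (P (i, false)) < Q (P (i', false)) ↔ Q' (P (i, false)) < Q' (P (i', false))) ∧
      (Q (P (i, false)) = Q (P (i', false)) → i = i') := by
  have h := IsPotential.lt_and_injective (hJ.bijective hf hj) (hQ.isPotential hP hf hJ ht)
    (hQ'.isPotential hP hf hJ ht) (P (i, false)) (P (i', false))
  simp only [innerPotential_place hP, origin_false] at h
  refine ⟨by have := h.1; omega, fun e => ?_⟩
  have := hP.injective (h.2 (by omega))
  simpa using this

/-- All potentials order the points alike, so a given potential can be replaced by the one that is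
rebuilt from its outer part. For the latter the conditions in the triangle are those of `Ordered`.
-/
lemma good_iff (hP : IsPlacement P) {R : Fin N → Fin N → Prop} {j : Fin N → Fin N}
    (hj : ∀ x, j (j x) = x) (hR : ∀ u v, R u v → (∀ y, P y ≠ u) ∧ ∀ y, P y ≠ v)
    {o T : Fin 3 → Bool} (hJ : Extends P (jump o T) j J) (ht : IsTraversed (jump o T)) :
    Good P R o T J ↔ ∃ Q, IsOuterPotential P j (entry (jump o T)) Q ∧ (∀ u v, R u v → Q u < Q v) ∧
      Ordered o T fun i => Q (P (i, false)) := by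
  have hf := jump_jump o T
  constructor
  · rintro ⟨q, hq, hqR, hord⟩
    have hQ := IsPotential.isOuterPotential hP hf hJ ht hq
    refine ⟨q, hQ, hqR, fun y hT hh => ?_⟩
    have h1 := (IsPotential.lt_and_injective (hJ.bijective hf hj) hq (hQ.isPotential hP hf hJ ht)
      _ _).1.mp (hord y hT hh)
    exact (innerPotential_lt_iff hP ht q fun i i' => (hQ.lt_iff hP hf hj hJ ht hQ i i').2).mp h1
  · rintro ⟨Q, hQ, hQR, hord⟩
    refine ⟨_, hQ.isPotential hP hf hJ ht, fun u v huv => ?_, fun y hT hh => ?_⟩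
    · rw [innerPotential_off _ _ (hR u v huv).1, innerPotential_off _ _ (hR u v huv).2]
      have := hQR u v huv
      omega
    · exact (innerPotential_lt_iff hP ht Q fun i i' =>
        (hQ.lt_iff hP hf hj hJ ht hQ i i').2).mpr (hord y hT hh)

lemma not_good (hP : IsPlacement P) {R : Fin N → Fin N → Prop} {j : Fin N → Fin N}
    {o T : Fin 3 → Bool} (hJ : Extends P (jump o T) j J) (ht : ¬ IsTraversed (jump o T)) :
    ¬ Good P R o T J := by
  rintro ⟨q, hq, -⟩
  obtain ⟨a, b, c, h1, h2, h3⟩ := (not_isTraversed o T).resolve_left ht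
  have step : ∀ {i k}, jump o T (i, true) = (k, false) → q (P (i, true)) < q (P (k, true)) := by
    intro i k h
    have := hq (P (i, true))
    simp only [hJ.place, h, hP.finRotate_false] at this
    exact this (by rw [hP.succ]; omega)
  have := step h1
  have := step h2
  have := step h3
  omega

/-- For every way of connecting the strands, the goodness depends only on the order in which the
strands are entered. -/
lemma exists_good_iff (hP : IsPlacement P) {R : Fin N → Fin N → Prop} {j : Fin N → Fin N}
    (hj : ∀ x, j (j x) = x) (hR : ∀ u v, R u v → (∀ y, P y ≠ u) ∧ ∀ y, P y ≠ v)
    (e : Fin 3 → Fin 3) : ∃ (b : Prop) (k : Fin 3 → Fin 3), k ∈ orders ∧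
      ∀ o T J, Extends P (jump o T) j J → IsTraversed (jump o T) → entry (jump o T) = e →
        (Good P R o T J ↔ b ∧ Ordered o T fun i => (k i).val) := by
  by_cases h : (∃ o T J, Extends P (jump o T) j J ∧ IsTraversed (jump o T) ∧
      entry (jump o T) = e) ∧ ∃ Q, IsOuterPotential P j e Q ∧ ∀ u v, R u v → Q u < Q v
  · obtain ⟨⟨o, T, J, hJ, ht, rfl⟩, Q, hQ, hQR⟩ := h
    have hlt := fun {Q'} hQ' => hQ.lt_iff hP (jump_jump o T) hj hJ ht (Q' := Q') hQ'
    -- All outer potentials order the three entries alike, so a single `k` serves for every state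
    -- with this pattern.
    obtain ⟨k, hk, hkQ⟩ := exists_order (Q := fun i => Q (P (i, false)))
      fun i i' e => (hlt hQ i i').2 e
    refine ⟨True, k, hk, fun o' T' J' hJ' ht' he' => ?_⟩
    rw [good_iff hP hj hR hJ' ht', he', true_and]
    constructor
    · rintro ⟨Q', hQ', -, h⟩
      rw [← ordered_congr hkQ]
      exact (ordered_congr fun i i' => ((hlt hQ' i i').1).symm).mp h
    · intro h
      exact ⟨Q, hQ, hQR, (ordered_congr hkQ).mpr h⟩
  -- The order is arbitrary here, since no state is good.
  · refine ⟨False, ![0, 1, 2], by decide, fun o T J hJ ht he => iff_of_false (fun hg => ?_) (by simp)⟩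
    rw [good_iff hP hj hR hJ ht, he] at hg
    obtain ⟨Q, h1, h2, -⟩ := hg
    exact h ⟨⟨o, T, J, hJ, ht, he⟩, Q, h1, h2⟩

open Classical in
/-- The signed number of good sets of `d` arrows of the triangle. -/
noncomputable def goodCount (P : Place → Fin N) (R : Fin N → Fin N → Prop) (o : Fin 3 → Bool)
    (s : Fin 3 → ℤ) (J : (Fin 3 → Bool) → Fin N → Fin N) (d : ℕ) : ℤ :=
  ∑ T : Fin 3 → Bool, if (∑ i, if T i then 1 else 0) = d ∧ Good P R o T (J T)
    then ∏ i, if T i then s i else 1 else 0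

/-- The signed number of good sets of `d` arrows of the triangle does not change when all three
strands are moved across the opposite crossings. -/
theorem sum_good_not (hP : IsPlacement P) {R : Fin N → Fin N → Prop} {j : Fin N → Fin N}
    (hj : ∀ x, j (j x) = x) (hR : ∀ u v, R u v → (∀ y, P y ≠ u) ∧ ∀ y, P y ≠ v)
    {o : Fin 3 → Bool} {s : Fin 3 → ℤ}
    (hs : s = triangleSign o ∨ s = triangleSign fun i => !o i)
    {J J' : (Fin 3 → Bool) → Fin N → Fin N} (hJ : ∀ T, Extends P (jump o T) j (J T))
    (hJ' : ∀ T, Extends P (jump (fun i => !o i) T) j (J' T)) {d : ℕ} (hd : d < 4) :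
    goodCount P R (fun i => !o i) s J' d = goodCount P R o s J d := by
  classical
  choose b k hk hb using fun e => exists_good_iff hP hj hR e
  -- The states are sorted by the pattern `e` in which they connect the strands. The outside decides
  -- whether `e` is admissible and gives the order `k e`; what remains is a local count.
  have key : ∀ (o : Fin 3 → Bool) (J : (Fin 3 → Bool) → Fin N → Fin N),
      (∀ T, Extends P (jump o T) j (J T)) →
      goodCount P R o s J d = ∑ e ∈ orders.toFinset, if b e then signedCount o s e (k e) d else 0 := by
    intro o J hJ
    have h1 : ∀ e, (if b e then signedCount o s e (k e) d else 0) = ∑ T : Fin 3 → Bool,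
        if e = entry (jump o T) then (if (∑ i, if T i then 1 else 0) = d ∧ b e ∧
          IsTraversed (jump o T) ∧ Ordered o T (fun i => (k e i).val) then
            ∏ i, if T i then s i else 1 else 0) else 0 := by
      intro e
      rw [signedCount]
      split_ifs with h
      · refine Finset.sum_congr rfl fun T _ => ?_
        by_cases he : e = entry (jump o T)
        · rw [if_pos he]
          exact if_congr (by rw [← he]; simp only [h, true_and]) rfl rfl
        · rw [if_neg he, if_neg]
          rintro ⟨-, -, h', -⟩
          exact he h'.symm
      · simp [h]
    simp only [h1, goodCount]
    rw [Finset.sum_comm]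
    refine Finset.sum_congr rfl fun T _ => ?_
    rw [Finset.sum_ite_eq']
    by_cases ht : IsTraversed (jump o T)
    · rw [if_pos (List.mem_toFinset.mpr (entry_mem_orders o T ht))]
      simp only [hb _ o T (J T) (hJ T) ht rfl, ht, true_and]
    · simp [ht, not_good hP (hJ T) ht]
  rw [key _ _ hJ, key _ _ hJ']
  refine Finset.sum_congr rfl fun e he => ?_
  rw [signedCount_not hs hd (List.mem_toFinset.mp he) (hk e)]

end Strands

/-! ### The ascending sum under the third move -/

namespace Strands

/-- The other place on the same strand. -/
def other (y : Place) : Place := (y.1, !y.2)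

lemma other_other (y : Place) : other (other y) = y := by simp [other]

/-- Reversing the order on all strands has the same effect as exchanging the two places on each
strand, which is what the move does. -/
lemma partner_not : ∀ o y, other (partner o (other y)) = partner (fun i => !o i) y := by
  decide +kernel

lemma arrowAt_not : ∀ o y, arrowAt o (other y) = arrowAt (fun i => !o i) y := by decide +kernel

lemma isHead_not : ∀ o y, isHead o (other y) = isHead (fun i => !o i) y := by decide +kernel

/-- The head of an arrow of the triangle. -/
def headPlace (o : Fin 3 → Bool) (i : Fin 3) : Place := ![(1, !o 1), (2, !o 2), (2, o 2)] i

lemma arrowAt_headPlace : ∀ o i, arrowAt o (headPlace o i) = i := by decide +kernel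

lemma isHead_headPlace : ∀ o i, isHead o (headPlace o i) = true := by decide +kernel

lemma headPlace_arrowAt : ∀ o y, isHead o y = true → headPlace o (arrowAt o y) = y := by
  decide +kernel

lemma eq_headPlace_or : ∀ o y, y = headPlace o (arrowAt o y) ∨
    y = partner o (headPlace o (arrowAt o y)) := by decide +kernel

end Strands

open Strands

namespace GaussDiagram

variable {n : ℕ} {G : GaussDiagram n}

/-- The end points of a triangle of arrows with given orders on the three strands. -/
structure HasTriangle (G : GaussDiagram n) (P : Place → Fin (2 * n)) (o : Fin 3 → Bool)
    (s : Fin 3 → ℤ) : Prop extends IsPlacement P where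
  partner : ∀ y, G.partner (P y) = P (Strands.partner o y)
  isHead : ∀ y, G.isHead (P y) = Strands.isHead o y
  sign : ∀ y, ((G.sign (P y) : ℤˣ) : ℤ) = s (arrowAt o y)

/-- The end points of some of the arrows of a triangle. -/
def trianglePoints (P : Place → Fin (2 * n)) (o T : Fin 3 → Bool) : Finset (Fin (2 * n)) :=
  (Finset.univ.filter fun y => T (arrowAt o y) = true).image P

variable {P : Place → Fin (2 * n)} {o : Fin 3 → Bool} {s : Fin 3 → ℤ}

namespace HasTriangle

lemma place_mem_iff (h : G.HasTriangle P o s) (T : Fin 3 → Bool) {S : Finset (Fin (2 * n))}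
    (hS : ∀ y, P y ∉ S) (y : Place) : P y ∈ S ∪ trianglePoints P o T ↔ T (arrowAt o y) = true := by
  rw [Finset.mem_union, trianglePoints, h.injective.mem_finset_image]
  simp [hS]

lemma mem_iff (T : Fin 3 → Bool) {S : Finset (Fin (2 * n))} {x : Fin (2 * n)}
    (hx : ∀ y, P y ≠ x) : x ∈ S ∪ trianglePoints P o T ↔ x ∈ S := by
  rw [Finset.mem_union, trianglePoints, Finset.mem_image]
  simp [hx]

lemma partner_ne (h : G.HasTriangle P o s) {x : Fin (2 * n)} (hx : ∀ y, P y ≠ x) (y : Place) :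
    P y ≠ G.partner x := by
  intro e
  have := h.partner y
  rw [e, G.partner_partner] at this
  exact hx _ this.symm

lemma isClosed_union (h : G.HasTriangle P o s) (T : Fin 3 → Bool) {S : Finset (Fin (2 * n))}
    (hS : ∀ y, P y ∉ S) (hcl : G.IsClosed S) : G.IsClosed (S ∪ trianglePoints P o T) := by
  intro x
  by_cases hx : ∃ y, P y = x
  · obtain ⟨y, rfl⟩ := hx
    rw [h.partner, h.place_mem_iff T hS, h.place_mem_iff T hS, arrowAt_partner]
  · push Not at hx
    rw [mem_iff T (h.partner_ne hx), mem_iff T hx]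
    exact hcl x

lemma extends_jump (h : G.HasTriangle P o s) (T : Fin 3 → Bool) {S : Finset (Fin (2 * n))}
    (hS : ∀ y, P y ∉ S) :
    Extends P (jump o T) (G.jump S) (G.jump (S ∪ trianglePoints P o T)) := by
  refine ⟨fun y => ?_, fun x hx => ?_, fun x hx y => ?_⟩
  · rw [ArrowDiagram.jump, Strands.jump]
    simp only [h.place_mem_iff T hS, h.partner]
    split_ifs <;> rfl
  · simp only [ArrowDiagram.jump, mem_iff T hx]
  · rw [ArrowDiagram.jump]
    split_ifs
    · exact h.partner_ne hx y
    · exact hx y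

/-- The order conditions at the heads of the arrows in `S`. -/
def _root_.GaussDiagram.HeadFirst (G : GaussDiagram n) (S : Finset (Fin (2 * n)))
    (u v : Fin (2 * n)) : Prop :=
  u ∈ S ∧ G.isHead u = true ∧ v = G.partner u

/-- The order conditions split into those at the arrows in `S`, which are collected in `HeadFirst`,
and those at the arrows of the triangle. -/
lemma ascends_iff_good (h : G.HasTriangle P o s) (T : Fin 3 → Bool) {S : Finset (Fin (2 * n))}
    (hS : ∀ y, P y ∉ S) : G.Ascends (S ∪ trianglePoints P o T) ↔
      Good P (G.HeadFirst S) o T (G.jump (S ∪ trianglePoints P o T)) := by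
  refine exists_congr fun q => and_congr_right fun _ => ⟨fun hq => ⟨?_, ?_⟩, fun hq x hx hh => ?_⟩
  · rintro u v ⟨hu, hh, rfl⟩
    exact hq u (Finset.mem_union_left _ hu) hh
  · intro y hT hh
    rw [← h.partner]
    exact hq _ ((h.place_mem_iff T hS y).mpr hT) (by rw [h.isHead, hh])
  · by_cases hx' : ∃ y, P y = x
    · obtain ⟨y, rfl⟩ := hx'
      rw [h.partner]
      exact hq.2 y ((h.place_mem_iff T hS y).mp hx) (by rw [← h.isHead, hh])
    · push Not at hx'
      exact hq.1 x _ ⟨(mem_iff T hx').mp hx, hh, rfl⟩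

lemma prod_triangle (s : Fin 3 → ℤ) (T : Fin 3 → Bool) :
    (∏ i, if T i then C (s i) * X else 1 : ℤ[X]) =
      C (∏ i, if T i then s i else 1) * X ^ (∑ i, if T i then 1 else 0 : ℕ) := by
  simp only [Fin.prod_univ_three, Fin.sum_univ_three]
  cases T 0 <;> cases T 1 <;> cases T 2 <;> simp <;> ring

lemma arrowWeight_union (h : G.HasTriangle P o s) (T : Fin 3 → Bool) {S : Finset (Fin (2 * n))}
    (hS : ∀ y, P y ∉ S) : G.arrowWeight (S ∪ trianglePoints P o T) =
      G.arrowWeight S * ∏ i, if T i then C (s i) * X else 1 := by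
  have hd : Disjoint S (trianglePoints P o T) := by
    rw [Finset.disjoint_left]
    intro x hx hx'
    obtain ⟨y, -, rfl⟩ := Finset.mem_image.mp hx'
    exact hS y hx
  rw [arrowWeight, Finset.filter_union, Finset.prod_union (Finset.disjoint_filter_filter hd)]
  congr 1
  rw [trianglePoints, Finset.prod_filter, Finset.prod_image h.injective.injOn,
    ← Finset.prod_filter, Finset.filter_filter, ← Finset.prod_filter]
  refine Finset.prod_nbij' (arrowAt o) (headPlace o) ?_ ?_ ?_ ?_ ?_
  · intro y hy
    simpa using (Finset.mem_filter.mp hy).2.1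
  · intro i hi
    simpa [h.isHead, arrowAt_headPlace, isHead_headPlace] using hi
  · intro y hy
    exact headPlace_arrowAt o y (by rw [← h.isHead]; exact (Finset.mem_filter.mp hy).2.2)
  · exact fun i _ => arrowAt_headPlace o i
  · exact fun y _ => by rw [h.sign]

open Classical in
-- A closed set is the union of a closed set off the triangle and the end points of some of the
-- three arrows, in a unique way.
lemma ascSum_eq (h : G.HasTriangle P o s) : G.ascSum =
    ∑ S : Finset (Fin (2 * n)) with G.IsClosed S ∧ ∀ y, P y ∉ S, ∑ T : Fin 3 → Bool,
      if G.Ascends (S ∪ trianglePoints P o T) then G.arrowWeight (S ∪ trianglePoints P o T)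
      else 0 := by
  change ∑ S : Finset (Fin (2 * n)) with G.IsClosed S ∧ G.Ascends S, G.arrowWeight S = _
  rw [← Finset.filter_filter, Finset.sum_filter]
  rw [Finset.sum_sigma']
  symm
  refine Finset.sum_bij' (fun x _ => x.1 ∪ trianglePoints P o x.2)
    (fun S _ => ⟨S \ Finset.univ.image P, fun i => decide (P (headPlace o i) ∈ S)⟩) ?_ ?_ ?_ ?_ ?_
  · rintro ⟨S, T⟩ hS
    simp only [Finset.mem_sigma, Finset.mem_filter, Finset.mem_univ, true_and, and_true] at hS ⊢
    exact h.isClosed_union T hS.2 hS.1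
  · intro S hS
    simp only [Finset.mem_sigma, Finset.mem_filter, Finset.mem_univ, true_and, and_true] at hS ⊢
    refine ⟨fun x => ?_, fun y hy => ?_⟩
    · simp only [Finset.mem_sdiff, Finset.mem_image, Finset.mem_univ, true_and]
      refine and_congr (hS x) (not_congr ⟨?_, ?_⟩)
      · rintro ⟨y, hy⟩
        exact ⟨_, by rw [← h.partner, hy, G.partner_partner]⟩
      · rintro ⟨y, rfl⟩
        exact ⟨_, (h.partner y).symm⟩
    · rw [Finset.mem_sdiff] at hy
      exact hy.2 (Finset.mem_image_of_mem _ (Finset.mem_univ _))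
  · rintro ⟨S, T⟩ hS
    simp only [Finset.mem_sigma, Finset.mem_filter, Finset.mem_univ, true_and, and_true] at hS
    have e1 : (S ∪ trianglePoints P o T) \ Finset.univ.image P = S := by
      ext x
      by_cases hx : ∃ y, P y = x
      · obtain ⟨y, rfl⟩ := hx
        simp [hS.2]
      · push Not at hx
        rw [Finset.mem_sdiff, mem_iff T hx]
        simp [hx]
    simp only [e1, h.place_mem_iff T hS.2, arrowAt_headPlace, Bool.decide_eq_true]
  · intro S hS
    simp only [Finset.mem_filter, Finset.mem_univ, true_and] at hS
    have hd : ∀ y, P y ∉ S \ Finset.univ.image P := by simp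
    ext x
    by_cases hx : ∃ y, P y = x
    · obtain ⟨y, rfl⟩ := hx
      rw [h.place_mem_iff _ hd, decide_eq_true_eq]
      rcases eq_headPlace_or o y with e | e
      · rw [← e]
      · conv_rhs => rw [e, ← h.partner]
        exact (hS _).symm
    · push Not at hx
      rw [mem_iff _ hx]
      simp [hx]
  · exact fun _ _ => rfl

/-- The states are sorted by the number of arrows of the triangle, because the relation between the
two sides of the move holds in each degree separately. -/
lemma sum_triangle (h : G.HasTriangle P o s) {S : Finset (Fin (2 * n))} (hS : ∀ y, P y ∉ S) :
    (open Classical in ∑ T : Fin 3 → Bool,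
      if G.Ascends (S ∪ trianglePoints P o T) then G.arrowWeight (S ∪ trianglePoints P o T)
      else 0) = G.arrowWeight S * ∑ d ∈ Finset.range 4,
        C (goodCount P (G.HeadFirst S) o s (fun T => G.jump (S ∪ trianglePoints P o T)) d) *
          X ^ d := by
  classical
  simp only [goodCount, map_sum, Finset.sum_mul]
  rw [Finset.sum_comm, Finset.mul_sum]
  refine Finset.sum_congr rfl fun T _ => ?_
  have hT : (∑ i, if T i then 1 else 0 : ℕ) ∈ Finset.range 4 := by
    rw [Fin.sum_univ_three]
    cases T 0 <;> cases T 1 <;> cases T 2 <;> simp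
  rw [Finset.sum_eq_single_of_mem _ hT]
  · simp only [h.ascends_iff_good T hS, true_and]
    split_ifs
    · rw [h.arrowWeight_union T hS, prod_triangle]
    · simp
  · intro d _ hd
    rw [if_neg fun h' => hd h'.1.symm]
    simp

end HasTriangle

/-- Two diagrams that differ only in the orders of the end points of a triangle on its strands. -/
theorem ascSum_eq_of_hasTriangle {G' : GaussDiagram n} (h : G.HasTriangle P o s)
    (h' : G'.HasTriangle P (fun i => !o i) s)
    (hs : s = triangleSign o ∨ s = triangleSign fun i => !o i)
    (hp : ∀ x, (∀ y, P y ≠ x) → G'.partner x = G.partner x)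
    (hh : ∀ x, (∀ y, P y ≠ x) → G'.isHead x = G.isHead x)
    (hsign : ∀ x, (∀ y, P y ≠ x) → G'.sign x = G.sign x) : G'.ascSum = G.ascSum := by
  classical
  rw [h.ascSum_eq, h'.ascSum_eq]
  have hmem : ∀ {S : Finset (Fin (2 * n))}, (∀ y, P y ∉ S) → ∀ x ∈ S, ∀ y, P y ≠ x := by
    rintro S hS x hx y rfl
    exact hS y hx
  have hcl : ∀ S : Finset (Fin (2 * n)), (∀ y, P y ∉ S) → (G'.IsClosed S ↔ G.IsClosed S) := by
    intro S hS
    refine forall_congr' fun x => ?_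
    by_cases hx : ∃ y, P y = x
    · obtain ⟨y, rfl⟩ := hx
      rw [h.partner, h'.partner]
      simp [hS]
    · push Not at hx
      rw [hp x hx]
  refine Finset.sum_congr (Finset.filter_congr fun S _ => and_congr_left (hcl S)) fun S hS => ?_
  obtain ⟨hS1, hS2⟩ := (Finset.mem_filter.mp hS).2
  have hjump : G'.jump S = G.jump S := by
    funext x
    unfold ArrowDiagram.jump
    split_ifs with hx
    · exact hp x (hmem hS2 x hx)
    · rfl
  have hR : G'.HeadFirst S = G.HeadFirst S := by
    funext u v
    refine propext (and_congr_right fun hu => ?_)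
    rw [hh u (hmem hS2 u hu), hp u (hmem hS2 u hu)]
  have hw : G'.arrowWeight S = G.arrowWeight S := by
    unfold arrowWeight
    refine Finset.prod_congr (Finset.filter_congr fun x hx => ?_) fun x hx => ?_
    · rw [hh x (hmem hS2 x hx)]
    · rw [hsign x (hmem hS2 x (Finset.mem_filter.mp hx).1)]
  have hJ' := fun T => h'.extends_jump T hS2
  rw [hjump] at hJ'
  have key := fun d (hd : d ∈ Finset.range 4) => sum_good_not (R := G.HeadFirst S)
    h.toIsPlacement (ArrowDiagram.jump_jump hS1) (by
      rintro u v ⟨hu, -, rfl⟩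
      exact ⟨hmem hS2 u hu, h.partner_ne (hmem hS2 u hu)⟩) hs (fun T => h.extends_jump T hS2) hJ'
    (Finset.mem_range.mp hd)
  refine (h'.sum_triangle hS2).trans (Eq.trans ?_ (h.sum_triangle hS2).symm)
  rw [hw, hR]
  exact congrArg _ (Finset.sum_congr rfl fun d hd => by rw [key d hd])

end GaussDiagram

open Strands

namespace Strands

/-- The sign condition in the definition of the move determines the signs from the three orders, up
to a simultaneous reversal that `η` accounts for. -/
lemma triangleSign_units : ∀ η a b c : ℤˣ, ∀ o : Fin 3 → Bool,
    o = ![decide (η * b = 1), decide (η * c = 1), decide (η * (a * b * c) = 1)] →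
    (![(a : ℤ), b, c] = triangleSign o ∨ ![(a : ℤ), b, c] = triangleSign fun i => !o i) := by
  rintro η a b c o rfl
  revert η a b c
  decide +kernel

end Strands

namespace GaussDiagram

variable {n : ℕ} {G G' : GaussDiagram n}

/-- The places of the points of a triangle. -/
def trianglePlace (G : GaussDiagram n) (a b c : Fin (2 * n)) (o : Fin 3 → Bool) (y : Place) :
    Fin (2 * n) :=
  if y.2 = o y.1 then ![b, c, G.partner c] y.1 else ![a, G.partner a, G.partner b] y.1

namespace IsTriangle

variable {a b c : Fin (2 * n)} {η : ℤˣ}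

/-- Which of the two arrows comes first, on each strand. -/
def order (G : GaussDiagram n) (a b c : Fin (2 * n)) (η : ℤˣ) : Fin 3 → Bool :=
  ![decide (η * G.sign b = 1), decide (η * G.sign c = 1),
    decide (η * (G.sign a * G.sign b * G.sign c) = 1)]

lemma hasTriangle (h : G.IsTriangle a b c η) :
    G.HasTriangle (G.trianglePlace a b c (order G a b c η)) (order G a b c η)
      ![(G.sign a : ℤ), G.sign b, G.sign c] := by
  obtain ⟨h1, h2, h3, ⟨h4, h5, h6⟩, ⟨h7, h8, h9⟩, ⟨h10, h11, h12⟩, h13, h14, h15⟩ := h.distinct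
  have ho : ∀ {x y : Fin (2 * n)} {u : ℤˣ}, (y.val : ℤ) - x.val = (u : ℤ) →
      (decide (u = 1) = true ∧ y.val = x.val + 1) ∨ (decide (u = 1) = false ∧ x.val = y.val + 1) := by
    intro x y u hu
    rcases Int.units_eq_one_or u with rfl | rfl
    · left; simp at hu ⊢; omega
    · right; simp at hu ⊢; omega
  have k0 := ho h.top
  have k1 := ho h.middle
  have k2 := ho h.bottom
  have hta := h.tail_a
  have htb := h.tail_b
  have htc := h.tail_c
  have e : order G a b c η = ![decide (η * G.sign b = 1), decide (η * G.sign c = 1),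
    decide (η * (G.sign a * G.sign b * G.sign c) = 1)] := rfl
  -- With the three orders as free Boolean variables, the rest is a finite case distinction.
  generalize decide (η * G.sign b = 1) = o0 at e k0
  generalize decide (η * G.sign c = 1) = o1 at e k1
  generalize decide (η * (G.sign a * G.sign b * G.sign c) = 1) = o2 at e k2
  rw [e]
  refine ⟨⟨?_, ?_⟩, ?_, ?_, ?_⟩
  · rintro ⟨i, x⟩ ⟨j, y⟩ hxy
    clear k0 k1 k2 e hta htb htc ho h
    fin_cases i <;> fin_cases j <;> cases x <;> cases y <;> cases o0 <;> cases o1 <;> cases o2 <;>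
      simp_all [trianglePlace, eq_comm]
  · intro i
    fin_cases i
    · rcases k0 with ⟨rfl, k⟩ | ⟨rfl, k⟩ <;> simpa [trianglePlace] using k
    · rcases k1 with ⟨rfl, k⟩ | ⟨rfl, k⟩ <;> simpa [trianglePlace] using k
    · rcases k2 with ⟨rfl, k⟩ | ⟨rfl, k⟩ <;> simpa [trianglePlace] using k
  · rintro ⟨i, x⟩
    fin_cases i <;> cases x <;> cases o0 <;> cases o1 <;> cases o2 <;>
      simp [trianglePlace, Strands.partner, arrowAt, G.partner_partner]
  · rintro ⟨i, x⟩
    fin_cases i <;> cases x <;> cases o0 <;> cases o1 <;> cases o2 <;>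
      simp [trianglePlace, Strands.isHead, arrowAt, G.isHead_partner, hta, htb, htc]
  · rintro ⟨i, x⟩
    fin_cases i <;> cases x <;> cases o0 <;> cases o1 <;> cases o2 <;>
      simp [trianglePlace, arrowAt, G.sign_partner]

lemma triangleSwap_place (h : G.IsTriangle a b c η) (o : Fin 3 → Bool) (y : Place) :
    G.triangleSwap a b c (G.trianglePlace a b c o y) = G.trianglePlace a b c o (other y) := by
  obtain ⟨h1, h2, h3, ⟨h4, h5, h6⟩, ⟨h7, h8, h9⟩, ⟨h10, h11, h12⟩, h13, h14, h15⟩ := h.distinct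
  have s1 : G.triangleSwap a b c a = b := by
    simp [triangleSwap, Equiv.swap_apply_of_ne_of_ne, *]
  have s2 : G.triangleSwap a b c b = a := by
    simp [triangleSwap, Equiv.swap_apply_of_ne_of_ne, *]
  have s3 : G.triangleSwap a b c (G.partner a) = c := by
    simp [triangleSwap, Equiv.swap_apply_of_ne_of_ne h13 h14,
      Equiv.swap_apply_of_ne_of_ne h2.symm h3.symm]
  have s4 : G.triangleSwap a b c c = G.partner a := by
    simp [triangleSwap, Equiv.swap_apply_of_ne_of_ne h11 h12,
      Equiv.swap_apply_of_ne_of_ne h4.symm h7.symm]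
  have s5 : G.triangleSwap a b c (G.partner b) = G.partner c := by
    simp [triangleSwap, Equiv.swap_apply_of_ne_of_ne h14.symm h12.symm,
      Equiv.swap_apply_of_ne_of_ne h6.symm h9.symm]
  have s6 : G.triangleSwap a b c (G.partner c) = G.partner b := by
    simp [triangleSwap, Equiv.swap_apply_of_ne_of_ne h13.symm h11.symm,
      Equiv.swap_apply_of_ne_of_ne h5.symm h8.symm]
  obtain ⟨i, x⟩ := y
  by_cases hx : x = o i
  · subst hx
    fin_cases i <;> simp [trianglePlace, other, s2, s4, s6]
  · have : (!x) = o i := by cases x <;> cases ho : o i <;> simp_all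
    fin_cases i <;> simp_all [trianglePlace, other]

lemma triangleSwap_off {o : Fin 3 → Bool} {x : Fin (2 * n)}
    (hx : ∀ y, G.trianglePlace a b c o y ≠ x) : G.triangleSwap a b c x = x := by
  have key : ∀ i, x ≠ ![b, c, G.partner c] i ∧ x ≠ ![a, G.partner a, G.partner b] i := by
    intro i
    have k1 := hx (i, o i)
    have k2 := hx (i, !o i)
    simp only [trianglePlace, if_true, Bool.not_eq_eq_eq_not] at k1 k2
    exact ⟨k1.symm, by simpa using k2.symm⟩
  have k0 := key 0
  have k1 := key 1
  have k2 := key 2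
  simp only [Matrix.cons_val] at k0 k1 k2
  simp [triangleSwap, Equiv.swap_apply_of_ne_of_ne, *]

end IsTriangle

/-- The diagram after the move has a triangle at the same places, with the same signs and all three
orders reversed, and it agrees with the former one elsewhere. -/
theorem ascSum_omega3 (hG : Omega3 G G') : G'.ascSum = G.ascSum := by
  obtain ⟨a, b, c, η, h, rfl⟩ := omega3_iff.mp hG
  set o := IsTriangle.order G a b c η
  set P := G.trianglePlace a b c o
  set τ := G.triangleSwap a b c with hτ
  have hP := h.hasTriangle
  have hsymm : ∀ y, τ.symm (P y) = P (other y) := fun y => by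
    rw [Equiv.symm_apply_eq, h.triangleSwap_place, other_other]
  have hoff : ∀ x, (∀ y, P y ≠ x) → τ.symm x = x := fun x hx => by
    rw [Equiv.symm_apply_eq, IsTriangle.triangleSwap_off hx]
  refine ascSum_eq_of_hasTriangle hP ⟨hP.toIsPlacement, fun y => ?_, fun y => ?_, fun y => ?_⟩
    (triangleSign_units η (G.sign a) (G.sign b) (G.sign c) o rfl)
    (fun x hx => ?_) (fun x hx => ?_) (fun x hx => ?_)
  · change τ (G.partner (τ.symm (P y))) = _
    rw [hsymm, hP.partner, h.triangleSwap_place, partner_not]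
  · change G.isHead (τ.symm (P y)) = _
    rw [hsymm, hP.isHead, isHead_not]
  · change ((G.sign (τ.symm (P y)) : ℤˣ) : ℤ) = _
    rw [hsymm, hP.sign, arrowAt_not]
  · change τ (G.partner (τ.symm x)) = _
    rw [hoff x hx, IsTriangle.triangleSwap_off (hP.partner_ne hx)]
  · change G.isHead (τ.symm x) = _
    rw [hoff x hx]
  · change G.sign (τ.symm x) = _
    rw [hoff x hx]

/-! ### Invariance -/

lemma IsEmbedding.flip {m : ℕ} {G : GaussDiagram m} {G' : GaussDiagram n}
    {f : Fin (2 * m) → Fin (2 * n)} (hf : G.IsEmbedding G' f) : G.flip.IsEmbedding G'.flip f :=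
  ⟨hf.toIsHom.flip, hf.map_sign⟩

lemma Omega1.flip {G : GaussDiagram n} {G' : GaussDiagram (n + 1)} (h : Omega1 G G') :
    Omega1 G.flip G'.flip := by
  obtain ⟨f, hf, h⟩ := h
  exact ⟨f, hf.flip, h⟩

lemma Omega2.flip {G : GaussDiagram n} {G' : GaussDiagram (n + 2)} (h : Omega2 G G') :
    Omega2 G.flip G'.flip := by
  obtain ⟨f, hf, p, p', q, q', hpp, hqq, hp, hp', hpart, hsign, hmiss⟩ := h
  have hm : ∀ i, f i ≠ q ∧ f i ≠ q' ∧ f i ≠ p ∧ f i ≠ p' := fun i =>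
    ⟨(hmiss i).2.2.1, (hmiss i).2.2.2, (hmiss i).1, (hmiss i).2.1⟩
  have key : ∀ x, G'.isHead x = false → G'.flip.isHead (G'.partner x) = false := by
    intro x hx
    change (!G'.isHead (G'.partner x)) = false
    rw [G'.isHead_partner, hx]
    rfl
  refine ⟨f, hf.flip, q, q', p, p', hqq, hpp, ?_, ?_, ?_, ?_, hm⟩
  · rcases hpart with ⟨e, e'⟩ | ⟨e, e'⟩
    · exact e ▸ key p hp
    · exact e' ▸ key p' hp'
  · rcases hpart with ⟨e, e'⟩ | ⟨e, e'⟩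
    · exact e' ▸ key p' hp'
    · exact e ▸ key p hp
  · change (G'.partner q = p ∧ G'.partner q' = p') ∨ (G'.partner q = p' ∧ G'.partner q' = p)
    rcases hpart with ⟨e, e'⟩ | ⟨e, e'⟩ <;> rw [← e, ← e', G'.partner_partner, G'.partner_partner]
    · exact Or.inl ⟨rfl, rfl⟩
    · exact Or.inr ⟨rfl, rfl⟩
  · change G'.sign q' = -G'.sign q
    rcases hpart with ⟨e, e'⟩ | ⟨e, e'⟩ <;>
      simp only [← e, ← e', G'.sign_partner, hsign, neg_neg]

/-- Reversing the arrows turns the triangle upside down: the top and the bottom strand are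
exchanged, hence also the roles of the first and the third arrow. -/
lemma IsTriangle.flip {a b c : Fin (2 * n)} {η : ℤˣ} (h : G.IsTriangle a b c η) :
    G.flip.IsTriangle (G.partner c) (G.partner b) (G.partner a)
      (-(η * (G.sign a * G.sign c))) := by
  have hh : ∀ x, G.isHead x = false → G.flip.isHead (G.partner x) = false := by
    intro x hx
    change (!G.isHead (G.partner x)) = false
    rw [G.isHead_partner, hx]
    rfl
  have hs : ∀ x, G.flip.sign (G.partner x) = G.sign x := G.sign_partner
  have hp : ∀ x, G.flip.partner (G.partner x) = x := G.partner_partner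
  have key : ∀ η x y z : ℤˣ, ((-(η * (x * z)) * y : ℤˣ) : ℤ) = -(η * (x * y * z) : ℤˣ) ∧
      ((-(η * (x * z)) * x : ℤˣ) : ℤ) = -(η * z : ℤˣ) ∧
      ((-(η * (x * z)) * (z * y * x) : ℤˣ) : ℤ) = -(η * y : ℤˣ) := by decide
  obtain ⟨k1, k2, k3⟩ := key η (G.sign a) (G.sign b) (G.sign c)
  have t1 := h.top
  have t2 := h.middle
  have t3 := h.bottom
  refine ⟨fun e => h.ne (G.partner_injective e).symm, hh c h.tail_c, hh b h.tail_b, hh a h.tail_a,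
    ?_, ?_, ?_⟩
  · rw [hs, k1]; omega
  · rw [hp, hs, k2]; omega
  · rw [hp, hp, hs, hs, hs, k3]; omega

lemma Omega3.flip (hG : Omega3 G G') : Omega3 G.flip G'.flip := by
  obtain ⟨a, b, c, η, h, rfl⟩ := omega3_iff.mp hG
  refine omega3_iff.mpr ⟨_, _, _, _, h.flip, ?_⟩
  have e : G.flip.triangleSwap (G.partner c) (G.partner b) (G.partner a) =
      G.triangleSwap a b c := by
    obtain ⟨h1, h2, h3, ⟨h4, h5, h6⟩, ⟨h7, h8, h9⟩, ⟨h10, h11, h12⟩, h13, h14, h15⟩ := h.distinct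
    have hp : ∀ x, G.flip.partner (G.partner x) = x := G.partner_partner
    unfold triangleSwap
    rw [hp, hp, hp, Equiv.swap_comm (G.partner c), Equiv.swap_comm c, Equiv.swap_comm b]
    have d1 : Commute (Equiv.swap (G.partner b) (G.partner c)) (Equiv.swap (G.partner a) c) :=
      (Equiv.Perm.disjoint_swap_swap (by simp; tauto)).commute
    have d2 : Commute (Equiv.swap (G.partner b) (G.partner c)) (Equiv.swap a b) :=
      (Equiv.Perm.disjoint_swap_swap (by simp; tauto)).commute
    have d3 : Commute (Equiv.swap (G.partner a) c) (Equiv.swap a b) :=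
      (Equiv.Perm.disjoint_swap_swap (by simp; tauto)).commute
    rw [d1.eq, mul_assoc, d2.eq, ← mul_assoc, d3.eq]
  rw [e]
  rfl

lemma ReidemeisterMove.nabla_eq {G G' : Σ n, GaussDiagram n} (h : ReidemeisterMove G G') :
    G.2.nablaA = G'.2.nablaA ∧ G.2.nablaD = G'.2.nablaD := by
  simp only [nablaD_eq_flip, nablaA_eq_ascSum]
  cases h with
  | omega1 h => exact ⟨(ascSum_omega1 h).symm, (ascSum_omega1 h.flip).symm⟩
  | omega2 h => exact ⟨(ascSum_omega2 h).symm, (ascSum_omega2 h.flip).symm⟩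
  | omega3 h => exact ⟨(ascSum_omega3 h).symm, (ascSum_omega3 h.flip).symm⟩

theorem LongEquiv.nabla_eq {m n : ℕ} {G : GaussDiagram m} {H : GaussDiagram n}
    (h : G.LongEquiv H) :
    G.nablaA = H.nablaA ∧ G.nablaD = H.nablaD ∧ G.nablaAD = H.nablaAD := by
  have key : ∀ {G G' : Σ n, GaussDiagram n}, Relation.EqvGen ReidemeisterMove G G' →
      G.2.nablaA = G'.2.nablaA ∧ G.2.nablaD = G'.2.nablaD := by
    intro G G' h
    induction h with
    | rel _ _ h => exact h.nabla_eq
    | refl => exact ⟨rfl, rfl⟩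
    | symm _ _ _ ih => exact ⟨ih.1.symm, ih.2.symm⟩
    | trans _ _ _ _ _ ih1 ih2 => exact ⟨ih1.1.trans ih2.1, ih1.2.trans ih2.2⟩
  have := key h
  exact ⟨this.1, this.2, by rw [nablaAD, nablaAD, this.1, this.2]⟩

end GaussDiagram

/-! ### Evaluation of the polynomials on the Kishino knot -/

/-- The points up to the first visit of `y` are distinct, so there are at most `N` of them. -/
lemma Equiv.Perm.exists_pow_eq_lt {N : ℕ} {w : Equiv.Perm (Fin N)} {x₀ y : Fin N}
    (h : ∃ k : ℕ, (w ^ k) x₀ = y) : ∃ k < N, (w ^ k) x₀ = y := by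
  refine ⟨Nat.find h, ?_, Nat.find_spec h⟩
  have hinj : Function.Injective fun i : Fin (Nat.find h + 1) => (w ^ i.val) x₀ := by
    have key : ∀ i j : ℕ, i < j → j ≤ Nat.find h → (w ^ i) x₀ ≠ (w ^ j) x₀ := by
      intro i j hij hj e
      refine Nat.find_min h (m := Nat.find h - j + i) (by omega) ?_
      rw [pow_add, Equiv.Perm.mul_apply, e, ← Equiv.Perm.mul_apply, ← pow_add,
        Nat.sub_add_cancel hj, Nat.find_spec h]
    intro i j e
    by_contra hne
    rcases lt_or_gt_of_ne fun e' => hne (Fin.ext e') with h' | h'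
    · exact key _ _ h' (by omega) e
    · exact key _ _ h' (by omega) e.symm
  have := Fintype.card_le_of_injective _ hinj
  simp only [Fintype.card_fin] at this
  omega

namespace ArrowDiagram

variable {n : ℕ}

/-- The list of the points that are passed from the base point on, in the given number of steps. -/
def walkList (A : ArrowDiagram n) (S : Finset (Fin (2 * n))) : ℕ → Fin (2 * n) → List (Fin (2 * n))
  | 0, _ => []
  | k + 1, x => x :: A.walkList S k (A.walk S x)

lemma getElem?_walkList (A : ArrowDiagram n) (S : Finset (Fin (2 * n))) (k : ℕ) (x : Fin (2 * n))
    (i : ℕ) : (A.walkList S k x)[i]? = if i < k then some ((A.walk S)^[i] x) else none := by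
  induction k generalizing x i with
  | zero => simp [walkList]
  | succ k ih =>
    cases i with
    | zero => simp [walkList]
    | succ i => simp [walkList, ih]

/-- A criterion in terms of the first passages of the end points. -/
def AscendsFrom (A : ArrowDiagram n) (S : Finset (Fin (2 * n))) (x₀ : Fin (2 * n)) : Prop :=
  (∀ y, y ∈ A.walkList S (2 * n) x₀) ∧ ∀ u ∈ S, A.isHead u = true →
    (A.walkList S (2 * n) x₀).idxOf u < (A.walkList S (2 * n) x₀).idxOf (A.partner u)

instance (A : ArrowDiagram n) (S : Finset (Fin (2 * n))) (x₀ : Fin (2 * n)) :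
    Decidable (A.AscendsFrom S x₀) := by unfold AscendsFrom; infer_instance

instance (A : ArrowDiagram n) (S : Finset (Fin (2 * n))) : Decidable (A.IsClosed S) := by
  unfold IsClosed; infer_instance

/-- The index of a point in the list of the first `2 * n` points of the walk is the time of its
first visit. This makes the condition decidable. -/
lemma ascends_iff_ascendsFrom {A : ArrowDiagram n} {S : Finset (Fin (2 * n))} (hS : A.IsClosed S)
    {x₀ : Fin (2 * n)} (hx₀ : x₀.val = 0) : A.Ascends S ↔ A.AscendsFrom S x₀ := by
  set w := Equiv.ofBijective _ (walk_bijective hS) with hw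
  have hpow : ∀ k : ℕ, (w ^ k) x₀ = (A.walk S)^[k] x₀ := by
    intro k
    rw [← Equiv.Perm.iterate_eq_pow]
    rfl
  have h0 : ∀ x : Fin (2 * n), x ≠ x₀ ↔ x.val ≠ 0 := fun x => by rw [Ne, Fin.ext_iff, hx₀]
  set L := A.walkList S (2 * n) x₀ with hL
  have hget : ∀ i y, L[i]? = some y ↔ i < 2 * n ∧ (w ^ i) x₀ = y := by
    intro i y
    rw [hL, getElem?_walkList, hpow]
    split_ifs with h <;> simp [h]
  have hmem : ∀ y, y ∈ L ↔ ∃ k : ℕ, (w ^ k) x₀ = y := by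
    intro y
    rw [List.mem_iff_getElem?]
    simp only [hget]
    exact ⟨fun ⟨i, _, hi⟩ => ⟨i, hi⟩, Equiv.Perm.exists_pow_eq_lt⟩
  have hidx : ∀ y (h : ∃ k : ℕ, (w ^ k) x₀ = y), Nat.find h = L.idxOf y := by
    intro y h
    have hlt := List.idxOf_lt_length_of_mem ((hmem y).mpr h)
    have hs := ((hget _ _).mp (List.getElem?_eq_some_iff.mpr ⟨hlt, List.getElem_idxOf hlt⟩)).2
    rw [Nat.find_eq_iff]
    refine ⟨hs, fun k hk e => ?_⟩
    have hk' : k < 2 * n := by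
      obtain ⟨i, hi, e'⟩ := Equiv.Perm.exists_pow_eq_lt h
      have := List.getElem?_eq_some_iff.mp ((hget (L.idxOf y) y).mpr ⟨?_, hs⟩)
      · exact hk.trans ((hget _ _).mp (List.getElem?_eq_some_iff.mpr this)).1
      · exact ((hget _ _).mp (List.getElem?_eq_some_iff.mpr ⟨hlt, List.getElem_idxOf hlt⟩)).1
    have h1 := List.getElem?_eq_some_iff.mp ((hget k y).mpr ⟨hk', e⟩)
    obtain ⟨h2, h3⟩ := h1
    have := List.not_of_lt_findIdx hk
    simp [h3] at this
  constructor
  · rintro ⟨q, hq, hord⟩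
    have hq' : ∀ x, w x ≠ x₀ → q x < q (w x) := fun x hx => hq x ((h0 _).mp hx)
    have hr := Equiv.Perm.exists_pow_eq_of_potential hq'
    refine ⟨fun y => (hmem y).mpr (hr y), fun u hu hh => ?_⟩
    rw [← hL, ← hidx u (hr u), ← hidx _ (hr _)]
    have h1 := hord u hu hh
    rcases lt_trichotomy (Nat.find (hr u)) (Nat.find (hr (A.partner u))) with h | h | h
    · exact h
    · have e1 := Nat.find_spec (hr u)
      have e2 := Nat.find_spec (hr (A.partner u))
      rw [h, e2] at e1
      rw [e1] at h1
      exact absurd h1 (lt_irrefl _)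
    · have := Equiv.Perm.potential_lt_of_find_lt hq' hr h
      omega
  · rintro ⟨hr, hord⟩
    have hr' : ∀ y, ∃ k : ℕ, (w ^ k) x₀ = y := fun y => (hmem y).mp (hr y)
    obtain ⟨q, hq, hR⟩ := Equiv.Perm.exists_tight_potential (w := w) (x₀ := x₀)
      (R := fun u v => u ∈ S ∧ A.isHead u = true ∧ v = A.partner u) hr' (by
        rintro u v ⟨hu, hh, rfl⟩ k hk
        have h1 := hord u hu hh
        rw [← hL, ← hidx u (hr' u), ← hidx _ (hr' _)] at h1
        exact ⟨_, h1.trans_le (Nat.find_min' _ hk), Nat.find_spec (hr' u)⟩)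
    exact ⟨q, fun x hx => by rw [show q (A.walk S x) = q x + 1 from hq x ((h0 _).mpr hx)]; omega,
      fun u hu hh => hR u _ ⟨hu, hh, rfl⟩⟩

end ArrowDiagram

namespace GaussDiagram

/-- The sum over the ascending sets of `k` arrows, in a form that can be evaluated. -/
def ascCountFrom {n : ℕ} (G : GaussDiagram n) (x₀ : Fin (2 * n)) (k : ℕ) : ℤ :=
  ∑ S : Finset (Fin (2 * n)) with
      (G.IsClosed S ∧ G.AscendsFrom S x₀) ∧ (S.filter fun i => G.isHead i = true).card = k,
        ∏ i ∈ S with G.isHead i = true, ((G.sign i : ℤˣ) : ℤ)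

lemma ascCount_eq_ascCountFrom {n : ℕ} (G : GaussDiagram n) {x₀ : Fin (2 * n)}
    (hx₀ : x₀.val = 0) (k : ℕ) : G.ascCount k = G.ascCountFrom x₀ k := by
  classical
  rw [ascCount_eq, ascCountFrom]
  refine Finset.sum_congr ?_ fun _ _ => rfl
  ext S
  simp only [Finset.mem_filter, Finset.mem_univ, true_and]
  exact and_congr_left' (and_congr_right fun hS => ArrowDiagram.ascends_iff_ascendsFrom hS hx₀)

lemma ascCountFrom_kishino : ∀ (ε δ : ℤˣ) (k : Fin 5),
    (kishinoG ε δ).ascCountFrom 0 k = ![1, 0, -2, 0, 1] k ∧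
    (kishinoG ε δ).flip.ascCountFrom 0 k = ![1, 0, 0, 0, 0] k ∧
    (kishinoG' ε δ).ascCountFrom 0 k = ![1, 0, 0, 0, 0] k ∧
    (kishinoG' ε δ).flip.ascCountFrom 0 k = ![1, 0, -2, 0, 1] k := by
  decide +kernel

lemma nablaA_eq_of_ascCountFrom {G : GaussDiagram 4} {v : Fin 5 → ℤ}
    (h : ∀ k : Fin 5, G.ascCountFrom 0 k = v k) :
    G.nablaA = C (v 0) + C (v 1) * X + C (v 2) * X ^ 2 + C (v 3) * X ^ 3 + C (v 4) * X ^ 4 := by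
  have h' : ∀ k : Fin 5, G.ascCount k = v k := fun k =>
    (G.ascCount_eq_ascCountFrom (x₀ := 0) rfl k).trans (h k)
  have h0 := h' 0
  have h1 := h' 1
  have h2 := h' 2
  have h3 := h' 3
  have h4 := h' 4
  simp only [Fin.coe_ofNat_eq_mod, Nat.zero_mod, Nat.reduceMod] at h0 h1 h2 h3 h4
  simp only [nablaA, Finset.sum_range_succ, Finset.sum_range_zero, h0, h1, h2, h3, h4]
  ring

theorem nabla_kishino (ε δ : ℤˣ) :
    ((kishinoG ε δ).nablaA = 1 - 2 * X ^ 2 + X ^ 4 ∧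
      (kishinoG ε δ).nablaD = 1 ∧
      (kishinoG ε δ).nablaAD = -2 * X ^ 2 + X ^ 4) ∧
    ((kishinoG' ε δ).nablaA = 1 ∧
      (kishinoG' ε δ).nablaD = 1 - 2 * X ^ 2 + X ^ 4 ∧
      (kishinoG' ε δ).nablaAD = 2 * X ^ 2 - X ^ 4) := by
  have h := ascCountFrom_kishino ε δ
  have h1 := nablaA_eq_of_ascCountFrom fun k => (h k).1
  have h2 := nablaA_eq_of_ascCountFrom fun k => (h k).2.1
  have h3 := nablaA_eq_of_ascCountFrom fun k => (h k).2.2.1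
  have h4 := nablaA_eq_of_ascCountFrom fun k => (h k).2.2.2
  rw [← nablaD_eq_flip] at h2 h4
  simp only [Matrix.cons_val, map_one, map_zero, zero_mul, add_zero, map_neg, map_ofNat]
    at h1 h2 h3 h4
  rw [nablaAD, nablaAD, h1, h2, h3, h4]
  refine ⟨⟨?_, ?_, ?_⟩, ?_, ?_, ?_⟩ <;> ring

end GaussDiagram

/-! ### The skein tree of a diagram with a base point -/

namespace GaussDiagram

variable {n : ℕ} (G : GaussDiagram n)

/-- The `i`-th point on the way along the circle with the arrows in `S` smoothed. -/
def stepsFrom (x₀ : Fin (2 * n)) (S : Finset (Fin (2 * n))) (i : ℕ) : Fin (2 * n) :=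
  (G.walk S)^[i] x₀

/-- The crossing through `z` is met in the first `m` steps. -/
def Met (x₀ : Fin (2 * n)) (S : Finset (Fin (2 * n))) (m : ℕ) (z : Fin (2 * n)) : Prop :=
  ∃ i < m, G.stepsFrom x₀ S i = z ∨ G.stepsFrom x₀ S i = G.partner z

/-- A stage of the exploration of the diagram: the crossings met in the first `m` steps have been
smoothed or changed in such a way that the smoothed arrows are met at their heads first, and at the
other crossings the first passage has the type `t`. -/
structure Explored (x₀ : Fin (2 * n)) (t : Bool) (S : Finset (Fin (2 * n))) (ov : Fin (2 * n) → Bool)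
    (m : ℕ) : Prop where
  closed : G.IsClosed S
  ov_partner : ∀ z, ov (G.partner z) = !ov z
  no_return : ∀ i < m, 0 < i → G.stepsFrom x₀ S i ≠ x₀
  met : ∀ z ∈ S, G.Met x₀ S m z
  head_first : ∀ i < m, G.stepsFrom x₀ S i ∈ S → G.isHead (G.stepsFrom x₀ S i) = false →
    ∃ l < i, G.stepsFrom x₀ S l = G.partner (G.stepsFrom x₀ S i)
  ov_first : ∀ i < m, G.stepsFrom x₀ S i ∉ S →
    (∀ l < i, G.stepsFrom x₀ S l ≠ G.partner (G.stepsFrom x₀ S i)) →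
    ov (G.stepsFrom x₀ S i) = t
  fresh : ∀ z, ¬ G.Met x₀ S m z → ov z = (if G.isHead z = true then !t else t)

variable {G} {x₀ : Fin (2 * n)} {t : Bool} {S S' : Finset (Fin (2 * n))} {ov : Fin (2 * n) → Bool}
  {m : ℕ}

lemma stepsFrom_succ (i : ℕ) :
    G.stepsFrom x₀ S (i + 1) = G.walk S (G.stepsFrom x₀ S i) :=
  Function.iterate_succ_apply' _ _ _

lemma Met.partner {z : Fin (2 * n)} (h : G.Met x₀ S m z) : G.Met x₀ S m (G.partner z) := by
  obtain ⟨i, hi, h⟩ := h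
  exact ⟨i, hi, by rw [G.partner_partner]; exact h.symm⟩

lemma Met.succ {z : Fin (2 * n)} (h : G.Met x₀ S m z) : G.Met x₀ S (m + 1) z := by
  obtain ⟨i, hi, h⟩ := h
  exact ⟨i, by omega, h⟩

lemma met_succ_iff {z : Fin (2 * n)} : G.Met x₀ S (m + 1) z ↔ G.Met x₀ S m z ∨
    G.stepsFrom x₀ S m = z ∨ G.stepsFrom x₀ S m = G.partner z := by
  constructor
  · rintro ⟨i, hi, h⟩
    rcases Nat.lt_succ_iff_lt_or_eq.mp hi with hi | rfl
    · exact Or.inl ⟨i, hi, h⟩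
    · exact Or.inr h
  · rintro (h | h)
    · exact h.succ
    · exact ⟨m, by omega, h⟩

/-- The steps depend only on the crossings that are met. -/
lemma stepsFrom_congr (h : ∀ z, G.Met x₀ S m z → (z ∈ S' ↔ z ∈ S)) :
    ∀ i ≤ m, G.stepsFrom x₀ S' i = G.stepsFrom x₀ S i := by
  intro i
  induction i with
  | zero => exact fun _ => rfl
  | succ i ih =>
    intro hi
    rw [stepsFrom_succ, stepsFrom_succ, ih (by omega)]
    unfold ArrowDiagram.walk ArrowDiagram.jump
    simp only [h _ ⟨i, by omega, Or.inl rfl⟩]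

lemma met_congr (h : ∀ z, G.Met x₀ S m z → (z ∈ S' ↔ z ∈ S)) {k : ℕ} (hk : k ≤ m + 1)
    (z : Fin (2 * n)) : G.Met x₀ S' k z ↔ G.Met x₀ S k z := by
  refine exists_congr fun i => and_congr_right fun hi => ?_
  rw [stepsFrom_congr h i (by omega)]

/-- The walk is injective, so the first repetition can only be a return to the starting point. -/
lemma stepsFrom_injOn (hS : G.IsClosed S) (h : ∀ i < m, 0 < i → G.stepsFrom x₀ S i ≠ x₀) :
    ∀ i < m, ∀ j < m, G.stepsFrom x₀ S i = G.stepsFrom x₀ S j → i = j := by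
  have key : ∀ i j, i < j → j < m → G.stepsFrom x₀ S i ≠ G.stepsFrom x₀ S j := by
    intro i
    induction i with
    | zero => exact fun j hj hjm e => h j hjm hj e.symm
    | succ i ih =>
      intro j hj hjm e
      obtain ⟨j, rfl⟩ : ∃ k, j = k + 1 := ⟨j - 1, by omega⟩
      rw [stepsFrom_succ, stepsFrom_succ] at e
      exact ih j (by omega) (by omega) ((ArrowDiagram.walk_bijective hS).injective e)
  intro i hi j hj e
  by_contra hne
  rcases lt_or_gt_of_ne hne with h' | h'
  · exact key i j h' hj e
  · exact key j i h' hi e.symm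

lemma le_of_no_return (hS : G.IsClosed S) (h : ∀ i < m, 0 < i → G.stepsFrom x₀ S i ≠ x₀) :
    m ≤ 2 * n := by
  have := Fintype.card_le_of_injective (fun i : Fin m => G.stepsFrom x₀ S i.val)
    fun i j e => Fin.ext (stepsFrom_injOn hS h i.val i.isLt j.val j.isLt e)
  simpa using this

/-- In an ascending diagram every point is reached, and the tails are reached after the heads. -/
lemma _root_.ArrowDiagram.Ascends.steps (hA : G.Ascends S) (hS : G.IsClosed S)
    (hx₀ : x₀.val = 0) : (∀ y, ∃ k, G.stepsFrom x₀ S k = y) ∧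
      ∀ u ∈ S, G.isHead u = true → ∀ k, G.stepsFrom x₀ S k = G.partner u →
        ∃ l < k, G.stepsFrom x₀ S l = u := by
  obtain ⟨q, hq, hord⟩ := hA
  set w := Equiv.ofBijective _ (ArrowDiagram.walk_bijective hS) with hw
  have hpow : ∀ k : ℕ, (w ^ k) x₀ = G.stepsFrom x₀ S k := by
    intro k
    rw [← Equiv.Perm.iterate_eq_pow]
    rfl
  have := Equiv.Perm.pow_eq_of_potential (w := w) (x₀ := x₀)
    (R := fun u v => u ∈ S ∧ G.isHead u = true ∧ v = G.partner u)
    (fun x hx => hq x fun e => hx (Fin.ext (e.trans hx₀.symm)))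
    (by rintro u v ⟨hu, hh, rfl⟩; exact hord u hu hh)
  simp only [hpow] at this
  exact ⟨this.1, fun u hu hh k hk => this.2 u _ ⟨hu, hh, rfl⟩ k hk⟩

/-- A closed path that does not return before covers all points and meets heads first. -/
lemma Explored.ascends (h : G.Explored x₀ t S ov m) (hx₀ : x₀.val = 0)
    (hret : G.stepsFrom x₀ S m = x₀) (hall : ∀ z, ∃ i < m, G.stepsFrom x₀ S i = z) :
    G.Ascends S := by
  choose pos hpos1 hpos2 using hall
  have huniq : ∀ {i z}, i < m → G.stepsFrom x₀ S i = z → pos z = i := fun hi hz =>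
    stepsFrom_injOn h.closed h.no_return _ (hpos1 _) _ hi ((hpos2 _).trans hz.symm)
  refine ⟨pos, fun x hx => ?_, fun x hx hh => ?_⟩
  · have hs : G.stepsFrom x₀ S (pos x + 1) = G.walk S x := by rw [stepsFrom_succ, hpos2]
    have hlt : pos x + 1 < m := by
      by_contra hge
      have := hpos1 x
      rw [show pos x + 1 = m by omega, hret] at hs
      exact hx (by rw [← hs, hx₀])
    rw [huniq hlt hs]
    omega
  · obtain ⟨l, hl, e⟩ := h.head_first (pos (G.partner x)) (hpos1 _)
      (by rw [hpos2]; exact (h.closed x).mpr hx) (by rw [hpos2, G.isHead_partner, hh]; rfl)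
    rw [hpos2, G.partner_partner] at e
    rw [huniq (hl.trans (hpos1 _)) e]
    exact hl

/-- The weight of a set of arrows, where each arrow contributes its sign and a factor `r`. -/
noncomputable def realWeight (G : GaussDiagram n) (r : ℝ) (S : Finset (Fin (2 * n))) : ℝ :=
  ∏ i ∈ S with G.isHead i = true, ((G.sign i : ℤˣ) : ℤ) * r

/-- The configuration with another type of passage at the crossing through `y`. -/
def changeAt (G : GaussDiagram n) (ov : Fin (2 * n) → Bool) (y z : Fin (2 * n)) : Bool :=
  if z = y ∨ z = G.partner y then !ov z else ov z

lemma changeAt_partner (hov : ∀ z, ov (G.partner z) = !ov z) (y z : Fin (2 * n)) :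
    G.changeAt ov y (G.partner z) = !G.changeAt ov y z := by
  have : (G.partner z = y ∨ G.partner z = G.partner y) ↔ (z = y ∨ z = G.partner y) := by
    rw [G.partner_injective.eq_iff, or_comm]
    refine or_congr_right ⟨fun e => by rw [← e, G.partner_partner], fun e => by
      rw [e, G.partner_partner]⟩
  simp only [changeAt, this, hov]
  split_ifs <;> rfl

lemma realWeight_insert (r : ℝ) {y : Fin (2 * n)} (hy : G.isHead y = true) (hyS : y ∉ S) :
    G.realWeight r (insert y (insert (G.partner y) S)) = ((G.sign y : ℤˣ) : ℤ) * r * G.realWeight r S := by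
  have h1 : G.isHead (G.partner y) ≠ true := by simp [G.isHead_partner, hy]
  rw [realWeight, Finset.filter_insert, if_pos hy, Finset.filter_insert, if_neg h1,
    Finset.prod_insert (by simp [hyS])]
  rfl

lemma isClosed_insert (hS : G.IsClosed S) (y : Fin (2 * n)) :
    G.IsClosed (insert y (insert (G.partner y) S)) := by
  intro z
  simp only [Finset.mem_insert, G.partner_injective.eq_iff, hS z]
  have : G.partner z = y ↔ z = G.partner y :=
    ⟨fun e => by rw [← e, G.partner_partner], fun e => by rw [e, G.partner_partner]⟩
  rw [this]
  tauto

lemma Explored.no_return_succ (h : G.Explored x₀ t S ov m)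
    (hne : ¬ (0 < m ∧ G.stepsFrom x₀ S m = x₀)) :
    ∀ i < m + 1, 0 < i → G.stepsFrom x₀ S i ≠ x₀ := by
  intro i hi hi0 e
  rcases Nat.lt_succ_iff_lt_or_eq.mp hi with hi | rfl
  · exact h.no_return i hi hi0 e
  · exact hne ⟨hi0, e⟩

/-- A step that requires no decision: the crossing was met before, or its passage has the right type
already. -/
lemma Explored.succ (h : G.Explored x₀ t S ov m) (hne : ¬ (0 < m ∧ G.stepsFrom x₀ S m = x₀))
    (h1 : G.stepsFrom x₀ S m ∈ S → G.isHead (G.stepsFrom x₀ S m) = false →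
      ∃ l < m, G.stepsFrom x₀ S l = G.partner (G.stepsFrom x₀ S m))
    (h2 : G.stepsFrom x₀ S m ∉ S →
      (∀ l < m, G.stepsFrom x₀ S l ≠ G.partner (G.stepsFrom x₀ S m)) →
      ov (G.stepsFrom x₀ S m) = t) : G.Explored x₀ t S ov (m + 1) where
  closed := h.closed
  ov_partner := h.ov_partner
  no_return := h.no_return_succ hne
  met z hz := (h.met z hz).succ
  head_first i hi := by
    rcases Nat.lt_succ_iff_lt_or_eq.mp hi with hi | rfl
    · exact h.head_first i hi
    · exact h1
  ov_first i hi := by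
    rcases Nat.lt_succ_iff_lt_or_eq.mp hi with hi | rfl
    · exact h.ov_first i hi
    · exact h2
  fresh z hz := h.fresh z fun hz' => hz hz'.succ

/-- One branch of the skein relation: a crossing that is met for the first time in the wrong way is
changed. -/
lemma Explored.succ_change (h : G.Explored x₀ t S ov m)
    (hne : ¬ (0 < m ∧ G.stepsFrom x₀ S m = x₀)) (hy : ¬ G.Met x₀ S m (G.stepsFrom x₀ S m))
    (hov : ov (G.stepsFrom x₀ S m) = !t) :
    G.Explored x₀ t S (G.changeAt ov (G.stepsFrom x₀ S m)) (m + 1) where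
  closed := h.closed
  ov_partner := changeAt_partner h.ov_partner _
  no_return := h.no_return_succ hne
  met z hz := (h.met z hz).succ
  head_first i hi := by
    rcases Nat.lt_succ_iff_lt_or_eq.mp hi with hi | rfl
    · exact h.head_first i hi
    · exact fun hS => absurd (h.met _ hS) hy
  ov_first i hi hS hfirst := by
    rcases Nat.lt_succ_iff_lt_or_eq.mp hi with hi | rfl
    · rw [changeAt, if_neg]
      · exact h.ov_first i hi hS hfirst
      · exact fun e => hy ⟨i, hi, e⟩
    · simp [changeAt, hov]
  fresh z hz := by
    rw [met_succ_iff] at hz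
    push Not at hz
    rw [changeAt, if_neg, h.fresh z hz.1]
    rintro (e | e)
    · exact hz.2.1 e.symm
    · exact hz.2.2 (by rw [e, G.partner_partner])

/-- The other branch: the crossing is smoothed. It was not met before, so the earlier steps remain
the same. -/
lemma Explored.succ_insert (h : G.Explored x₀ t S ov m)
    (hne : ¬ (0 < m ∧ G.stepsFrom x₀ S m = x₀)) {y : Fin (2 * n)} (hym : G.stepsFrom x₀ S m = y)
    (hy : ¬ G.Met x₀ S m y) (hh : G.isHead y = true) :
    G.Explored x₀ t (insert y (insert (G.partner y) S)) ov (m + 1) := by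
  have hag : ∀ z, G.Met x₀ S m z → (z ∈ insert y (insert (G.partner y) S) ↔ z ∈ S) := by
    intro z hz
    have h1 : z ≠ y := fun e => hy (e ▸ hz)
    have h2 : z ≠ G.partner y := fun e => hy (by simpa [e, G.partner_partner] using hz.partner)
    simp [h1, h2]
  have hst := stepsFrom_congr hag
  have hmet := fun z => met_congr hag le_rfl z
  have hnr := h.no_return_succ hne
  refine ⟨isClosed_insert h.closed y, h.ov_partner, fun i hi => ?_, fun z hz => ?_, fun i hi => ?_,
    fun i hi => ?_, fun z hz => ?_⟩
  · rw [hst i (by omega)]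
    exact hnr i hi
  · rw [hmet, met_succ_iff, hym]
    simp only [Finset.mem_insert] at hz
    rcases hz with rfl | rfl | hz
    · exact Or.inr (Or.inl rfl)
    · exact Or.inr (Or.inr (G.partner_partner _).symm)
    · exact Or.inl (h.met z hz)
  · rw [hst i (by omega)]
    rcases Nat.lt_succ_iff_lt_or_eq.mp hi with hi | rfl
    · rw [hag _ ⟨i, hi, Or.inl rfl⟩]
      intro h1 h2
      obtain ⟨l, hl, e⟩ := h.head_first i hi h1 h2
      exact ⟨l, hl, by rw [hst l (by omega), e]⟩
    · intro _ h2
      rw [hym, hh] at h2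
      exact absurd h2 (by simp)
  · rw [hst i (by omega)]
    rcases Nat.lt_succ_iff_lt_or_eq.mp hi with hi | rfl
    · rw [hag _ ⟨i, hi, Or.inl rfl⟩]
      intro h1 h2
      exact h.ov_first i hi h1 fun l hl => by rw [← hst l (by omega)]; exact h2 l hl
    · intro h1
      exact absurd (by rw [hym]; exact Finset.mem_insert_self _ _) h1
  · exact h.fresh z fun hz' => hz ((hmet z).mpr hz'.succ)

open Classical in
/-- The sum of the weights of the ascending sets of arrows that agree with `S` as far as the
crossings met in `m` steps are concerned. -/
noncomputable def ascendingFrom (G : GaussDiagram n) (r : ℝ) (x₀ : Fin (2 * n))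
    (S : Finset (Fin (2 * n))) (m : ℕ) : ℝ :=
  ∑ S' : Finset (Fin (2 * n)) with (G.IsClosed S' ∧ G.Ascends S') ∧
    ∀ z, G.Met x₀ S m z → (z ∈ S' ↔ z ∈ S), G.realWeight r S'

lemma ascendingFrom_congr {S₁ S₂ : Finset (Fin (2 * n))} {m₁ m₂ : ℕ} (r : ℝ)
    (h : ∀ S', G.IsClosed S' → G.Ascends S' →
      ((∀ z, G.Met x₀ S₁ m₁ z → (z ∈ S' ↔ z ∈ S₁)) ↔ ∀ z, G.Met x₀ S₂ m₂ z → (z ∈ S' ↔ z ∈ S₂))) :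
    G.ascendingFrom r x₀ S₁ m₁ = G.ascendingFrom r x₀ S₂ m₂ := by
  classical
  unfold ascendingFrom
  refine Finset.sum_congr (Finset.filter_congr fun S' _ => and_congr_right fun hS' => ?_)
    fun _ _ => rfl
  exact h S' hS'.1 hS'.2

/-- If the path returns after all points were met, only one set remains. -/
lemma Explored.ascendingFrom_eq (h : G.Explored x₀ t S ov m) (hx₀ : x₀.val = 0)
    (hret : G.stepsFrom x₀ S m = x₀) (hall : ∀ z, ∃ i < m, G.stepsFrom x₀ S i = z) (r : ℝ) :
    G.ascendingFrom r x₀ S m = G.realWeight r S := by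
  classical
  unfold ascendingFrom
  rw [Finset.sum_eq_single_of_mem S]
  · simp only [Finset.mem_filter, Finset.mem_univ, true_and]
    exact ⟨⟨h.closed, h.ascends hx₀ hret hall⟩, fun _ _ => trivial⟩
  · intro S' hS' hne
    refine absurd (Finset.ext fun z => ?_) hne
    obtain ⟨i, hi, e⟩ := hall z
    exact (Finset.mem_filter.mp hS').2.2 z ⟨i, hi, Or.inl e⟩

/-- If the path returns before all points were met, no set remains. -/
lemma ascendingFrom_eq_zero (hx₀ : x₀.val = 0) (hm : 0 < m)
    (hret : G.stepsFrom x₀ S m = x₀) (hall : ¬ ∀ z, ∃ i < m, G.stepsFrom x₀ S i = z) (r : ℝ) :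
    G.ascendingFrom r x₀ S m = 0 := by
  classical
  unfold ascendingFrom
  refine Finset.sum_eq_zero fun S' hS' => absurd (fun z => ?_) hall
  obtain ⟨-, ⟨hc, ha⟩, hag⟩ := Finset.mem_filter.mp hS'
  have hst := stepsFrom_congr hag
  obtain ⟨k, hk⟩ := (ha.steps hc hx₀).1 z
  refine ⟨k % m, Nat.mod_lt _ hm, ?_⟩
  rw [← hst _ (Nat.mod_lt _ hm).le, ← hk]
  -- After its return the walk repeats itself and meets no further points, whereas an ascending set
  -- must reach all of them.
  have hper : Function.IsPeriodicPt (G.walk S') m x₀ := by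
    have := hst m le_rfl
    rw [hret] at this
    exact this
  exact hper.iterate_mod_apply k

section exploration

variable (G)
variable {Φ : Finset (Fin (2 * n)) → (Fin (2 * n) → Bool) → ℝ} {r c : ℝ}

/-- The exploration of a diagram: a function of configurations that satisfies a skein relation is a
sum over ascending sets of arrows. -/
lemma exploration (hx₀ : x₀.val = 0)
    (hskein : ∀ S ov y, G.IsClosed S → (∀ z, ov (G.partner z) = !ov z) → y ∉ S →
      G.isHead y = true → ov y = !t → Φ S ov = Φ S (G.changeAt ov y) +
        ((G.sign y : ℤˣ) : ℤ) * r * Φ (insert y (insert (G.partner y) S)) ov)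
    (hleaf : ∀ S ov m, G.Explored x₀ t S ov m → 0 < m → G.stepsFrom x₀ S m = x₀ →
      (∀ z, ∃ i < m, G.stepsFrom x₀ S i = z) → Φ S ov = c)
    (hzero : ∀ S ov m, G.Explored x₀ t S ov m → 0 < m → G.stepsFrom x₀ S m = x₀ →
      ¬ (∀ z, ∃ i < m, G.stepsFrom x₀ S i = z) → Φ S ov = 0) :
    ∀ k m S ov, G.Explored x₀ t S ov m → 2 * n - m ≤ k → G.realWeight r S * Φ S ov =
      c * G.ascendingFrom r x₀ S m := by
  have hret : ∀ m S ov, G.Explored x₀ t S ov m → 0 < m ∧ G.stepsFrom x₀ S m = x₀ →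
      G.realWeight r S * Φ S ov = c * G.ascendingFrom r x₀ S m := by
    rintro m S ov h ⟨hm, hr⟩
    by_cases hall : ∀ z, ∃ i < m, G.stepsFrom x₀ S i = z
    · rw [hleaf S ov m h hm hr hall, h.ascendingFrom_eq hx₀ hr hall, mul_comm]
    · rw [hzero S ov m h hm hr hall, ascendingFrom_eq_zero hx₀ hm hr hall, mul_zero, mul_zero]
  -- Induction on the number of steps that are left: without a return, at most `2 * n` steps are
  -- possible.
  intro k
  induction k with
  | zero =>
    intro m S ov h hk
    by_cases hne : 0 < m ∧ G.stepsFrom x₀ S m = x₀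
    · exact hret m S ov h hne
    · have := le_of_no_return h.closed (h.no_return_succ hne)
      omega
  | succ k ih =>
    intro m S ov h hk
    by_cases hne : 0 < m ∧ G.stepsFrom x₀ S m = x₀
    · exact hret m S ov h hne
    have hle := le_of_no_return h.closed (h.no_return_succ hne)
    have hinj := stepsFrom_injOn h.closed (h.no_return_succ hne)
    obtain ⟨y, hy⟩ : ∃ y, G.stepsFrom x₀ S m = y := ⟨_, rfl⟩
    by_cases hmet : G.Met x₀ S m y
    · obtain ⟨i, hi, e⟩ : ∃ i < m, G.stepsFrom x₀ S i = G.partner y := by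
        obtain ⟨i, hi, e | e⟩ := hmet
        · exact absurd (hinj i (by omega) m (by omega) (e.trans hy.symm)) (by omega)
        · exact ⟨i, hi, e⟩
      have h' := h.succ hne (fun _ _ => ⟨i, hi, by rw [e, hy]⟩)
        (fun _ hno => absurd (by rw [e, hy]) (hno i hi))
      rw [ih (m + 1) S ov h' (by omega)]
      congr 1
      refine ascendingFrom_congr r fun S' _ _ => forall_congr' fun z => ?_
      rw [met_succ_iff, hy]
      refine imp_congr_left ⟨fun hz => ?_, Or.inl⟩
      rcases hz with hz | rfl | rfl
      · exact hz
      · exact hmet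
      · simpa [G.partner_partner] using hmet.partner
    have hyS : y ∉ S := fun hyS => hmet (h.met y hyS)
    have hpyS : G.partner y ∉ S := fun h' => hyS ((h.closed y).mp h')
    have hpm : G.partner (G.partner y) = y := G.partner_partner y
    by_cases hh : G.isHead y = true
    -- At a head that is met first the passage has the wrong type. The skein relation splits the
    -- function just as the sum splits into the sets without and with this arrow.
    · have hovy : ov y = !t := by rw [h.fresh y hmet, if_pos hh]
      have h1 : G.Explored x₀ t S (G.changeAt ov y) (m + 1) := by
        subst hy
        exact h.succ_change hne hmet hovy
      have h2 := h.succ_insert hne hy hmet hh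
      have e1 := ih _ _ _ h1 (by omega)
      have e2 := ih _ _ _ h2 (by omega)
      rw [realWeight_insert r hh hyS] at e2
      have hag : ∀ z, G.Met x₀ S m z → (z ∈ insert y (insert (G.partner y) S) ↔ z ∈ S) := by
        intro z hz
        have h1 : z ≠ y := fun e => hmet (e ▸ hz)
        have h2 : z ≠ G.partner y := fun e => hmet (by simpa [e, hpm] using hz.partner)
        simp [h1, h2]
      have hM := fun z => met_congr hag le_rfl z
      have hsplit : G.ascendingFrom r x₀ S m = G.ascendingFrom r x₀ S (m + 1) +
          G.ascendingFrom r x₀ (insert y (insert (G.partner y) S)) (m + 1) := by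
        classical
        unfold ascendingFrom
        rw [← Finset.sum_filter_add_sum_filter_not _ (fun S' => y ∉ S'), Finset.filter_filter,
          Finset.filter_filter]
        congr 1
        · refine Finset.sum_congr (Finset.filter_congr fun S' _ => ?_) fun _ _ => rfl
          rw [and_assoc]
          refine and_congr_right fun hS' => ⟨fun hz z hz' => ?_, fun hz =>
            ⟨fun z hz' => hz z hz'.succ, ?_⟩⟩
          · rw [met_succ_iff, hy] at hz'
            rcases hz' with hz' | rfl | hz'
            · exact hz.1 z hz'
            · exact iff_of_false hz.2 hyS
            · obtain rfl : z = G.partner y := by rw [hz', G.partner_partner]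
              exact iff_of_false (fun h' => hz.2 ((hS'.1 y).mp h')) hpyS
          · exact fun h' => hyS ((hz y ⟨m, by omega, Or.inl hy⟩).mp h')
        · refine Finset.sum_congr (Finset.filter_congr fun S' _ => ?_) fun _ _ => rfl
          rw [and_assoc, not_not]
          simp only [hM]
          refine and_congr_right fun hS' => ⟨fun hz z hz' => ?_, fun hz =>
            ⟨fun z hz' => (hz z hz'.succ).trans (hag z hz'), ?_⟩⟩
          · rw [met_succ_iff, hy] at hz'
            rcases hz' with hz' | rfl | hz'
            · rw [hag z hz', hz.1 z hz']
            · exact iff_of_true hz.2 (by simp)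
            · obtain rfl : z = G.partner y := by rw [hz', G.partner_partner]
              exact iff_of_true ((hS'.1 y).mpr hz.2) (by simp)
          · exact (hz y ⟨m, by omega, Or.inl hy⟩).mpr (by simp)
      rw [hskein S ov y h.closed h.ov_partner hyS hh hovy, hsplit, mul_add, mul_add, e1, ← e2]
      ring
    -- At a tail that is met first the passage has the right type, and no ascending set contains
    -- this arrow, because its head would have to be met before.
    · have hovy : ov y = t := by rw [h.fresh y hmet, if_neg hh]
      have h' := h.succ hne (fun h1 _ => absurd (by rwa [hy] at h1) hyS) (fun _ _ => by rw [hy, hovy])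
      rw [ih (m + 1) S ov h' (by omega)]
      congr 1
      refine ascendingFrom_congr r fun S' hc ha => ⟨fun hz z hz' => hz z hz'.succ, fun hz => ?_⟩
      have hyS' : y ∉ S' := by
        intro hyS'
        obtain ⟨l, hl, e⟩ := (ha.steps hc hx₀).2 (G.partner y) ((hc y).mpr hyS')
          (by rw [G.isHead_partner]; simpa using hh) m
          (by rw [stepsFrom_congr hz m le_rfl, hy, hpm])
        rw [stepsFrom_congr hz l hl.le] at e
        exact hmet ⟨l, hl, Or.inr e⟩
      intro z hz'
      rw [met_succ_iff, hy] at hz'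
      rcases hz' with hz' | rfl | hz'
      · exact hz z hz'
      · exact iff_of_false hyS' hyS
      · obtain rfl : z = G.partner y := by rw [hz', G.partner_partner]
        exact iff_of_false (fun h' => hyS' ((hc y).mp h')) hpyS

end exploration

end GaussDiagram

/-! ### The Burau type determinant and its skein relation -/

/-- The skein relation for determinants: a linear relation for the determinants of three matrices
that differ in two rows. -/
lemma Matrix.det_skein {ι : Type*} [Fintype ι] [DecidableEq ι] (N : Matrix ι ι ℝ) {x y : ι}
    (hxy : x ≠ y) (u w A B : ι → ℝ) {τ : ℝ} (hτ : τ ≠ 0) :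
    ((N.updateRow x (u - A - (1 - τ) • B)).updateRow y (w - τ • B)).det -
      τ * ((N.updateRow x (u - τ⁻¹ • A)).updateRow y (w - B - (1 - τ⁻¹) • A)).det =
    (1 - τ) * ((N.updateRow x (u - B)).updateRow y (w - A)).det := by
  set D : (ι → ℝ) → (ι → ℝ) → ℝ := fun R R' => ((N.updateRow x R).updateRow y R').det with hD
  have comm : ∀ R R', D R R' = ((N.updateRow y R').updateRow x R).det := fun R R' => by
    simp only [hD]
    congr 1
    funext z
    by_cases h1 : z = y
    · subst h1
      rw [Matrix.updateRow_self, Matrix.updateRow_ne hxy.symm, Matrix.updateRow_self]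
    · rw [Matrix.updateRow_ne h1]
      by_cases h2 : z = x
      · subst h2
        rw [Matrix.updateRow_self, Matrix.updateRow_self]
      · rw [Matrix.updateRow_ne h2, Matrix.updateRow_ne h2, Matrix.updateRow_ne h1]
  have al : ∀ R R₁ R', D (R + R₁) R' = D R R' + D R₁ R' := fun R R₁ R' => by
    simp only [comm, Matrix.det_updateRow_add]
  have sl : ∀ (c : ℝ) R R', D (c • R) R' = c * D R R' := fun c R R' => by
    simp only [comm, Matrix.det_updateRow_smul]
  have ar : ∀ R R' R₁, D R (R' + R₁) = D R R' + D R R₁ := fun R R₁ R' => by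
    simp only [hD, Matrix.det_updateRow_add]
  have sr : ∀ (c : ℝ) R R', D R (c • R') = c * D R R' := fun c R R' => by
    simp only [hD, Matrix.det_updateRow_smul]
  have self : ∀ R, D R R = 0 := fun R => by
    refine Matrix.det_zero_of_row_eq hxy ?_
    rw [Matrix.updateRow_ne hxy, Matrix.updateRow_self, Matrix.updateRow_self]
  -- The determinant is bilinear and alternating in the two rows; the rest is the expansion of both
  -- sides.
  have swap : D A B = -D B A := by
    have := self (A + B)
    rw [al, ar, ar, self, self] at this
    linarith
  change D _ _ - τ * D _ _ = (1 - τ) * D _ _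
  have sub : ∀ R R' : ι → ℝ, R - R' = R + (-1 : ℝ) • R' := fun R R' => by
    rw [neg_one_smul, sub_eq_add_neg]
  simp only [sub, al, sl, ar, sr, self, swap]
  field_simp
  ring

namespace GaussDiagram

variable {n : ℕ} (G : GaussDiagram n) (q : ℝ) (x₀ : Fin (2 * n))

/-- The weight of going on along the circle. -/
noncomputable def goWeight (S : Finset (Fin (2 * n))) (ov : Fin (2 * n) → Bool) (z : Fin (2 * n)) : ℝ :=
  if z ∈ S then 0 else if ov z = true then 1 else q ^ (-2 * G.flatSign z)

/-- The weight of changing the strand at a crossing. -/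
noncomputable def turnWeight (S : Finset (Fin (2 * n))) (ov : Fin (2 * n) → Bool)
    (z : Fin (2 * n)) : ℝ :=
  if z ∈ S then 1 else if ov z = true then 1 - q ^ (2 * G.flatSign z) else 0

variable {n : ℕ} in
/-- The unit vector at `j`, without its entry at `x₀`. -/
def unitAway (x₀ j : Fin (2 * n)) : Fin (2 * n) → ℝ :=
  fun k => if k = x₀ then 0 else if j = k then 1 else 0

/-- The Burau type matrix of a diagram whose crossings are passed in the way `ov`, with the arrows in
`S` smoothed. -/
noncomputable def burau (S : Finset (Fin (2 * n))) (ov : Fin (2 * n) → Bool) :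
    Matrix (Fin (2 * n)) (Fin (2 * n)) ℝ := fun z =>
  Pi.single z 1 - G.goWeight q S ov z • unitAway x₀ (finRotate (2 * n) z) -
    G.turnWeight q S ov z • unitAway x₀ (finRotate (2 * n) (G.partner z))

/-- The normalizing factor. -/
noncomputable def overFactor (S : Finset (Fin (2 * n))) (ov : Fin (2 * n) → Bool) : ℝ :=
  ∏ z, if z ∉ S ∧ ov z = true then q ^ (-G.flatSign z) else 1

/-- The normalized determinant of the Burau type matrix. -/
noncomputable def burauDet (S : Finset (Fin (2 * n))) (ov : Fin (2 * n) → Bool) : ℝ :=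
  G.overFactor q S ov * (G.burau q x₀ S ov).det

variable {G q x₀} {S : Finset (Fin (2 * n))} {ov : Fin (2 * n) → Bool}

lemma prod_eq_mul_partner {M : Type*} [CommMonoid M] (f : Fin (2 * n) → M) (x : Fin (2 * n)) :
    ∏ z, f z = f x * f (G.partner x) *
      ∏ z ∈ (Finset.univ.erase x).erase (G.partner x), f z := by
  rw [mul_assoc, Finset.mul_prod_erase _ _ (by simp [G.partner_ne]),
    Finset.mul_prod_erase _ _ (Finset.mem_univ _)]

/-- The matrices of the three diagrams differ only in the two rows of the crossing, as in
`Matrix.det_skein` with the two outgoing edges as `A` and `B`. The normalizing factors turn `1` and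
`τ = q ^ (2 * χ)` into the symmetric coefficients. -/
lemma burauDet_skein (hq : 0 < q) (hov : ∀ z, ov (G.partner z) = !ov z) (hS : G.IsClosed S)
    {x : Fin (2 * n)} (hx : x ∉ S) (hx' : ov x = true) :
    G.burauDet q x₀ S ov - G.burauDet q x₀ S (G.changeAt ov x) =
      (q ^ (-G.flatSign x) - q ^ G.flatSign x) *
        G.burauDet q x₀ (insert x (insert (G.partner x) S)) ov := by
  have hpx : G.partner x ∉ S := fun h => hx ((hS x).mp h)
  have hpx' : ov (G.partner x) = false := by rw [hov, hx']; rfl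
  have hne : x ≠ G.partner x := (G.partner_ne x).symm
  have hpp := G.partner_partner x
  set χ := G.flatSign x with hχ
  have hχ' : G.flatSign (G.partner x) = -χ := G.flatSign_partner x
  set σ := finRotate (2 * n)
  set τ : ℝ := q ^ (2 * χ) with hτ
  have hτ0 : τ ≠ 0 := by positivity
  have hτi : q ^ (-2 * χ) = τ⁻¹ := by rw [hτ, ← zpow_neg]; ring_nf
  set N := G.burau q x₀ S ov with hN
  have hskein := Matrix.det_skein N hne (Pi.single x 1) (Pi.single (G.partner x) 1)
    (unitAway x₀ (σ x)) (unitAway x₀ (σ (G.partner x))) hτ0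
  have e1 : G.burau q x₀ S ov = (N.updateRow x (Pi.single x 1 - unitAway x₀ (σ x) -
      (1 - τ) • unitAway x₀ (σ (G.partner x)))).updateRow (G.partner x)
      (Pi.single (G.partner x) 1 - τ • unitAway x₀ (σ (G.partner x))) := by
    funext z
    by_cases h1 : z = G.partner x
    · subst h1
      rw [Matrix.updateRow_self, burau, goWeight, if_neg hpx, hpx', if_neg (by simp), hχ', turnWeight,
        if_neg hpx, hpx', if_neg (by simp), zero_smul, sub_zero,
        show -2 * -χ = 2 * χ by ring]
    by_cases h2 : z = x
    · subst h2
      rw [Matrix.updateRow_ne h1, Matrix.updateRow_self, burau, goWeight, if_neg hx, hx', if_pos rfl,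
        turnWeight, if_neg hx, hx', if_pos rfl, one_smul]
    · rw [Matrix.updateRow_ne h1, Matrix.updateRow_ne h2, hN]
  have e2 : G.burau q x₀ S (G.changeAt ov x) = (N.updateRow x (Pi.single x 1 -
      τ⁻¹ • unitAway x₀ (σ x))).updateRow (G.partner x)
      (Pi.single (G.partner x) 1 - unitAway x₀ (σ (G.partner x)) - (1 - τ⁻¹) • unitAway x₀ (σ x)) := by
    have c1 : G.changeAt ov x x = false := by simp [changeAt, hx']
    have c2 : G.changeAt ov x (G.partner x) = true := by simp [changeAt, hpx']
    funext z
    by_cases h1 : z = G.partner x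
    · subst h1
      rw [Matrix.updateRow_self, burau, goWeight, if_neg hpx, c2, if_pos rfl, turnWeight,
        if_neg hpx, c2, if_pos rfl, one_smul, hχ', show 2 * -χ = -2 * χ by ring, hτi, hpp]
    by_cases h2 : z = x
    · subst h2
      rw [Matrix.updateRow_ne h1, Matrix.updateRow_self, burau, goWeight, if_neg hx, c1,
        if_neg (by simp), turnWeight, if_neg hx, c1, if_neg (by simp), zero_smul, sub_zero, hτi]
    · have c3 : G.changeAt ov x z = ov z := by simp [changeAt, h1, h2]
      rw [Matrix.updateRow_ne h1, Matrix.updateRow_ne h2, hN]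
      simp only [burau, goWeight, turnWeight, c3]
  have e3 : G.burau q x₀ (insert x (insert (G.partner x) S)) ov = (N.updateRow x (Pi.single x 1 -
      unitAway x₀ (σ (G.partner x)))).updateRow (G.partner x)
      (Pi.single (G.partner x) 1 - unitAway x₀ (σ x)) := by
    funext z
    by_cases h1 : z = G.partner x
    · subst h1
      rw [Matrix.updateRow_self, burau, goWeight, if_pos (by simp), zero_smul, sub_zero, turnWeight,
        if_pos (by simp), one_smul, hpp]
    by_cases h2 : z = x
    · subst h2
      rw [Matrix.updateRow_ne h1, Matrix.updateRow_self, burau, goWeight, if_pos (by simp), zero_smul,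
        sub_zero, turnWeight, if_pos (by simp), one_smul]
    · rw [Matrix.updateRow_ne h1, Matrix.updateRow_ne h2, hN]
      simp only [burau, goWeight, turnWeight, Finset.mem_insert, h1, h2, false_or]
  rw [← e1, ← e2, ← e3] at hskein
  have g2 : ∏ z ∈ (Finset.univ.erase x).erase (G.partner x),
      (if z ∉ S ∧ G.changeAt ov x z = true then q ^ (-G.flatSign z) else 1) =
      ∏ z ∈ (Finset.univ.erase x).erase (G.partner x),
        if z ∉ S ∧ ov z = true then q ^ (-G.flatSign z) else 1 := by
    refine Finset.prod_congr rfl fun z hz => ?_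
    simp only [Finset.mem_erase, Finset.mem_univ, and_true] at hz
    simp only [changeAt, hz.1, hz.2, or_self, if_false]
  have g3 : ∏ z ∈ (Finset.univ.erase x).erase (G.partner x),
      (if z ∉ insert x (insert (G.partner x) S) ∧ ov z = true then q ^ (-G.flatSign z) else 1) =
      ∏ z ∈ (Finset.univ.erase x).erase (G.partner x),
        if z ∉ S ∧ ov z = true then q ^ (-G.flatSign z) else 1 := by
    refine Finset.prod_congr rfl fun z hz => ?_
    simp only [Finset.mem_erase, Finset.mem_univ, and_true] at hz
    simp only [Finset.mem_insert, hz.1, hz.2, false_or]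
  set F := ∏ z ∈ (Finset.univ.erase x).erase (G.partner x),
        if z ∉ S ∧ ov z = true then q ^ (-G.flatSign z) else 1
  have f1 : G.overFactor q S ov = q ^ (-χ) * F := by
    rw [overFactor, G.prod_eq_mul_partner _ x]
    simp [hx, hx', hpx', ← hχ, F]
  have f2 : G.overFactor q S (G.changeAt ov x) = q ^ χ * F := by
    rw [overFactor, G.prod_eq_mul_partner _ x, g2]
    simp [changeAt, hpx, hx', hpx', hχ']
  have f3 : G.overFactor q (insert x (insert (G.partner x) S)) ov = F := by
    rw [overFactor, G.prod_eq_mul_partner _ x, g3]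
    simp
  rw [burauDet, burauDet, burauDet, f1, f2, f3]
  have hs : τ = q ^ χ * q ^ χ := by rw [hτ, two_mul, zpow_add₀ hq.ne']
  have hs' : q ^ (-χ) = (q ^ χ)⁻¹ := zpow_neg _ _
  have hs0 : q ^ χ ≠ 0 := by positivity
  rw [hs] at hskein
  rw [hs']
  field_simp
  linear_combination F * hskein

end GaussDiagram

/-! ### The determinants at the leaves of the skein tree -/

namespace GaussDiagram

variable {n : ℕ} {G : GaussDiagram n} {q : ℝ} {x₀ : Fin (2 * n)} {S : Finset (Fin (2 * n))}
  {ov : Fin (2 * n) → Bool}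

/-- The points are numbered in the order in which they are met on the way along the circle with the
arrows in `S` smoothed. -/
structure IsNumbering (G : GaussDiagram n) (x₀ : Fin (2 * n)) (S : Finset (Fin (2 * n)))
    (pos : Equiv.Perm (Fin (2 * n))) : Prop where
  base : pos x₀ = x₀
  walk : ∀ z, pos (G.walk S z) = finRotate (2 * n) (pos z)

/-- Each point is numbered by the time of its visit. As all points are met before the return, the
length of the walk is `2 * n`. -/
lemma Explored.exists_numbering {t : Bool} {m : ℕ} (h : G.Explored x₀ t S ov m) (hx₀ : x₀.val = 0)
    (hret : G.stepsFrom x₀ S m = x₀) (hall : ∀ z, ∃ i < m, G.stepsFrom x₀ S i = z) :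
    ∃ pos, G.IsNumbering x₀ S pos ∧
      ∀ z ∉ S, (ov z = t ↔ (pos z).val < (pos (G.partner z)).val) := by
  have hm : m ≤ 2 * n := le_of_no_return h.closed h.no_return
  choose f hf1 hf2 using hall
  have huniq : ∀ {i z}, i < m → G.stepsFrom x₀ S i = z → f z = i := fun hi hz =>
    stepsFrom_injOn h.closed h.no_return _ (hf1 _) _ hi ((hf2 _).trans hz.symm)
  have hinj : Function.Injective f := fun a b e => by rw [← hf2 a, e, hf2 b]
  have hm' : 2 * n ≤ m := by
    have := Fintype.card_le_of_injective (fun z => (⟨f z, hf1 z⟩ : Fin m))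
      fun a b e => hinj (Fin.mk.inj e)
    simpa using this
  obtain rfl : m = 2 * n := le_antisymm hm hm'
  have hinj' : Function.Injective fun z => (⟨f z, hf1 z⟩ : Fin (2 * n)) :=
    fun a b e => hinj (Fin.mk.inj e)
  refine ⟨Equiv.ofBijective _ (Finite.injective_iff_bijective.mp hinj'), ⟨?_, fun z => ?_⟩,
    fun z hz => ?_⟩
  · refine Fin.ext ?_
    change f x₀ = x₀.val
    rw [hx₀]
    exact huniq (by have := x₀.isLt; omega) rfl
  · refine Fin.ext ?_
    change f (G.walk S z) = _
    have hs : G.stepsFrom x₀ S (f z + 1) = G.walk S z := by rw [stepsFrom_succ, hf2]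
    rw [finRotate_val]
    change _ = if f z + 1 = 2 * n then 0 else f z + 1
    have hlt := hf1 z
    split_ifs with h'
    · rw [h', hret] at hs
      exact huniq (by omega) hs
    · exact huniq (by omega) hs
  · change _ ↔ f z < f (G.partner z)
    have hfirst : ∀ u ∉ S, f u < f (G.partner u) → ov u = t := by
      intro u hu hlt
      have := h.ov_first (f u) (hf1 u) (by rwa [hf2])
      rw [hf2] at this
      exact this fun l hl e => by
        have := huniq (by have := hf1 u; omega) e
        omega
    refine ⟨fun ht => ?_, hfirst z hz⟩
    by_contra hle
    have hne : f z ≠ f (G.partner z) := fun e => G.partner_ne z (hinj e).symm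
    have := hfirst (G.partner z) (fun h' => hz ((h.closed z).mp h'))
      (by rw [G.partner_partner]; omega)
    rw [h.ov_partner, ht] at this
    cases t <;> simp at this

lemma burau_apply (z j : Fin (2 * n)) : G.burau q x₀ S ov z j = (if z = j then 1 else 0) -
    (if j = x₀ then 0 else (if finRotate (2 * n) z = j then G.goWeight q S ov z else 0) +
      if finRotate (2 * n) (G.partner z) = j then G.turnWeight q S ov z else 0) := by
  simp only [burau, unitAway, Pi.sub_apply, Pi.smul_apply, Pi.single_apply, smul_eq_mul, @eq_comm _ j z]
  split_ifs <;> ring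

/-- The edge that leaves `z` is reached by going on at `z` or by turning at the partner of `z`. -/
lemma goWeight_add_turnWeight (hov : ∀ z, ov (G.partner z) = !ov z) (hS : G.IsClosed S)
    (z : Fin (2 * n)) : G.goWeight q S ov z + G.turnWeight q S ov (G.partner z) = 1 := by
  simp only [goWeight, turnWeight, hS z, hov, flatSign_partner]
  by_cases h : z ∈ S
  · simp [h]
  · cases ov z <;> simp [h]

/-- The sum of the column of `j` of the transition weights is `1`. -/
lemma sum_weights (hov : ∀ z, ov (G.partner z) = !ov z) (hS : G.IsClosed S) (j : Fin (2 * n)) :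
    ∑ z, ((if finRotate (2 * n) z = j then G.goWeight q S ov z else 0) +
      if finRotate (2 * n) (G.partner z) = j then G.turnWeight q S ov z else 0) = 1 := by
  rw [Finset.sum_add_distrib]
  have : ∑ z, (if finRotate (2 * n) (G.partner z) = j then G.turnWeight q S ov z else 0) =
      ∑ z, if finRotate (2 * n) z = j then G.turnWeight q S ov (G.partner z) else 0 := by
    rw [← G.sum_partner]
    simp only [G.partner_partner]
  rw [this, ← Finset.sum_add_distrib]
  simp only [← Equiv.eq_symm_apply]
  rw [Finset.sum_eq_single_of_mem ((finRotate (2 * n)).symm j) (Finset.mem_univ _)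
    (fun b _ hb => by rw [if_neg hb, if_neg hb, add_zero]), if_pos rfl, if_pos rfl,
    goWeight_add_turnWeight hov hS]

lemma sum_burau (hov : ∀ z, ov (G.partner z) = !ov z) (hS : G.IsClosed S) {j : Fin (2 * n)}
    (hj : j ≠ x₀) : ∑ z, G.burau q x₀ S ov z j = 0 := by
  simp only [burau_apply, if_neg hj]
  rw [Finset.sum_sub_distrib, sum_weights hov hS]
  simp

/-- If the part that is not reached is left nowhere, and the weights have a right eigenvector, then
the determinant vanishes. -/
lemma det_burau_eq_zero_of_forall_notMem (V : Fin (2 * n) → Prop) (hx₀ : V x₀)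
    (hne : ∃ z, ¬ V z)
    (hgo : ∀ z, ¬ V z → G.goWeight q S ov z ≠ 0 → ¬ V (finRotate (2 * n) z))
    (hturn : ∀ z, ¬ V z → G.turnWeight q S ov z ≠ 0 → ¬ V (finRotate (2 * n) (G.partner z)))
    {v : Fin (2 * n) → ℝ} (hv : ∀ z, v z ≠ 0)
    (hvM : ∀ z, G.goWeight q S ov z * v (finRotate (2 * n) z) +
      G.turnWeight q S ov z * v (finRotate (2 * n) (G.partner z)) = v z) :
    (G.burau q x₀ S ov).det = 0 := by
  classical
  have hzero : ∀ z, ¬ V z → ∀ j, V j → G.burau q x₀ S ov z j = 0 := by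
    intro z hz j hj
    rw [burau_apply, if_neg (fun e : z = j => hz (e ▸ hj))]
    by_cases h1 : j = x₀
    · rw [if_pos h1, sub_zero]
    rw [if_neg h1]
    have h2 : (if finRotate (2 * n) z = j then G.goWeight q S ov z else 0) = 0 := by
      split_ifs with e
      · by_contra h
        exact hgo z hz h (e ▸ hj)
      · rfl
    have h3 : (if finRotate (2 * n) (G.partner z) = j then G.turnWeight q S ov z else 0) = 0 := by
      split_ifs with e
      · by_contra h
        exact hturn z hz h (e ▸ hj)
      · rfl
    rw [h2, h3]
    ring
  -- The matrix is block triangular, and `v` spoils the invertibility of the block of the points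
  -- that are not reached.
  rw [Matrix.twoBlockTriangular_det _ V hzero]
  refine mul_eq_zero_of_right _ (Matrix.exists_mulVec_eq_zero_iff.mp
    ⟨fun z => v z, fun h => ?_, funext fun z => ?_⟩)
  · obtain ⟨z, hz⟩ := hne
    exact hv z (congrFun h ⟨z, hz⟩)
  · obtain ⟨z, hz⟩ := z
    change ∑ j : {j // ¬ V j}, G.burau q x₀ S ov z j * v j = 0
    rw [← Finset.sum_subtype (Finset.univ.filter fun j => ¬ V j) (by simp)
      (fun j => G.burau q x₀ S ov z j * v j), Finset.sum_filter_of_ne (p := fun j => ¬ V j) (fun j _ hj hV => hj (by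
        rw [hzero z hz j hV, zero_mul]))]
    have key : ∀ j, G.burau q x₀ S ov z j * v j = (if z = j then v j else 0) -
        ((if finRotate (2 * n) z = j then G.goWeight q S ov z * v j else 0) +
          if finRotate (2 * n) (G.partner z) = j then G.turnWeight q S ov z * v j else 0) := by
      intro j
      rw [burau_apply]
      by_cases h1 : j = x₀
      · subst h1
        have h2 : (if finRotate (2 * n) z = j then G.goWeight q S ov z * v j else 0) = 0 := by
          split_ifs with e
          · by_contra h
            exact hgo z hz (left_ne_zero_of_mul h) (e ▸ hx₀)
          · rfl
        have h3 : (if finRotate (2 * n) (G.partner z) = j then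
            G.turnWeight q S ov z * v j else 0) = 0 := by
          split_ifs with e
          · by_contra h
            exact hturn z hz (left_ne_zero_of_mul h) (e ▸ hx₀)
          · rfl
        rw [h2, h3, if_pos rfl]
        split_ifs <;> ring
      · rw [if_neg h1]
        split_ifs <;> ring
    simp only [key, Finset.sum_sub_distrib, Finset.sum_add_distrib, Finset.sum_ite_eq,
      Finset.mem_univ, if_true]
    rw [hvM z, sub_self]

/-- If the part that is reached is not left, then the determinant vanishes, unless all is reached. -/
lemma det_burau_eq_zero_of_forall_mem (hov : ∀ z, ov (G.partner z) = !ov z) (hS : G.IsClosed S)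
    (V : Fin (2 * n) → Prop) (hx₀ : V x₀) (hne : ∃ z, ¬ V z)
    (hgo : ∀ z, V z → G.goWeight q S ov z ≠ 0 → V (finRotate (2 * n) z))
    (hturn : ∀ z, V z → G.turnWeight q S ov z ≠ 0 → V (finRotate (2 * n) (G.partner z))) :
    (G.burau q x₀ S ov).det = 0 := by
  classical
  have hzero : ∀ z, V z → ∀ j, ¬ V j → G.burau q x₀ S ov z j = 0 := by
    intro z hz j hj
    rw [burau_apply, if_neg (fun e : z = j => hj (e ▸ hz)),
      if_neg (fun e : j = x₀ => hj (e ▸ hx₀))]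
    have h2 : (if finRotate (2 * n) z = j then G.goWeight q S ov z else 0) = 0 := by
      split_ifs with e
      · by_contra h
        exact hj (e ▸ hgo z hz h)
      · rfl
    have h3 : (if finRotate (2 * n) (G.partner z) = j then G.turnWeight q S ov z else 0) = 0 := by
      split_ifs with e
      · by_contra h
        exact hj (e ▸ hturn z hz h)
      · rfl
    rw [h2, h3]
    ring
  -- Here the block of the points that are not reached has vanishing column sums.
  rw [Matrix.twoBlockTriangular_det' _ V hzero]
  refine mul_eq_zero_of_right _ (Matrix.exists_vecMul_eq_zero_iff.mp
    ⟨fun z => 1, fun h => ?_, funext fun j => ?_⟩)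
  · obtain ⟨z, hz⟩ := hne
    exact one_ne_zero (congrFun h ⟨z, hz⟩)
  · obtain ⟨j, hj⟩ := j
    change ∑ z : {z // ¬ V z}, 1 * G.burau q x₀ S ov z j = 0
    simp only [one_mul]
    rw [← Finset.sum_subtype (Finset.univ.filter fun z => ¬ V z) (by simp)
      (fun z => G.burau q x₀ S ov z j), Finset.sum_filter_of_ne (p := fun z => ¬ V z) (fun z _ hz hV => hz
        (hzero z hV j hj))]
    exact sum_burau hov hS fun e => hj (e ▸ hx₀)

section leaves

variable {pos : Equiv.Perm (Fin (2 * n))}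

lemma IsNumbering.pos_walk (hp : G.IsNumbering x₀ S pos) (hx₀ : x₀.val = 0) {z : Fin (2 * n)}
    (hz : G.walk S z ≠ x₀) : (pos (G.walk S z)).val = (pos z).val + 1 := by
  rw [hp.walk]
  refine finRotate_val_of_ne_zero fun h => hz (pos.injective ?_)
  rw [hp.walk, hp.base]
  exact Fin.ext (h.trans hx₀.symm)

lemma walk_of_notMem {z : Fin (2 * n)} (hz : z ∉ S) : G.walk S z = finRotate (2 * n) z := by
  rw [ArrowDiagram.walk, ArrowDiagram.jump, if_neg hz]

lemma walk_of_mem' {z : Fin (2 * n)} (hz : z ∈ S) :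
    G.walk S z = finRotate (2 * n) (G.partner z) := by
  rw [ArrowDiagram.walk, ArrowDiagram.jump, if_pos hz]

/-- If all crossings are passed over first, the determinant is `1`. -/
lemma IsNumbering.det_burau_over (hp : G.IsNumbering x₀ S pos) (hx₀ : x₀.val = 0)
    (hS : G.IsClosed S)
    (hov : ∀ z ∉ S, ov z = true → (pos z).val < (pos (G.partner z)).val) :
    (G.burau q x₀ S ov).det = 1 := by
  -- Every transition of nonzero weight, apart from those to the base point, leads to a later point.
  -- In the order of the walk the matrix is upper triangular with diagonal entries `1`.
  have key : ∀ z j, (pos j).val ≤ (pos z).val → G.burau q x₀ S ov z j = if z = j then 1 else 0 := by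
    intro z j hle
    rw [burau_apply]
    by_cases h1 : j = x₀
    · rw [if_pos h1, sub_zero]
    rw [if_neg h1]
    have hwalk : ∀ u, G.walk S u = j → (pos z).val ≤ (pos u).val → False := by
      intro u hu hle'
      have := hp.pos_walk hx₀ (z := u) (by rwa [hu])
      rw [hu] at this
      omega
    have h2 : (if finRotate (2 * n) z = j then G.goWeight q S ov z else 0) = 0 := by
      split_ifs with e
      · rw [goWeight]
        by_cases hz : z ∈ S
        · rw [if_pos hz]
        · exact (hwalk z (by rw [walk_of_notMem hz, e]) le_rfl).elim
      · rfl
    have h3 : (if finRotate (2 * n) (G.partner z) = j then G.turnWeight q S ov z else 0) = 0 := by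
      split_ifs with e
      · rw [turnWeight]
        by_cases hz : z ∈ S
        · exact (hwalk z (by rw [walk_of_mem' hz, e]) le_rfl).elim
        · rw [if_neg hz]
          by_cases ho : ov z = true
          · exact (hwalk (G.partner z) (by rw [walk_of_notMem (fun h => hz ((hS z).mp h)), e])
              (hov z hz ho).le).elim
          · rw [if_neg ho]
      · rfl
    rw [h2, h3]
    ring
  rw [← Matrix.det_submatrix_equiv_self pos.symm, Matrix.det_of_isUpperTriangular]
  · refine Finset.prod_eq_one fun i _ => ?_
    rw [Matrix.submatrix_apply, key _ _ le_rfl, if_pos rfl]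
  · intro i j hij
    rw [Matrix.submatrix_apply, key _ _ (by simpa using le_of_lt hij), if_neg]
    exact fun e => hij.ne' (pos.symm.injective e)

/-- If all crossings are passed under first, the determinant is a power of the parameter. -/
lemma IsNumbering.det_burau_under (hp : G.IsNumbering x₀ S pos) (hx₀ : x₀.val = 0)
    (hS : G.IsClosed S) (hov' : ∀ z, ov (G.partner z) = !ov z)
    (hov : ∀ z ∉ S, ov z = true → (pos (G.partner z)).val < (pos z).val) :
    (G.burau q x₀ S ov).det =
      ∏ z, if z ∉ S ∧ ov z = false then q ^ (-2 * G.flatSign z) else 1 := by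
  set σ := finRotate (2 * n) with hσ
  -- This is the matrix with the transitions to the base point retained. All its columns have sum
  -- zero, so it is singular.
  set L : Matrix (Fin (2 * n)) (Fin (2 * n)) ℝ := fun z j => (if z = j then 1 else 0) -
    ((if σ z = j then G.goWeight q S ov z else 0) +
      if σ (G.partner z) = j then G.turnWeight q S ov z else 0) with hL
  have hLdet : L.det = 0 := by
    refine Matrix.exists_vecMul_eq_zero_iff.mp ⟨fun _ => 1, fun h => one_ne_zero (congrFun h x₀),
      funext fun j => ?_⟩
    change ∑ z, 1 * L z j = 0
    simp only [one_mul, hL]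
    rw [Finset.sum_sub_distrib, sum_weights hov' hS]
    simp
  set c : Fin (2 * n) → ℝ := fun z => L z x₀ with hc
  have h1 : L.updateCol x₀ (Pi.single x₀ 1) = G.burau q x₀ S ov := by
    funext z j
    rw [Matrix.updateCol_apply, burau_apply]
    by_cases hj : j = x₀
    · subst hj
      rw [if_pos rfl, if_pos rfl, Pi.single_apply, sub_zero]
    · rw [if_neg hj, if_neg hj]
  -- In the column of `x₀` the matrix `burau` keeps only the diagonal `1`, and `P` keeps only the
  -- transitions. By linearity in this column, their determinants are opposite.
  have h2 : (L.updateCol x₀ (c + (-1 : ℝ) • Pi.single x₀ 1)).det = -(G.burau q x₀ S ov).det := by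
    rw [Matrix.det_updateCol_add, Matrix.det_updateCol_smul, h1]
    have : L.updateCol x₀ c = L := Matrix.updateCol_eq_self L x₀
    rw [this, hLdet]
    ring
  set P := L.updateCol x₀ (c + (-1 : ℝ) • Pi.single x₀ 1) with hP
  have hPapp : ∀ z j, P z j = (if z = j ∧ j ≠ x₀ then 1 else 0) -
    ((if σ z = j then G.goWeight q S ov z else 0) +
      if σ (G.partner z) = j then G.turnWeight q S ov z else 0) := by
    intro z j
    rw [hP, Matrix.updateCol_apply]
    by_cases hj : j = x₀
    · subst hj
      simp only [hc, hL, Pi.add_apply, Pi.smul_apply, Pi.single_apply, smul_eq_mul]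
      simp only [if_true, ne_eq, not_true_eq_false, and_false, if_false]
      split_ifs <;> ring
    · simp [hj, hL]
  -- entries of `P` on and above the shifted diagonal
  have key : ∀ z u, (pos z).val ≤ (pos u).val → P z (G.walk S u) =
      if z = u then -(if z ∈ S then 1 else G.goWeight q S ov z) else 0 := by
    intro z u hle
    have hinj := (ArrowDiagram.walk_bijective hS).injective
    have hid : ¬ (z = G.walk S u ∧ G.walk S u ≠ x₀) := by
      rintro ⟨e1, e2⟩
      have := hp.pos_walk hx₀ e2
      rw [← e1] at this
      omega
    rw [hPapp, if_neg hid]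
    by_cases hz : z ∈ S
    · have hg : G.goWeight q S ov z = 0 := by rw [goWeight, if_pos hz]
      have ht : G.turnWeight q S ov z = 1 := by rw [turnWeight, if_pos hz]
      rw [hg, ht, ← walk_of_mem' hz, if_pos hz]
      simp only [hinj.eq_iff]
      split_ifs <;> ring
    · have hpz : G.partner z ∉ S := fun h => hz ((hS z).mp h)
      have ht : (if σ (G.partner z) = G.walk S u then G.turnWeight q S ov z else 0) = 0 := by
        split_ifs with e
        · rw [hσ, ← walk_of_notMem hpz, hinj.eq_iff] at e
          rw [turnWeight, if_neg hz, if_neg]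
          intro ho
          have := hov z hz ho
          rw [e] at this
          omega
        · rfl
      rw [ht, ← walk_of_notMem (G := G) hz, if_neg hz]
      simp only [hinj.eq_iff]
      split_ifs <;> ring
  have hwalk : ∀ k, pos.symm (σ k) = G.walk S (pos.symm k) := by
    intro k
    rw [Equiv.symm_apply_eq, hp.walk, Equiv.apply_symm_apply]
  have hn : 0 < 2 * n := by have := x₀.isLt; omega
  -- The rotation is a cycle of even length, so shifting the columns compensates the sign in `h2`.
  have hsign : Equiv.Perm.sign σ = -1 := by
    rw [hσ, sign_finRotate]
    exact Odd.neg_one_pow ⟨n - 1, by omega⟩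
  have h3 : ((P.submatrix pos.symm pos.symm).submatrix id σ).det = (G.burau q x₀ S ov).det := by
    rw [Matrix.det_permute', Matrix.det_submatrix_equiv_self, h2, hsign]
    simp
  -- In the order of the walk, and with the columns shifted by one, the steps of the walk form the
  -- diagonal. If each crossing is passed under first, all turns lead back, below the diagonal.
  rw [← h3, Matrix.det_of_isLowerTriangular]
  · simp only [Matrix.submatrix_apply, id, hwalk]
    rw [Equiv.prod_comp pos.symm fun z => P z (G.walk S z)]
    have : ∀ z, P z (G.walk S z) =
        (-1) * (if z ∉ S ∧ ov z = false then q ^ (-2 * G.flatSign z) else 1) := by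
      intro z
      rw [key z z le_rfl, if_pos rfl, goWeight]
      by_cases hz : z ∈ S
      · simp [hz]
      · cases ov z <;> simp [hz]
    simp only [this]
    rw [Finset.prod_mul_distrib, Finset.prod_const, Finset.card_univ, Fintype.card_fin, pow_mul]
    simp
  · intro i k hik
    have hik' : i < k := hik
    rw [Matrix.submatrix_apply, Matrix.submatrix_apply, hwalk, id, key _ _ (by simpa using hik'.le),
      if_neg (fun e => hik'.ne (pos.symm.injective e))]

end leaves

end GaussDiagram

/-! ### The signs at first passages do not depend on the smoothed arrows -/

/-- The rearrangement of the numbers in which the blocks `(a, b]`, `(b, c]`, `(c, d]` are put into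
the reverse order. -/
def reverseBlocks (a b c d i : ℕ) : ℕ :=
  if i ≤ a then i else if i ≤ b then i + d - b else if i ≤ c then i + a + d - b - c
    else if i ≤ d then i + a - c else i

section reverseBlocks

variable {a b c d i : ℕ}

lemma reverseBlocks_of_le (h : i ≤ a) : reverseBlocks a b c d i = i := if_pos h

lemma reverseBlocks_of_gt (h : d < i) (hab : a < b) (hbc : b < c) (hcd : c < d) :
    reverseBlocks a b c d i = i := by
  rw [reverseBlocks, if_neg (by omega), if_neg (by omega), if_neg (by omega), if_neg (by omega)]

lemma reverseBlocks_first (h : a < i) (h' : i ≤ b) : reverseBlocks a b c d i = i + d - b := by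
  rw [reverseBlocks, if_neg (by omega), if_pos (by omega)]

lemma reverseBlocks_second (hab : a < b) (h : b < i) (h' : i ≤ c) :
    reverseBlocks a b c d i = i + a + d - b - c := by
  rw [reverseBlocks, if_neg (by omega), if_neg (by omega), if_pos (by omega)]

lemma reverseBlocks_third (hab : a < b) (hbc : b < c) (h : c < i) (h' : i ≤ d) :
    reverseBlocks a b c d i = i + a - c := by
  rw [reverseBlocks, if_neg (by omega), if_neg (by omega), if_neg (by omega), if_pos (by omega)]

lemma reverseBlocks_cases (hab : a < b) (hbc : b < c) (hcd : c < d) (i : ℕ) :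
    (i ≤ a ∧ reverseBlocks a b c d i = i) ∨ (a < i ∧ i ≤ b ∧ reverseBlocks a b c d i = i + d - b) ∨
      (b < i ∧ i ≤ c ∧ reverseBlocks a b c d i = i + a + d - b - c) ∨
      (c < i ∧ i ≤ d ∧ reverseBlocks a b c d i = i + a - c) ∨
      (d < i ∧ reverseBlocks a b c d i = i) := by
  rcases le_or_gt i a with h1 | h1
  · exact Or.inl ⟨h1, reverseBlocks_of_le h1⟩
  rcases le_or_gt i b with h2 | h2
  · exact Or.inr (Or.inl ⟨h1, h2, reverseBlocks_first h1 h2⟩)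
  rcases le_or_gt i c with h3 | h3
  · exact Or.inr (Or.inr (Or.inl ⟨h2, h3, reverseBlocks_second hab h2 h3⟩))
  rcases le_or_gt i d with h4 | h4
  · exact Or.inr (Or.inr (Or.inr (Or.inl ⟨h3, h4, reverseBlocks_third hab hbc h3 h4⟩)))
  · exact Or.inr (Or.inr (Or.inr (Or.inr ⟨h4, reverseBlocks_of_gt h4 hab hbc hcd⟩)))

lemma reverseBlocks_lt (hab : a < b) (hbc : b < c) (hcd : c < d) {N : ℕ} (hd : d < N) (hi : i < N) :
    reverseBlocks a b c d i < N := by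
  rcases reverseBlocks_cases hab hbc hcd i with h | h | h | h | h <;> omega

lemma reverseBlocks_injective (hab : a < b) (hbc : b < c) (hcd : c < d) :
    Function.Injective (reverseBlocks a b c d) := by
  intro i j e
  rcases reverseBlocks_cases hab hbc hcd i with h | h | h | h | h <;>
    rcases reverseBlocks_cases hab hbc hcd j with h' | h' | h' | h' | h' <;> omega

lemma reverseBlocks_succ (hab : a < b) (hbc : b < c) (hcd : c < d)
    (hi : ¬ (i = a ∨ i = b ∨ i = c ∨ i = d)) :
    reverseBlocks a b c d (i + 1) = reverseBlocks a b c d i + 1 := by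
  rcases reverseBlocks_cases hab hbc hcd i with h | h | h | h | h
  · rw [h.2, reverseBlocks_of_le (by omega)]
  · rw [h.2.2, reverseBlocks_first (by omega) (by omega)]
    omega
  · rw [h.2.2, reverseBlocks_second hab (by omega) (by omega)]
    omega
  · rw [h.2.2, reverseBlocks_third hab hbc (by omega) (by omega)]
    omega
  · rw [h.2, reverseBlocks_of_gt (by omega) hab hbc hcd]

/-- The inversions of the rearrangement. -/
lemma reverseBlocks_lt_indicator (hab : a < b) (hbc : b < c) (hcd : c < d) (i j : ℕ) :
    (if reverseBlocks a b c d i < reverseBlocks a b c d j then (1 : ℤ) else 0) =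
      (if i < j then 1 else 0) +
        ((if (b < i ∧ i ≤ d) ∧ a < j ∧ j ≤ c then 1 else 0) -
          if (b < j ∧ j ≤ d) ∧ a < i ∧ i ≤ c then 1 else 0) := by
  have hi := reverseBlocks_cases hab hbc hcd i
  have hj := reverseBlocks_cases hab hbc hcd j
  generalize reverseBlocks a b c d i = k at hi ⊢
  generalize reverseBlocks a b c d j = l at hj ⊢
  rcases hi with h | h | h | h | h <;> rcases hj with h' | h' | h' | h' | h' <;>
    split_ifs <;> omega

end reverseBlocks

namespace GaussDiagram

variable {n : ℕ} {G : GaussDiagram n} {x₀ : Fin (2 * n)} {S : Finset (Fin (2 * n))}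
  {pos : Equiv.Perm (Fin (2 * n))}

/-- The sum of the signs at the first passages of the crossings outside of `S`. -/
def firstSum (G : GaussDiagram n) (S : Finset (Fin (2 * n))) (pos : Equiv.Perm (Fin (2 * n))) : ℤ :=
  ∑ z, if z ∉ S ∧ (pos z).val < (pos (G.partner z)).val then G.flatSign z else 0

/-- If no arrow of `S` were interleaved with `x`, then undoing the smoothings would keep the stretch
of the walk from `x` to its partner closed under the rotation. But the rotation is a single cycle,
and `x` itself is outside of the stretch. -/
lemma IsNumbering.exists_interleaved (hp : G.IsNumbering x₀ S pos) (hS : G.IsClosed S)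
    (hne : S.Nonempty) : ∃ x ∈ S, ∃ y ∈ S, (pos x).val < (pos y).val ∧
      (pos y).val < (pos (G.partner x)).val ∧
      (pos (G.partner x)).val < (pos (G.partner y)).val := by
  have hpp := G.partner_partner
  have hinj : ∀ {u v}, (pos u).val = (pos v).val → u = v := fun e => pos.injective (Fin.ext e)
  obtain ⟨x, hx, hlt⟩ : ∃ x ∈ S, (pos x).val < (pos (G.partner x)).val := by
    obtain ⟨x, hx⟩ := hne
    rcases lt_trichotomy (pos x).val (pos (G.partner x)).val with h | h | h
    · exact ⟨x, hx, h⟩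
    · exact absurd (hinj h).symm (G.partner_ne x)
    · exact ⟨G.partner x, (hS x).mpr hx, by rwa [hpp]⟩
  by_contra! hno
  have hin : ∀ y ∈ S, (pos x).val < (pos y).val → (pos y).val < (pos (G.partner x)).val →
      (pos x).val < (pos (G.partner y)).val ∧
        (pos (G.partner y)).val < (pos (G.partner x)).val := by
    intro y hy h1 h2
    have h3 := hno x hx y hy h1 h2
    have h4 : (pos (G.partner y)).val ≠ (pos (G.partner x)).val := by
      intro e
      obtain rfl := G.partner_injective (hinj e)
      exact lt_irrefl _ h1
    have h5 : (pos (G.partner y)).val ≠ (pos x).val := by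
      intro e
      rw [← hinj e, hpp] at h2
      exact lt_irrefl _ h2
    have h6 : ¬ (pos (G.partner y)).val < (pos x).val := by
      intro h
      have := hno (G.partner y) ((hS y).mpr hy) x hx h (by rwa [hpp])
      rw [hpp] at this
      omega
    omega
  have hnext : ∀ z, (pos x).val < (pos z).val → (pos z).val < (pos (G.partner x)).val →
      (pos (G.walk S z)).val = (pos z).val + 1 := by
    intro z _ h2
    rw [hp.walk, finRotate_val, if_neg]
    have := (pos (G.partner x)).isLt
    omega
  have hV : ∀ z, (pos x).val < (pos z).val ∧ (pos z).val ≤ (pos (G.partner x)).val := by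
    refine finRotate_induction (i := G.partner x) ⟨hlt, le_rfl⟩ fun z hz => ?_
    by_cases hzS : z ∈ S
    · by_cases hzx : z = G.partner x
      · have e : finRotate (2 * n) z = G.walk S x := by rw [hzx, walk_of_mem' hx]
        have : (pos (G.walk S x)).val = (pos x).val + 1 := by
          rw [hp.walk, finRotate_val, if_neg]
          have := (pos (G.partner x)).isLt
          omega
        rw [e, this]
        omega
      · have hlt' : (pos z).val < (pos (G.partner x)).val :=
          lt_of_le_of_ne hz.2 fun e => hzx (hinj e)
        have h1 := hin z hzS hz.1 hlt'
        have e : finRotate (2 * n) z = G.walk S (G.partner z) := by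
          rw [walk_of_mem' ((hS z).mpr hzS), hpp]
        rw [e, hnext _ h1.1 h1.2]
        omega
    · have hlt' : (pos z).val < (pos (G.partner x)).val :=
        lt_of_le_of_ne hz.2 fun e => hzS (hinj e ▸ (hS x).mpr hx)
      rw [← walk_of_notMem hzS, hnext z hz.1 hlt']
      omega
  exact lt_irrefl _ (hV x).1

section interleaved

variable {x y : Fin (2 * n)}

/-- Two loops of the smoothed diagram have intersection number zero. -/
lemma IsNumbering.sum_eq_zero (hG : G.IsClassical) (hp : G.IsNumbering x₀ S pos)
    (hS : G.IsClosed S) (hx : x ∈ S) (hy : y ∈ S) (hxy : (pos x).val < (pos y).val)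
    (hyx : (pos y).val < (pos (G.partner x)).val)
    (hxy' : (pos (G.partner x)).val < (pos (G.partner y)).val) :
    2 * ∑ z, (if z ∉ S ∧ ((pos y).val < (pos z).val ∧ (pos z).val ≤ (pos (G.partner y)).val) ∧
        (pos x).val < (pos (G.partner z)).val ∧
          (pos (G.partner z)).val ≤ (pos (G.partner x)).val then G.flatSign z else 0) +
      G.flatSign x + G.flatSign (G.partner y) = 0 := by
  have hpp := G.partner_partner
  have hn : n ≠ 0 := by rintro rfl; exact x.elim0
  have hinj : ∀ {u v}, (pos u).val = (pos v).val → u = v := fun e => pos.injective (Fin.ext e)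
  have hpx := (hS x).mpr hx
  have hpy := (hS y).mpr hy
  set a := (pos x).val with ha
  set b := (pos y).val with hb
  set c := (pos (G.partner x)).val with hc
  set d := (pos (G.partner y)).val with hd
  have hd2 : d < 2 * n := (pos (G.partner y)).isLt
  -- The indicator function of the loop that the smoothed walk describes between its two passages of
  -- `x`. It is a flow and has a height function `K`.
  set f : Fin (2 * n) → ℝ := fun z => if a < (pos z).val ∧ (pos z).val ≤ c then 1 else 0 with hf
  have hnext : ∀ z, (pos (G.walk S z)).val =
      if (pos z).val + 1 = 2 * n then 0 else (pos z).val + 1 := fun z => by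
    rw [hp.walk, finRotate_val]
  -- the flow changes only at the crossing of `x`
  have hfx : f x = 0 ∧ f (G.walk S x) = 1 ∧ f (G.partner x) = 1 ∧
      f (G.walk S (G.partner x)) = 0 := by
    simp only [hf, hnext, ← ha, ← hc]
    have e1 : (if a + 1 = 2 * n then 0 else a + 1) = a + 1 := if_neg (by omega)
    have e2 : (if c + 1 = 2 * n then 0 else c + 1) = c + 1 := if_neg (by omega)
    rw [e1, e2]
    exact ⟨if_neg (by omega), if_pos (by omega), if_pos (by omega), if_neg (by omega)⟩
  have hfne : ∀ z, z ≠ x → z ≠ G.partner x → f (G.walk S z) = f z := by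
    intro z h1 h2
    have h1' : (pos z).val ≠ a := fun e => h1 (hinj e)
    have h2' : (pos z).val ≠ c := fun e => h2 (hinj e)
    simp only [hf, hnext]
    have := (pos z).isLt
    refine if_congr ?_ rfl rfl
    split_ifs <;> omega
  have hpe : ∀ z, G.partner z ≠ x ↔ z ≠ G.partner x := fun z => by
    rw [ne_eq, ne_eq, ← G.partner_injective.eq_iff, hpp]
  have hflow : G.IsFlow f := by
    intro z
    by_cases hz : z ∈ S
    · rw [← walk_of_mem' hz]
      have e : finRotate (2 * n) z = G.walk S (G.partner z) := by
        rw [walk_of_mem' ((hS z).mpr hz), hpp]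
      rw [e]
      by_cases h1 : z = x
      · subst h1
        rw [hfx.1, hfx.2.1, hfx.2.2.1, hfx.2.2.2]
      by_cases h2 : z = G.partner x
      · rw [h2, hpp, hfx.1, hfx.2.1, hfx.2.2.1, hfx.2.2.2]
      · rw [hfne z h1 h2, hfne (G.partner z) ((hpe z).mpr h2)
          (fun e => h1 (G.partner_injective e))]
        ring
    · have hz' : G.partner z ∉ S := fun h => hz ((hS z).mp h)
      rw [← walk_of_notMem hz, ← walk_of_notMem (G := G) hz', hfne, hfne]
      · exact fun e => hz' (e ▸ hx)
      · exact fun e => hz' (e ▸ hpx)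
      · exact fun e => hz (e ▸ hx)
      · exact fun e => hz (e ▸ hpx)
  obtain ⟨K, hK⟩ := G.exists_height hn hG hflow
  -- The height is followed along the loop that belongs to `y`.
  have htel : ∑ z, (if b < (pos z).val ∧ (pos z).val < d then K (G.walk S z) - K z else 0) =
      K (G.partner y) - K (G.walk S y) := by
    have := sum_Ioo_eq_sub (K := fun i => K (pos.symm i)) (g := fun i =>
      K (pos.symm (finRotate (2 * n) i)) - K (pos.symm i)) (fun _ => rfl)
      (x := pos y) (y := pos (G.partner y)) (by rw [Fin.lt_def]; omega)
    rw [← hp.walk, Equiv.symm_apply_apply, Equiv.symm_apply_apply] at this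
    rw [← this, ← Equiv.sum_comp pos.symm, ← Finset.sum_filter]
    refine Finset.sum_congr ?_ fun i _ => ?_
    · ext i
      simp only [Finset.mem_filter, Finset.mem_univ, true_and, Equiv.apply_symm_apply, Finset.mem_Ioo,
        Fin.lt_def, hb, hd]
    · have e : pos.symm (finRotate (2 * n) i) = G.walk S (pos.symm i) := by
        rw [Equiv.symm_apply_eq, hp.walk, Equiv.apply_symm_apply]
      rw [e]
  -- At its corner this loop leaves the loop of `x`, which accounts for the flat sign at the end.
  have hlast : K (G.walk S y) - K (G.partner y) = G.flatSign (G.partner y) := by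
    have h1 := (hK (G.partner y)).1
    rw [hpp] at h1
    have e : finRotate (2 * n) y = G.walk S (G.partner y) := by rw [walk_of_mem' hpy, hpp]
    have h2 : f y = 1 := if_pos ⟨hxy, hyx.le⟩
    have h3 : f (G.walk S (G.partner y)) = 0 := by
      simp only [hf, hnext, ← hd]
      refine if_neg ?_
      split_ifs <;> omega
    rw [← walk_of_mem' hy, e, h2, h3] at h1
    rw [h1]
    ring
  -- At a crossing outside of `S` the height changes by twice the flat sign if the other strand
  -- belongs to the loop of `x`. At a smoothed one it changes only at the partner of `x`, where the
  -- flow ends.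
  have hterm : ∀ z, (if b < (pos z).val ∧ (pos z).val < d then K (G.walk S z) - K z else 0) =
      2 * (if z ∉ S ∧ (b < (pos z).val ∧ (pos z).val ≤ d) ∧ a < (pos (G.partner z)).val ∧
        (pos (G.partner z)).val ≤ c then (G.flatSign z : ℝ) else 0) +
      if z = G.partner x then (G.flatSign x : ℝ) else 0 := by
    intro z
    by_cases hz : z ∈ S
    · simp only [hz, not_true_eq_false, false_and, if_false, mul_zero, zero_add]
      by_cases h2 : z = G.partner x
      · rw [if_pos h2, h2, if_pos (by omega)]
        have := (hK (G.partner x)).2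
        rw [← walk_of_mem' hpx, hfx.2.2.1, hfx.2.2.2, G.flatSign_partner] at this
        rw [this]
        push_cast
        ring
      · rw [if_neg h2]
        split_ifs with h
        · have h1 : z ≠ x := by
            rintro rfl
            omega
          have := (hK z).2
          rw [← walk_of_mem' hz, hfne z h1 h2, sub_self, mul_zero] at this
          exact this
        · rfl
    · have hz' : G.partner z ∉ S := fun h => hz ((hS z).mp h)
      have h2 : z ≠ G.partner x := fun e => hz (e ▸ hpx)
      have hd' : (pos z).val ≠ d := fun e => hz (hinj e ▸ hpy)
      rw [if_neg h2, add_zero]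
      have h3 := (hK z).1
      rw [← walk_of_notMem hz, ← walk_of_notMem (G := G) hz', hfne (G.partner z)
        (fun e => hz' (e ▸ hx)) (fun e => hz' (e ▸ hpx))] at h3
      simp only [hz, not_false_eq_true, true_and]
      by_cases h4 : b < (pos z).val ∧ (pos z).val < d
      · rw [if_pos h4, h3]
        simp only [hf]
        by_cases h5 : a < (pos (G.partner z)).val ∧ (pos (G.partner z)).val ≤ c
        · rw [if_pos h5, if_pos ⟨⟨h4.1, h4.2.le⟩, h5⟩]
          ring
        · rw [if_neg h5, if_neg fun h => h5 h.2]
          ring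
      · rw [if_neg h4, if_neg fun h => h4 ⟨h.1.1, lt_of_le_of_ne h.1.2 hd'⟩, mul_zero]
  simp only [hterm] at htel
  rw [Finset.sum_add_distrib, Finset.sum_ite_eq', if_pos (Finset.mem_univ _), ← Finset.mul_sum] at htel
  have : ((2 * ∑ z, (if z ∉ S ∧ (b < (pos z).val ∧ (pos z).val ≤ d) ∧ a < (pos (G.partner z)).val ∧
      (pos (G.partner z)).val ≤ c then G.flatSign z else 0) +
      G.flatSign x + G.flatSign (G.partner y) : ℤ) : ℝ) = 0 := by
    push_cast
    linarith
  exact_mod_cast this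

/-- Two interleaved arrows can be removed from the smoothed arrows. -/
lemma IsNumbering.exists_sdiff (hG : G.IsClassical) (hp : G.IsNumbering x₀ S pos)
    (hx₀ : x₀.val = 0) (hS : G.IsClosed S) (hx : x ∈ S) (hy : y ∈ S)
    (hxy : (pos x).val < (pos y).val) (hyx : (pos y).val < (pos (G.partner x)).val)
    (hxy' : (pos (G.partner x)).val < (pos (G.partner y)).val) :
    ∃ S' pos', S'.card < S.card ∧ G.IsClosed S' ∧ G.IsNumbering x₀ S' pos' ∧
      G.firstSum S' pos' = G.firstSum S pos := by
  have hpp := G.partner_partner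
  have hinj : ∀ {u v}, (pos u).val = (pos v).val → u = v := fun e => pos.injective (Fin.ext e)
  have hpx := (hS x).mpr hx
  have hpy := (hS y).mpr hy
  have hsum := hp.sum_eq_zero hG hS hx hy hxy hyx hxy'
  have hlt : ∀ z, (pos z).val < 2 * n := fun z => (pos z).isLt
  have ha : ∀ z, (pos z).val = (pos x).val ↔ z = x := fun z => ⟨hinj, fun e => by rw [e]⟩
  have hb : ∀ z, (pos z).val = (pos y).val ↔ z = y := fun z => ⟨hinj, fun e => by rw [e]⟩
  have hc : ∀ z, (pos z).val = (pos (G.partner x)).val ↔ z = G.partner x :=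
    fun z => ⟨hinj, fun e => by rw [e]⟩
  have hd : ∀ z, (pos z).val = (pos (G.partner y)).val ↔ z = G.partner y :=
    fun z => ⟨hinj, fun e => by rw [e]⟩
  have hd2 := hlt (G.partner y)
  have hnext : ∀ z, (pos (G.walk S z)).val =
      if (pos z).val + 1 = 2 * n then 0 else (pos z).val + 1 := fun z => by
    rw [hp.walk, finRotate_val]
  have hnx := hnext x
  have hny := hnext y
  have hnpx := hnext (G.partner x)
  have hnpy := hnext (G.partner y)
  set a := (pos x).val
  set b := (pos y).val
  set c := (pos (G.partner x)).val
  set d := (pos (G.partner y)).val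
  have hra : reverseBlocks a b c d a = a := reverseBlocks_of_le le_rfl
  have hrb : reverseBlocks a b c d b = d := by
    rw [reverseBlocks_first hxy le_rfl]
    omega
  have hrc : reverseBlocks a b c d c = a + d - b := by
    rw [reverseBlocks_second hxy hyx le_rfl]
    omega
  have hrd : reverseBlocks a b c d d = a + d - c := by
    rw [reverseBlocks_third hxy hyx hxy' le_rfl]
    omega
  have hinj' : Function.Injective fun z => (⟨reverseBlocks a b c d (pos z).val,
      reverseBlocks_lt hxy hyx hxy' hd2 (hlt z)⟩ : Fin (2 * n)) := fun u v e =>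
    hinj (reverseBlocks_injective hxy hyx hxy' (Fin.mk.inj e))
  -- Without the smoothings at `x` and `y` the walk runs through the three stretches between their
  -- four end points in the reverse order.
  set pos' := Equiv.ofBijective _ (Finite.injective_iff_bijective.mp hinj')
  have hpos' : ∀ z, (pos' z).val = reverseBlocks a b c d (pos z).val := fun _ => rfl
  set S' := S.filter fun z => ¬ (z = x ∨ z = y ∨ z = G.partner x ∨ z = G.partner y) with hS'def
  have hmem : ∀ z, z ∈ S' ↔ z ∈ S ∧ ¬ (z = x ∨ z = y ∨ z = G.partner x ∨ z = G.partner y) :=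
    fun z => by rw [hS'def, Finset.mem_filter]
  have hpe : ∀ u v, G.partner u = v ↔ u = G.partner v := fun u v =>
    ⟨fun e => by rw [← e, hpp], fun e => by rw [e, hpp]⟩
  refine ⟨S', pos', ?_, fun z => ?_, ⟨?_, fun z => ?_⟩, ?_⟩
  · refine Finset.card_lt_card (Finset.ssubset_iff_subset_ne.mpr ⟨Finset.filter_subset _ _, ?_⟩)
    intro e
    exact ((hmem x).mp (by rw [e]; exact hx)).2 (Or.inl rfl)
  · rw [hmem, hmem, hS z, hpe, hpe, hpe, hpe, hpp, hpp]
    tauto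
  · refine Fin.ext ?_
    rw [hpos', hp.base, hx₀, reverseBlocks, if_pos (Nat.zero_le _)]
  · refine Fin.ext ?_
    rw [hpos', finRotate_val, hpos']
    by_cases hz : z = x ∨ z = y ∨ z = G.partner x ∨ z = G.partner y
    · have hz' : z ∈ S := by
        rcases hz with rfl | rfl | rfl | rfl <;> assumption
      have e : G.walk S' z = G.walk S (G.partner z) := by
        rw [walk_of_notMem fun h => ((hmem z).mp h).2 hz, walk_of_mem' ((hS z).mpr hz'), hpp]
      rw [e]
      rcases hz with rfl | rfl | rfl | rfl
      · change _ = if reverseBlocks a b c d a + 1 = 2 * n then 0 else reverseBlocks a b c d a + 1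
        rw [hnpx, hra, if_neg (by omega), if_neg (by omega),
          reverseBlocks_third hxy hyx (by omega) (by omega)]
        omega
      · change _ = if reverseBlocks a b c d b + 1 = 2 * n then 0 else reverseBlocks a b c d b + 1
        rw [hnpy, hrb]
        split_ifs
        · exact reverseBlocks_of_le (Nat.zero_le _)
        · exact reverseBlocks_of_gt (by omega) hxy hyx hxy'
      · change _ = if reverseBlocks a b c d c + 1 = 2 * n then 0 else reverseBlocks a b c d c + 1
        rw [hpp, hnx, hrc, if_neg (by omega), if_neg (by omega),
          reverseBlocks_first (by omega) (by omega)]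
        omega
      · change _ = if reverseBlocks a b c d d + 1 = 2 * n then 0 else reverseBlocks a b c d d + 1
        rw [hpp, hny, hrd, if_neg (by omega), if_neg (by omega),
          reverseBlocks_second hxy (by omega) (by omega)]
        omega
    · have e : G.walk S' z = G.walk S z := by
        have : z ∈ S' ↔ z ∈ S := by rw [hmem]; tauto
        unfold ArrowDiagram.walk ArrowDiagram.jump
        simp only [this]
      rw [← ha, ← hb, ← hc, ← hd] at hz
      rw [e, hnext]
      have hlz := hlt z
      by_cases h0 : (pos z).val + 1 = 2 * n
      · rw [if_pos h0, reverseBlocks_of_le (Nat.zero_le _),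
          reverseBlocks_of_gt (by omega) hxy hyx hxy', if_pos h0]
      · have := reverseBlocks_lt hxy hyx hxy' hd2 (i := (pos z).val + 1) (by omega)
        rw [reverseBlocks_succ hxy hyx hxy' hz] at this
        rw [if_neg h0, reverseBlocks_succ hxy hyx hxy' hz, if_neg (by omega)]
  -- Here `w` marks crossings whose two passages may be interchanged by the reordering. Moreover `x`
  -- and the partner of `y` become first passages of crossings that are no longer smoothed. The
  -- total change is the sum that vanishes by `sum_eq_zero`.
  · set w : Fin (2 * n) → ℤ := fun z => if z ∉ S ∧ (b < (pos z).val ∧ (pos z).val ≤ d) ∧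
      a < (pos (G.partner z)).val ∧ (pos (G.partner z)).val ≤ c then 1 else 0 with hw
    have key : ∀ z, (if z ∉ S' ∧ (pos' z).val < (pos' (G.partner z)).val then G.flatSign z else 0) =
        (if z ∉ S ∧ (pos z).val < (pos (G.partner z)).val then G.flatSign z else 0) +
        (G.flatSign z * w z - G.flatSign z * w (G.partner z)) +
        ((if z = x then G.flatSign z else 0) + if z = G.partner y then G.flatSign z else 0) := by
      intro z
      by_cases hz : z ∈ S
      · have hw1 : w z = 0 := if_neg fun h => h.1 hz
        have hw2 : w (G.partner z) = 0 := if_neg fun h => h.1 ((hS z).mpr hz)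
        rw [hw1, hw2, if_neg (fun h : z ∉ S ∧ _ => h.1 hz), mul_zero, sub_zero, zero_add, zero_add]
        by_cases h1 : z = x
        · subst h1
          have hz' : z ∉ S' := fun h => ((hmem _).mp h).2 (Or.inl rfl)
          have hlt' : (pos' z).val < (pos' (G.partner z)).val := by
            change reverseBlocks a b c d a < reverseBlocks a b c d c
            omega
          have hne' : z ≠ G.partner y := fun e => absurd ((hd z).mpr e) (by omega)
          rw [if_pos ⟨hz', hlt'⟩, if_pos rfl, if_neg hne', add_zero]
        by_cases h4 : z = G.partner y
        · subst h4
          have hz' : G.partner y ∉ S' := fun h => ((hmem _).mp h).2 (by simp)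
          have hlt' : (pos' (G.partner y)).val < (pos' (G.partner (G.partner y))).val := by
            rw [hpp]
            change reverseBlocks a b c d d < reverseBlocks a b c d b
            omega
          rw [if_pos ⟨hz', hlt'⟩, if_neg h1, if_pos rfl, zero_add]
        rw [if_neg h1, if_neg h4, add_zero, if_neg]
        rintro ⟨hz', hlt'⟩
        have : z = y ∨ z = G.partner x := by
          by_contra hno
          exact hz' ((hmem z).mpr ⟨hz, by tauto⟩)
        rcases this with rfl | rfl
        · change reverseBlocks a b c d b < reverseBlocks a b c d d at hlt'
          omega
        · rw [hpp] at hlt'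
          change reverseBlocks a b c d c < reverseBlocks a b c d a at hlt'
          omega
      · have hz' : G.partner z ∉ S := fun h => hz ((hS z).mp h)
        have h1 : z ≠ x := fun e => hz (e ▸ hx)
        have h2 : z ≠ G.partner y := fun e => hz (e ▸ hpy)
        have hzS' : z ∉ S' := fun h => hz ((hmem z).mp h).1
        simp only [hw, hpp, hz, hz', hzS', h1, h2, not_false_eq_true, true_and, if_false, hpos',
          add_zero]
        have key2 : (if reverseBlocks a b c d (pos z).val <
            reverseBlocks a b c d (pos (G.partner z)).val then (1 : ℤ) else 0) =
            (if (pos z).val < (pos (G.partner z)).val then 1 else 0) +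
            ((if (b < (pos z).val ∧ (pos z).val ≤ d) ∧
              a < (pos (G.partner z)).val ∧ (pos (G.partner z)).val ≤ c then 1 else 0) -
            if (b < (pos (G.partner z)).val ∧ (pos (G.partner z)).val ≤ d) ∧
              a < (pos z).val ∧ (pos z).val ≤ c then 1 else 0) :=
          reverseBlocks_lt_indicator hxy hyx hxy' _ _
        have hm : ∀ (P : Prop) [Decidable P], (if P then G.flatSign z else 0) =
            G.flatSign z * if P then 1 else 0 := fun P _ => by rw [mul_ite, mul_one, mul_zero]
        rw [hm, hm, key2]
        ring
    unfold firstSum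
    rw [Finset.sum_congr rfl fun z _ => key z]
    have hanti : ∑ z, G.flatSign z * w (G.partner z) = -∑ z, G.flatSign z * w z := by
      rw [← G.sum_partner, ← Finset.sum_neg_distrib]
      refine Finset.sum_congr rfl fun z _ => ?_
      rw [hpp, flatSign_partner]
      ring
    have hww : ∑ z, G.flatSign z * w z = ∑ z, (if z ∉ S ∧ (b < (pos z).val ∧ (pos z).val ≤ d) ∧
      a < (pos (G.partner z)).val ∧ (pos (G.partner z)).val ≤ c then G.flatSign z else 0) := by
      refine Finset.sum_congr rfl fun z _ => ?_
      rw [hw, mul_ite, mul_one, mul_zero]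
    rw [← hww] at hsum
    rw [Finset.sum_add_distrib, Finset.sum_add_distrib, Finset.sum_sub_distrib, hanti,
      Finset.sum_add_distrib, Finset.sum_ite_eq', Finset.sum_ite_eq', if_pos (Finset.mem_univ _),
      if_pos (Finset.mem_univ _)]
    linarith

end interleaved

lemma IsNumbering.eq_one (hp : G.IsNumbering x₀ ∅ pos) : pos = 1 := by
  refine Equiv.ext (finRotate_induction (i := x₀) hp.base fun z hz => ?_)
  have := hp.walk z
  rw [walk_of_notMem (Finset.notMem_empty z), hz] at this
  exact this

/-- The sum of the signs at the first passages does not depend on the arrows that are smoothed. -/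
theorem IsNumbering.firstSum_eq (hG : G.IsClassical) (hx₀ : x₀.val = 0) (hS : G.IsClosed S)
    (hp : G.IsNumbering x₀ S pos) : G.firstSum S pos = G.firstSum ∅ 1 := by
  induction hk : S.card using Nat.strong_induction_on generalizing S pos with
  | h k ih =>
    rcases S.eq_empty_or_nonempty with rfl | hne
    · rw [hp.eq_one]
    · obtain ⟨x, hx, y, hy, h1, h2, h3⟩ := hp.exists_interleaved hS hne
      obtain ⟨S', pos', hlt, hS', hp', e⟩ := hp.exists_sdiff hG hx₀ hS hx hy h1 h2 h3
      rw [← e]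
      exact ih _ (hk ▸ hlt) hS' hp' rfl

end GaussDiagram

/-! ### Equality of the ascending and the descending sum of a classical diagram -/

lemma Finset.prod_ite_zpow {ι : Type*} {q : ℝ} (hq : q ≠ 0) (s : Finset ι) (P : ι → Prop)
    [DecidablePred P] (f : ι → ℤ) :
    ∏ z ∈ s, (if P z then q ^ f z else 1) = q ^ ∑ z ∈ s, if P z then f z else 0 := by
  classical
  induction s using Finset.induction with
  | empty => simp
  | insert a s ha ih =>
    rw [Finset.prod_insert ha, Finset.sum_insert ha, zpow_add₀ hq, ih]
    split_ifs <;> simp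

namespace GaussDiagram

variable {n : ℕ} {G : GaussDiagram n} {q : ℝ} {x₀ : Fin (2 * n)} {S : Finset (Fin (2 * n))}
  {ov : Fin (2 * n) → Bool} {t : Bool} {m : ℕ} {pos : Equiv.Perm (Fin (2 * n))}

lemma flatSign_eq_of_isHead {z : Fin (2 * n)} (h : G.isHead z = true) :
    G.flatSign z = -(G.sign z : ℤ) := if_pos h

lemma flatSign_eq_of_isTail {z : Fin (2 * n)} (h : G.isHead z = false) :
    G.flatSign z = (G.sign z : ℤ) := if_neg (by simp [h])

lemma zpow_sign_sub (s : ℤˣ) (q : ℝ) :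
    q ^ (-(s : ℤ)) - q ^ (s : ℤ) = ((s : ℤ) : ℝ) * (q⁻¹ - q) := by
  rcases Int.units_eq_one_or s with rfl | rfl <;> simp

lemma IsNumbering.burauDet_over (hq : 0 < q) (hp : G.IsNumbering x₀ S pos) (hx₀ : x₀.val = 0)
    (hS : G.IsClosed S)
    (hov : ∀ z ∉ S, (ov z = true ↔ (pos z).val < (pos (G.partner z)).val)) :
    G.burauDet q x₀ S ov = q ^ (-G.firstSum S pos) := by
  rw [burauDet, hp.det_burau_over hx₀ hS fun z hz => (hov z hz).mp, mul_one, overFactor,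
    Finset.prod_ite_zpow hq.ne', firstSum, ← Finset.sum_neg_distrib]
  congr 1
  refine Finset.sum_congr rfl fun z _ => ?_
  have : z ∉ S ∧ ov z = true ↔ z ∉ S ∧ (pos z).val < (pos (G.partner z)).val :=
    and_congr_right (hov z)
  simp only [this]
  split_ifs <;> simp

/-- The determinant has the exponent `-2` times the sum of the signs at first passages, and the
normalizing factor has this sum itself. Together they give the same value as at the leaves with over
passages first. -/
lemma IsNumbering.burauDet_under (hq : 0 < q) (hp : G.IsNumbering x₀ S pos) (hx₀ : x₀.val = 0)
    (hS : G.IsClosed S) (hov' : ∀ z, ov (G.partner z) = !ov z)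
    (hov : ∀ z ∉ S, (ov z = false ↔ (pos z).val < (pos (G.partner z)).val)) :
    G.burauDet q x₀ S ov = q ^ (-G.firstSum S pos) := by
  have h1 : ∀ z, (if z ∉ S ∧ ov z = false then -2 * G.flatSign z else 0) =
      -2 * if z ∉ S ∧ (pos z).val < (pos (G.partner z)).val then G.flatSign z else 0 := by
    intro z
    have : z ∉ S ∧ ov z = false ↔ z ∉ S ∧ (pos z).val < (pos (G.partner z)).val :=
      and_congr_right (hov z)
    simp only [this, mul_ite, mul_zero]
  have h2 : ∀ z, (if G.partner z ∉ S ∧ ov (G.partner z) = true then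
      -G.flatSign (G.partner z) else 0) =
      if z ∉ S ∧ (pos z).val < (pos (G.partner z)).val then G.flatSign z else 0 := by
    intro z
    have : G.partner z ∉ S ∧ ov (G.partner z) = true ↔
        z ∉ S ∧ (pos z).val < (pos (G.partner z)).val := by
      rw [hS z, hov']
      refine and_congr_right fun hz => ?_
      rw [← hov z hz, Bool.not_eq_true']
    simp only [this, flatSign_partner, neg_neg]
  rw [burauDet, hp.det_burau_under hx₀ hS hov' fun z hz ho => ?_, overFactor,
    Finset.prod_ite_zpow hq.ne', Finset.prod_ite_zpow hq.ne', ← zpow_add₀ hq.ne', ← G.sum_partner]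
  · simp only [h1, h2]
    rw [← Finset.mul_sum]
    congr 1
    simp only [firstSum]
    ring
  · have hne : (pos z).val ≠ (pos (G.partner z)).val := fun e =>
      G.partner_ne z (pos.injective (Fin.ext e)).symm
    have : ¬ (pos z).val < (pos (G.partner z)).val := by
      rw [← hov z hz, ho]
      simp
    omega

/-- The points that are reached form a complete orbit of the walk. -/
lemma Explored.reached_iff (h : G.Explored x₀ t S ov m) (hm : 0 < m)
    (hret : G.stepsFrom x₀ S m = x₀) (z : Fin (2 * n)) :
    (∃ i < m, G.stepsFrom x₀ S i = G.walk S z) ↔ ∃ i < m, G.stepsFrom x₀ S i = z := by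
  have hinj := (ArrowDiagram.walk_bijective h.closed).injective
  constructor
  · rintro ⟨i, hi, e⟩
    rcases Nat.eq_zero_or_pos i with rfl | hi0
    · refine ⟨m - 1, by omega, hinj ?_⟩
      rw [← e, ← stepsFrom_succ, Nat.sub_add_cancel hm, hret]
      rfl
    · refine ⟨i - 1, by omega, hinj ?_⟩
      rw [← e, ← stepsFrom_succ, Nat.sub_add_cancel hi0]
  · rintro ⟨i, hi, rfl⟩
    rcases eq_or_lt_of_le (Nat.succ_le_of_lt hi) with e | hlt
    · exact ⟨0, hm, by rw [← stepsFrom_succ, ← Nat.succ_eq_add_one, e, hret]; rfl⟩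
    · exact ⟨i + 1, hlt, stepsFrom_succ i⟩

lemma Explored.ov_eq (h : G.Explored x₀ t S ov m) {z : Fin (2 * n)} (hzS : z ∉ S)
    (hz : ∃ i < m, G.stepsFrom x₀ S i = z) (hpz : ¬ ∃ i < m, G.stepsFrom x₀ S i = G.partner z) :
    ov z = t := by
  obtain ⟨i, hi, rfl⟩ := hz
  exact h.ov_first i hi hzS fun l hl e => hpz ⟨l, hl.trans hi, e⟩

/-- A crossing that is reached on one strand only is passed over there, so one cannot turn from its
other strand into the part that is reached. Planarity provides the eigenvector, with entries `q ^ K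
z` for the height function `K` of the constant flow `1`. -/
lemma Explored.burauDet_eq_zero_over (hG : G.IsClassical) (hq : 0 < q)
    (h : G.Explored x₀ true S ov m) (hm : 0 < m) (hret : G.stepsFrom x₀ S m = x₀)
    (hall : ¬ ∀ z, ∃ i < m, G.stepsFrom x₀ S i = z) : G.burauDet q x₀ S ov = 0 := by
  have hn : n ≠ 0 := by rintro rfl; exact x₀.elim0
  obtain ⟨K, hK⟩ := G.exists_height hn hG (c := fun _ => 1) (by intro z; simp)
  have h1 : ∀ z, q ^ K (finRotate (2 * n) z) = q ^ (2 * G.flatSign z) * q ^ K z := by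
    intro z
    rw [← Real.rpow_intCast, ← Real.rpow_add hq]
    congr 1
    have := (hK z).1
    push_cast
    linarith
  have h2 : ∀ z, K (finRotate (2 * n) (G.partner z)) = K z := by
    intro z
    have := (hK z).2
    linarith
  rw [burauDet, det_burau_eq_zero_of_forall_notMem (fun z => ∃ i < m, G.stepsFrom x₀ S i = z)
    (x₀ := x₀) ⟨0, hm, rfl⟩ (not_forall.mp hall) (fun z hz hgo => ?_) (fun z hz hturn => ?_)
    (v := fun z => q ^ K z) (fun z => (Real.rpow_pos_of_pos hq _).ne') (fun z => ?_), mul_zero]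
  · by_cases hzS : z ∈ S
    · rw [goWeight, if_pos hzS] at hgo
      exact absurd rfl hgo
    · rwa [← walk_of_notMem hzS, h.reached_iff hm hret]
  · by_cases hzS : z ∈ S
    · rwa [← walk_of_mem' hzS, h.reached_iff hm hret]
    · have hpS : G.partner z ∉ S := fun h' => hzS ((h.closed z).mp h')
      rw [← walk_of_notMem (G := G) hpS, h.reached_iff hm hret]
      intro hpz
      have := h.ov_eq hpS hpz (by rwa [G.partner_partner])
      rw [h.ov_partner] at this
      rw [turnWeight, if_neg hzS, if_neg (by
        rw [Bool.not_eq_true]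
        simpa using this)] at hturn
      exact hturn rfl
  · simp only [h1, h2, goWeight, turnWeight]
    by_cases hzS : z ∈ S
    · simp [hzS]
    · cases ov z
      · simp only [hzS, if_false, Bool.false_eq_true, zero_mul, add_zero]
        rw [← mul_assoc, ← zpow_add₀ hq.ne']
        simp
      · simp only [hzS, if_false, if_true]
        ring

/-- A crossing that is reached on one strand only is passed under there, so the part that is reached
is never left. The column sums suffice here, without planarity. -/
lemma Explored.burauDet_eq_zero_under (h : G.flip.Explored x₀ false S ov m) (hm : 0 < m)
    (hret : G.stepsFrom x₀ S m = x₀) (hall : ¬ ∀ z, ∃ i < m, G.stepsFrom x₀ S i = z) (q : ℝ) :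
    G.burauDet q x₀ S ov = 0 := by
  have hc : G.IsClosed S := h.closed
  have hV : ∀ z, (∃ i < m, G.stepsFrom x₀ S i = G.walk S z) ↔ ∃ i < m, G.stepsFrom x₀ S i = z :=
    h.reached_iff hm hret
  have hov : ∀ z ∉ S, (∃ i < m, G.stepsFrom x₀ S i = z) →
      (¬ ∃ i < m, G.stepsFrom x₀ S i = G.partner z) → ov z = false := fun z => h.ov_eq
  rw [burauDet, det_burau_eq_zero_of_forall_mem (G := G) h.ov_partner hc
    (fun z => ∃ i < m, G.stepsFrom x₀ S i = z) (x₀ := x₀) ⟨0, hm, rfl⟩ (not_forall.mp hall)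
    (fun z hz hgo => ?_) (fun z hz hturn => ?_), mul_zero]
  · by_cases hzS : z ∈ S
    · rw [goWeight, if_pos hzS] at hgo
      exact absurd rfl hgo
    · rwa [← walk_of_notMem hzS, hV]
  · by_cases hzS : z ∈ S
    · rwa [← walk_of_mem' hzS, hV]
    · have hpS : G.partner z ∉ S := fun h' => hzS ((hc z).mp h')
      rw [← walk_of_notMem (G := G) hpS, hV]
      by_contra hpz
      have := hov z hzS hz hpz
      rw [turnWeight, if_neg hzS, if_neg (by simp [this])] at hturn
      exact hturn rfl

/-- The underlying configuration at the start of the exploration. -/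
lemma explored_empty (G : GaussDiagram n) (x₀ : Fin (2 * n)) (t : Bool) :
    G.Explored x₀ t ∅ (fun z => if G.isHead z = true then !t else t) 0 where
  closed z := by simp
  ov_partner z := by
    rw [G.isHead_partner]
    cases G.isHead z <;> simp
  no_return i hi := absurd hi (Nat.not_lt_zero i)
  met z hz := absurd hz (Finset.notMem_empty z)
  head_first i hi := absurd hi (Nat.not_lt_zero i)
  ov_first i hi := absurd hi (Nat.not_lt_zero i)
  fresh z _ := rfl

lemma ascendingFrom_empty (G : GaussDiagram n) (x₀ : Fin (2 * n)) (r : ℝ) :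
    G.ascendingFrom r x₀ ∅ 0 = (G.ascSum.map (Int.castRingHom ℝ)).eval r := by
  classical
  rw [ascendingFrom, ascSum, Polynomial.map_sum, Polynomial.eval_finsetSum]
  refine Finset.sum_congr (Finset.ext fun S' => ?_) fun S' _ => ?_
  · simp only [Finset.mem_filter, Finset.mem_univ, true_and]
    refine and_iff_left ?_
    rintro z ⟨i, hi, -⟩
    exact absurd hi (Nat.not_lt_zero i)
  · rw [realWeight, Polynomial.map_prod, Polynomial.eval_prod]
    simp

lemma eval_ascSum (hG : G.IsClassical) (hx₀ : x₀.val = 0) (hq : 0 < q) :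
    G.burauDet q x₀ ∅ (fun z => !G.isHead z) =
      q ^ (-G.firstSum ∅ 1) * (G.ascSum.map (Int.castRingHom ℝ)).eval (q⁻¹ - q) := by
  have hpp := G.partner_partner
  have h := G.exploration (x₀ := x₀) (t := true) (Φ := G.burauDet q x₀) (r := q⁻¹ - q)
    (c := q ^ (-G.firstSum ∅ 1)) hx₀ ?_ ?_ ?_ (2 * n) 0 ∅ _ (G.explored_empty x₀ true) (by omega)
  · rw [ascendingFrom_empty] at h
    rw [← h, realWeight]
    have : (fun z => if G.isHead z = true then !true else true) = fun z => !G.isHead z := by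
      funext z
      cases G.isHead z <;> rfl
    rw [this]
    simp
  · intro S ov y hS hov hy hh hoy
    have h := burauDet_skein (q := q) (x₀ := x₀) hq hov hS
      (x := G.partner y) (fun h' => hy ((hS y).mp h')) (by rw [hov, hoy]; rfl)
    have e1 : G.changeAt ov (G.partner y) = G.changeAt ov y := by
      funext z
      simp only [changeAt, hpp, or_comm]
    rw [e1, hpp, Finset.insert_comm, G.flatSign_partner, flatSign_eq_of_isHead hh, neg_neg (G.sign y : ℤ),
      zpow_sign_sub] at h
    linarith
  · intro S ov m h hm hret hall
    obtain ⟨pos, hp, hov⟩ := h.exists_numbering hx₀ hret hall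
    rw [hp.burauDet_over hq hx₀ h.closed hov, hp.firstSum_eq hG hx₀ h.closed]
  · exact fun S ov m h hm hret hall => h.burauDet_eq_zero_over hG hq hm hret hall

/-- The starting configuration is that of `eval_ascSum`, but now the skein relation is used to make
every first passage an under passage, and the tails of `G` play the role of the heads. -/
lemma eval_ascSum_flip (hG : G.IsClassical) (hx₀ : x₀.val = 0) (hq : 0 < q) :
    G.burauDet q x₀ ∅ (fun z => !G.isHead z) =
      q ^ (-G.firstSum ∅ 1) * (G.flip.ascSum.map (Int.castRingHom ℝ)).eval (q⁻¹ - q) := by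
  have h := G.flip.exploration (x₀ := x₀) (t := false) (Φ := G.burauDet q x₀) (r := q⁻¹ - q)
    (c := q ^ (-G.firstSum ∅ 1)) hx₀ ?_ ?_ ?_ (2 * n) 0 ∅ _ (G.flip.explored_empty x₀ false)
    (by omega)
  · rw [ascendingFrom_empty] at h
    rw [← h, realWeight]
    have : (fun z => if G.flip.isHead z = true then !false else false) = fun z => !G.isHead z := by
      funext z
      change (if (!G.isHead z) = true then !false else false) = !G.isHead z
      cases G.isHead z <;> rfl
    rw [this]
    simp
  · intro S ov y hS hov hy hh hoy
    have hh' : G.isHead y = false := by simpa [flip, ArrowDiagram.flip] using hh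
    have h := burauDet_skein (G := G) (q := q) (x₀ := x₀) hq hov hS (x := y) hy hoy
    rw [flatSign_eq_of_isTail hh', zpow_sign_sub] at h
    change G.burauDet q x₀ S ov = G.burauDet q x₀ S (G.changeAt ov y) +
      ((G.sign y : ℤ) : ℝ) * (q⁻¹ - q) * G.burauDet q x₀ (insert y (insert (G.partner y) S)) ov
    linarith
  · intro S ov m h hm hret hall
    obtain ⟨pos, hp, hov⟩ := h.exists_numbering hx₀ hret hall
    have hp' : G.IsNumbering x₀ S pos := ⟨hp.base, hp.walk⟩
    rw [hp'.burauDet_under hq hx₀ h.closed h.ov_partner hov, hp'.firstSum_eq hG hx₀ h.closed]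
  · exact fun S ov m h hm hret hall => h.burauDet_eq_zero_under hm hret hall q

theorem IsClassical.ascSum_flip (hG : G.IsClassical) : G.flip.ascSum = G.ascSum := by
  rcases Nat.eq_zero_or_pos n with rfl | hn
  · have : G.flip = G := by
      obtain ⟨⟨p, hp, h, hh⟩, s, hs⟩ := G
      simp only [flip, ArrowDiagram.flip, GaussDiagram.mk.injEq, ArrowDiagram.mk.injEq, true_and,
        and_true]
      exact funext fun i => i.elim0
    rw [this]
  refine Polynomial.map_injective _ (RingHom.injective_int (Int.castRingHom ℝ))
    (Polynomial.funext fun r => ?_)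
  -- The positive root of `q ^ 2 + r * q - 1`.
  obtain ⟨q, hq, rfl⟩ : ∃ q : ℝ, 0 < q ∧ q⁻¹ - q = r := by
    have h1 : 0 < √(r ^ 2 + 4) - r := by
      have : r < √(r ^ 2 + 4) := Real.lt_sqrt_of_sq_lt (by linarith)
      linarith
    have h2 : √(r ^ 2 + 4) ^ 2 = r ^ 2 + 4 := Real.sq_sqrt (by positivity)
    refine ⟨(√(r ^ 2 + 4) - r) / 2, by linarith, ?_⟩
    have h3 := h1.ne'
    field_simp
    nlinarith
  have h1 := eval_ascSum (x₀ := ⟨0, by omega⟩) hG rfl hq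
  have h2 := eval_ascSum_flip (x₀ := ⟨0, by omega⟩) hG rfl hq
  rw [h1] at h2
  exact (mul_left_cancel₀ (zpow_ne_zero _ hq.ne') h2).symm

end GaussDiagram

/-! ### Independence of the base point -/

namespace GaussDiagram

variable {n : ℕ} {G : GaussDiagram n} {S : Finset (Fin (2 * n))}

lemma basedAt_zero (G : GaussDiagram n) : G.basedAt 0 = G := by
  obtain ⟨⟨p, hp, h, hh⟩, s, hs⟩ := G
  rfl

lemma basedAt_succ (G : GaussDiagram n) (j : ℕ) : G.basedAt (j + 1) = (G.basedAt j).basedAt 1 := by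
  simp only [basedAt, pow_succ, pow_zero, one_mul]
  rfl

lemma flip_basedAt (G : GaussDiagram n) (j : ℕ) : (G.basedAt j).flip = G.flip.basedAt j := rfl

section transport

variable (τ : Equiv.Perm (Fin (2 * n)))

lemma isClosed_transport : (G.transport τ).IsClosed (S.image τ) ↔ G.IsClosed S := by
  have hmem : ∀ z, z ∈ S.image τ ↔ τ.symm z ∈ S := fun z => by
    rw [← τ.injective.mem_finset_image (s := S), Equiv.apply_symm_apply]
  refine ⟨fun h z => ?_, fun h z => ?_⟩
  · have := h (τ z)
    rw [transport_partner] at this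
    simpa only [τ.injective.mem_finset_image] using this
  · rw [hmem, hmem, ← h (τ.symm z)]
    simp [transport]

lemma walk_transport (hτ : Commute τ (finRotate (2 * n))) (z : Fin (2 * n)) :
    (G.transport τ).walk (S.image τ) (τ z) = τ (G.walk S z) := by
  have hc : ∀ u, finRotate (2 * n) (τ u) = τ (finRotate (2 * n) u) := fun u =>
    (Equiv.congr_fun hτ.eq u).symm
  simp only [ArrowDiagram.walk, ArrowDiagram.jump, τ.injective.mem_finset_image, transport_partner]
  split_ifs <;> rw [hc]

lemma arrowWeight_transport : (G.transport τ).arrowWeight (S.image τ) = G.arrowWeight S := by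
  simp only [arrowWeight, Finset.prod_filter, Finset.prod_image τ.injective.injOn]
  simp [transport]

end transport

/-- Moving the base point across a tail does not change which sets of arrows ascend. -/
lemma ascends_basedAt_one (hS : G.IsClosed S) {x₀ : Fin (2 * n)} (hx₀ : x₀.val = 0)
    (htail : G.isHead x₀ = false) :
    (G.basedAt 1).Ascends (S.image ((finRotate (2 * n) ^ 1).symm)) ↔ G.Ascends S := by
  have hpp := G.partner_partner
  set τ : Equiv.Perm (Fin (2 * n)) := (finRotate (2 * n) ^ 1).symm with hτdef
  have hτ : Commute τ (finRotate (2 * n)) := (Commute.pow_left (Commute.refl _) 1).inv_left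
  have hwalk : ∀ z, (G.basedAt 1).walk (S.image τ) (τ z) = τ (G.walk S z) := walk_transport τ hτ
  have hinj := (ArrowDiagram.walk_bijective hS).injective
  have h0 : ∀ z : Fin (2 * n), z.val = 0 ↔ z = x₀ := fun z => by rw [Fin.ext_iff, hx₀]
  have h1 : ∀ z, (τ z).val = 0 ↔ z = finRotate (2 * n) x₀ := fun z => by
    rw [h0, hτdef, pow_one, Equiv.symm_apply_eq]
  have hhead : ∀ z, (G.basedAt 1).isHead (τ z) = G.isHead z := fun z =>
    congrArg G.isHead (τ.symm_apply_apply z)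
  have hpart : ∀ z, (G.basedAt 1).partner (τ z) = τ (G.partner z) := G.transport_partner τ
  have hphead : G.isHead (G.partner x₀) = true := by rw [G.isHead_partner, htail]; rfl
  constructor
  · rintro ⟨q, hq, hord⟩
    replace hq : ∀ z, G.walk S z ≠ finRotate (2 * n) x₀ → q (τ z) < q (τ (G.walk S z)) := by
      intro z hz
      have := hq (τ z)
      rw [hwalk, ne_eq, h1] at this
      exact this hz
    replace hord : ∀ z ∈ S, G.isHead z = true → q (τ z) < q (τ (G.partner z)) := by
      intro z hz hh
      have := hord (τ z) (Finset.mem_image_of_mem τ hz) (by rw [hhead, hh])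
      rwa [hpart] at this
    -- From the head of the arrow at `x₀` the walk would go straight to the new base point and close
    -- up before it comes to `x₀`.
    have hx₀S : x₀ ∉ S := by
      intro hxS
      set w := Equiv.ofBijective _ (ArrowDiagram.walk_bijective hS) with hw
      obtain ⟨h2, h3⟩ := Equiv.Perm.pow_eq_of_potential (w := w) (x₀ := finRotate (2 * n) x₀)
        (q := fun z => q (τ z)) (R := fun u v => u = G.partner x₀ ∧ v = x₀) hq (by
          rintro u v ⟨rfl, rfl⟩
          have := hord (G.partner v) ((hS v).mpr hxS) hphead
          rwa [hpp] at this)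
      obtain ⟨l, hl, e⟩ := h3 _ _ ⟨rfl, rfl⟩ _ (Nat.find_spec (h2 x₀))
      have e' : (w ^ (l + 1)) (finRotate (2 * n) x₀) = finRotate (2 * n) x₀ := by
        rw [pow_succ', Equiv.Perm.mul_apply, e]
        change G.walk S (G.partner x₀) = _
        rw [walk_of_mem' ((hS x₀).mpr hxS), hpp]
      refine Nat.find_min (h2 x₀) (m := Nat.find (h2 x₀) - (l + 1)) (by omega) ?_
      refine (congrArg _ e'.symm).trans ?_
      rw [← Equiv.Perm.mul_apply, ← pow_add, Nat.sub_add_cancel (by omega)]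
      exact Nat.find_spec (h2 x₀)
    -- The point `x₀`, which was the last one, becomes the first one.
    refine ⟨fun z => if z = x₀ then 0 else q (τ z) + 1, fun z hz => ?_, fun z hz hh => ?_⟩
    · rw [ne_eq, h0] at hz
      beta_reduce
      rw [if_neg hz]
      split_ifs with h
      · exact Nat.succ_pos _
      · refine Nat.succ_lt_succ (hq z fun e => h (hinj ?_))
        rw [e, walk_of_notMem hx₀S]
    · beta_reduce
      rw [if_neg (fun e : z = x₀ => hx₀S (e ▸ hz)),
        if_neg (fun e : G.partner z = x₀ => hx₀S (e ▸ (hS z).mpr hz))]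
      exact Nat.succ_lt_succ (hord z hz hh)
  · intro hA
    -- The walk begins at `x₀`, so its head could not be met before.
    have hx₀S : x₀ ∉ S := by
      intro hxS
      obtain ⟨l, hl, -⟩ := (hA.steps hS hx₀).2 (G.partner x₀) ((hS x₀).mpr hxS) hphead 0
        (hpp x₀).symm
      exact absurd hl (Nat.not_lt_zero l)
    obtain ⟨q, hq, hord⟩ := hA
    obtain ⟨B, hB⟩ := (Set.finite_range q).bddAbove
    -- The point `x₀` becomes the last one, above the bound `B` of all other values.
    refine ⟨fun v => if τ.symm v = x₀ then B + 1 else q (τ.symm v), fun v hv => ?_,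
      fun v hv hh => ?_⟩
    · obtain ⟨z, rfl⟩ := τ.surjective v
      rw [hwalk, ne_eq, h1] at hv
      simp only [hwalk, Equiv.symm_apply_apply]
      have hz : z ≠ x₀ := by
        rintro rfl
        exact hv (walk_of_notMem hx₀S)
      rw [if_neg hz]
      split_ifs with h
      · exact Nat.lt_succ_of_le (hB ⟨z, rfl⟩)
      · exact hq z fun h' => h ((h0 _).mp h')
    · obtain ⟨z, hz, rfl⟩ := Finset.mem_image.mp hv
      rw [hhead] at hh
      simp only [hpart, Equiv.symm_apply_apply]
      rw [if_neg (fun e : z = x₀ => hx₀S (e ▸ hz)),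
        if_neg (fun e : G.partner z = x₀ => hx₀S (e ▸ (hS z).mpr hz))]
      exact hord z hz hh

lemma ascSum_basedAt_one {x₀ : Fin (2 * n)} (hx₀ : x₀.val = 0) (htail : G.isHead x₀ = false) :
    (G.basedAt 1).ascSum = G.ascSum := by
  classical
  symm
  unfold ascSum
  refine Finset.sum_bij (fun S _ => S.image ((finRotate (2 * n) ^ 1).symm)) ?_ ?_ ?_ ?_
  · intro S hS
    simp only [Finset.mem_filter, Finset.mem_univ, true_and] at hS ⊢
    exact ⟨(isClosed_transport _).mpr hS.1, (ascends_basedAt_one hS.1 hx₀ htail).mpr hS.2⟩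
  · intro S _ T _ h
    exact Finset.image_injective (Equiv.injective _) h
  · intro T hT
    set σ : Equiv.Perm (Fin (2 * n)) := finRotate (2 * n) ^ 1
    have e : (T.image σ).image σ.symm = T := by
      rw [Finset.image_image, Equiv.symm_comp_self, Finset.image_id]
    simp only [Finset.mem_filter, Finset.mem_univ, true_and] at hT
    rw [← e] at hT
    have hc := (isClosed_transport (G := G) _).mp hT.1
    refine ⟨_, ?_, e⟩
    simp only [Finset.mem_filter, Finset.mem_univ, true_and]
    exact ⟨hc, (ascends_basedAt_one hc hx₀ htail).mp hT.2⟩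
  · intro S _
    exact (arrowWeight_transport _).symm

/-- The passages along the faces of the two diagrams are conjugate by the rotation of the labels. -/
lemma faces_basedAt_one (G : GaussDiagram n) : (G.basedAt 1).faces = G.faces := by
  unfold faces
  set θ : Equiv.Perm (Fin (2 * n) × Bool) :=
    Equiv.prodCongr (finRotate (2 * n) ^ 1).symm (Equiv.refl Bool) with hθ
  have hconj : (G.basedAt 1).otherHalf.trans (G.basedAt 1).nextHalf =
      θ * (G.otherHalf.trans G.nextHalf) * θ⁻¹ := by
    have h1 : ∀ x, (G.basedAt 1).otherHalf (θ x) = θ (G.otherHalf x) := by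
      rintro ⟨z, _ | _⟩ <;> simp [hθ, otherHalf, -finRotate_apply, -finRotate_symm_apply]
    have h2 : ∀ x, (G.basedAt 1).nextHalf (θ x) = θ (G.nextHalf x) := by
      rintro ⟨z, b⟩
      simp [hθ, nextHalf, basedAt, transport, crossesRightward, -finRotate_apply,
        -finRotate_symm_apply]
    rw [eq_mul_inv_iff_mul_eq]
    ext1 x
    change (G.basedAt 1).nextHalf ((G.basedAt 1).otherHalf (θ x)) = θ (G.nextHalf (G.otherHalf x))
    rw [h1, h2]
  refine (Nat.card_congr (Quotient.congr θ fun u v => ?_)).symm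
  change Equiv.Perm.SameCycle _ u v ↔ Equiv.Perm.SameCycle _ (θ u) (θ v)
  rw [hconj, Equiv.Perm.sameCycle_conj]
  simp

lemma IsClassical.basedAt_one (hG : G.IsClassical) : (G.basedAt 1).IsClassical := by
  rw [IsClassical, faces_basedAt_one]
  exact hG

/-- If the base point moves across a head, it moves across a tail of the reversed diagram, which has
the same ascending sum. -/
lemma IsClassical.ascSum_basedAt_one (hG : G.IsClassical) : (G.basedAt 1).ascSum = G.ascSum := by
  rcases Nat.eq_zero_or_pos n with rfl | hn
  · rw [show G.basedAt 1 = G from rfl]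
  set x₀ : Fin (2 * n) := ⟨0, by omega⟩
  cases h : G.isHead x₀
  · exact GaussDiagram.ascSum_basedAt_one (x₀ := x₀) rfl h
  · rw [← hG.basedAt_one.ascSum_flip, flip_basedAt, ← hG.ascSum_flip]
    refine GaussDiagram.ascSum_basedAt_one (x₀ := x₀) rfl ?_
    change (!G.isHead x₀) = false
    rw [h]
    rfl

lemma IsClassical.basedAt (hG : G.IsClassical) (j : ℕ) :
    (G.basedAt j).IsClassical ∧ (G.basedAt j).ascSum = G.ascSum := by
  induction j with
  | zero => rw [basedAt_zero]; exact ⟨hG, rfl⟩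
  | succ j ih =>
    rw [basedAt_succ]
    exact ⟨ih.1.basedAt_one, ih.1.ascSum_basedAt_one.trans ih.2⟩

theorem IsClassical.nabla_eq (hG : G.IsClassical) :
    G.nablaAD = 0 ∧ ∀ j : ℕ, (G.basedAt j).nablaA = G.nablaA ∧
      (G.basedAt j).nablaD = G.nablaD ∧ (G.basedAt j).nablaAD = G.nablaAD := by
  have hAD : ∀ {H : GaussDiagram n}, H.IsClassical → H.nablaD = H.nablaA := fun {H} hH => by
    rw [nablaD_eq_flip, nablaA_eq_ascSum, nablaA_eq_ascSum, hH.ascSum_flip]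
  have hA : ∀ j, (G.basedAt j).nablaA = G.nablaA := fun j => by
    rw [nablaA_eq_ascSum, nablaA_eq_ascSum, (hG.basedAt j).2]
  refine ⟨by rw [nablaAD, hAD hG, sub_self], fun j => ⟨hA j, ?_, ?_⟩⟩
  · rw [hAD (hG.basedAt j).1, hAD hG, hA]
  · rw [nablaAD, nablaAD, hAD (hG.basedAt j).1, hAD hG, hA]

end GaussDiagram

theorem mainTheorem11 (ε δ : ℤˣ) :
    -- the three polynomials are invariants of long virtual knots
    (∀ (m n : ℕ) (G : GaussDiagram m) (H : GaussDiagram n), G.LongEquiv H →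
      G.nablaA = H.nablaA ∧ G.nablaD = H.nablaD ∧ G.nablaAD = H.nablaAD) ∧
    -- on Gauss diagrams of classical knots they do not depend on the base point,
    -- and the third one vanishes
    (∀ (n : ℕ) (G : GaussDiagram n), G.IsClassical →
      G.nablaAD = 0 ∧ ∀ j : ℕ, (G.basedAt j).nablaA = G.nablaA ∧
        (G.basedAt j).nablaD = G.nablaD ∧ (G.basedAt j).nablaAD = G.nablaAD) ∧
    -- their values on the Kishino knot, for two positions of the base point
    ((kishinoG ε δ).nablaA = 1 - 2 * X ^ 2 + X ^ 4 ∧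
      (kishinoG ε δ).nablaD = 1 ∧
      (kishinoG ε δ).nablaAD = -2 * X ^ 2 + X ^ 4) ∧
    ((kishinoG' ε δ).nablaA = 1 ∧
      (kishinoG' ε δ).nablaD = 1 - 2 * X ^ 2 + X ^ 4 ∧
      (kishinoG' ε δ).nablaAD = 2 * X ^ 2 - X ^ 4) ∧
    -- the Kishino knot is not classical
    ¬ (kishino ε δ).RepresentsClassicalKnot := by
  refine ⟨fun _ _ _ _ h => h.nabla_eq, fun _ _ hG => hG.nabla_eq, (GaussDiagram.nabla_kishino ε δ).1,
    (GaussDiagram.nabla_kishino ε δ).2, GaussDiagram.not_representsClassicalKnot_kishino ε δ⟩
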